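/- Let $k$ be a field, let $\mathfrak{g}$ be a finite dimensional Lie algebra over $k$, let $n = \dim_k \mathfrak{g}$, and let $U = \operatorname{U}(\mathfrak{g})$ be its universal enveloping algebra. For a finite dimensional $k$-central $U$-bimodule $M$ (the left and right actions of $k$ on $M$ agree), regard the following as $k$-central $U$-bimodules. (i) $\operatorname{Ext}^n_{U}(M, U)$, the Ext group of left $U$-modules; its left action is induced by the right action of $U$ on $M$, and its right action is induced by right multiplication on $U$. (ii) $M^* \otimes_k \bigwedge^n \mathfrak{g}^*$. Here $M^* = \operatorname{Hom}_k(M, k)$ with $(a \cdot \varphi \cdot b)(m) = \varphi(b \cdot m \cdot a)$; $\mathfrak{g}^* = \operatorname{Hom}_k(\mathfrak{g}, k)$ with the right coadjoint action $(f \cdot x)(y) = f([x, y])$ of $\mathfrak{g}$; $\bigwedge^n \mathfrak{g}^*$ has the induced right action $(f_1 \wedge \cdots \wedge f_n) \cdot x = \sum_{i} f_1 \wedge \cdots \wedge (f_i \cdot x) \wedge \cdots \wedge f_n$ and the trivial left action. On the tensor product, $a \cdot (\varphi \otimes \omega) = (a \cdot \varphi) \otimes \omega$ for $a \in U$, and $(\varphi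 \otimes \omega) \cdot x = (\varphi \cdot x) \otimes \omega + \varphi \otimes (\omega \cdot x)$ for $x \in \mathfrak{g}$. Then there is an isomorphism of $U$-bimodules \[ \operatorname{Ext}^n_{U}(M, U) \;\cong\; M^* \otimes_k \textstyle\bigwedge^n \mathfrak{g}^* \] which is functorial in $M$; that is, the two contravariant functors in $M$, from finite dimensional $k$-central $U$-bimodules to $k$-central $U$-bimodules, are naturally isomorphic. -/

import Mathlib

open CategoryTheory Abelian TensorProduct MulOpposite

universe u v w

attribute [local instance 100] LieRing.ofAssociativeRing

noncomputable section

/-! ### Central bimodules over an algebra -/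

/-- A `k`-central bimodule over a `k`-algebra `A`: a `k`-vector space with a `k`-linear left action
and a `k`-linear right action of `A` which commute. The vector `left a m` is `a · m` and the vector
`right (op b) m` is `m · b`. As both actions are algebra maps over `k`, scalars of `k` act in the
same way from the left and from the right. -/
structure CentralBimod (k : Type u) (A : Type w) [Field k] [Ring A] [Algebra k A] where
  carrier : Type w
  [addCommGroup : AddCommGroup carrier]
  [module : Module k carrier]
  left : A →ₐ[k] Module.End k carrier
  right : Aᵐᵒᵖ →ₐ[k] Module.End k carrier
  comm : ∀ (a : A) (b : Aᵐᵒᵖ) (m : carrier), left a (right b m) = right b (left a m)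

namespace CentralBimod

attribute [instance] addCommGroup module

variable {k : Type u} {A : Type w} [Field k] [Ring A] [Algebra k A]

instance : CoeSort (CentralBimod k A) (Type w) := ⟨carrier⟩

/-- Morphisms of bimodules. -/
@[ext]
structure Hom (M N : CentralBimod k A) where
  toLin : M →ₗ[k] N
  map_left : ∀ (a : A) (m : M), toLin (M.left a m) = N.left a (toLin m)
  map_right : ∀ (b : Aᵐᵒᵖ) (m : M), toLin (M.right b m) = N.right b (toLin m)

instance : Category (CentralBimod k A) where
  Hom := Hom
  id M := ⟨LinearMap.id, fun _ _ => rfl, fun _ _ => rfl⟩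
  comp f g := ⟨g.toLin ∘ₗ f.toLin,
    fun a m => by simp [f.map_left, g.map_left], fun a m => by simp [f.map_right, g.map_right]⟩

@[ext]
lemma hom_ext {M N : CentralBimod k A} {f g : M ⟶ N} (h : ∀ m, f.toLin m = g.toLin m) : f = g :=
  Hom.ext (LinearMap.ext h)

@[simp] lemma id_toLin (M : CentralBimod k A) : Hom.toLin (𝟙 M) = LinearMap.id := rfl

@[simp] lemma comp_toLin {M N P : CentralBimod k A} (f : M ⟶ N) (g : N ⟶ P) :
    (f ≫ g).toLin = g.toLin ∘ₗ f.toLin := rfl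

/-- The bimodules which are finite dimensional over `k`. -/
def finDim (k : Type u) (A : Type w) [Field k] [Ring A] [Algebra k A] :
    ObjectProperty (CentralBimod k A) :=
  fun M => FiniteDimensional k M

/-! ### Ext of left modules, as a bimodule -/

/-- The set underlying a bimodule, which carries its structure of a left `A`-module. -/
def LeftMod (M : CentralBimod k A) : Type w := M

instance (M : CentralBimod k A) : AddCommGroup M.LeftMod := inferInstanceAs (AddCommGroup M)

instance (M : CentralBimod k A) : Module A M.LeftMod where
  smul a m := M.left a m
  one_smul m := LinearMap.congr_fun (map_one M.left) m
  mul_smul a b m := LinearMap.congr_fun (map_mul M.left a b) m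
  smul_zero a := map_zero (M.left a)
  smul_add a m m' := map_add (M.left a) m m'
  add_smul a b m := LinearMap.congr_fun (map_add M.left a b) m
  zero_smul m := LinearMap.congr_fun (map_zero M.left) m

/-- The functor from bimodules to left modules which forgets the right action. -/
def toLeft (k : Type u) (A : Type w) [Field k] [Ring A] [Algebra k A] :
    CentralBimod k A ⥤ ModuleCat.{w} A where
  obj M := ModuleCat.of A M.LeftMod
  map {M N} f := ModuleCat.ofHom (X := M.LeftMod) (Y := N.LeftMod)
    { toFun := fun m => f.toLin m
      map_add' := fun m m' => map_add f.toLin m m'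
      map_smul' := fun a m => f.map_left a m }

/-- Right multiplication `m ↦ m · b` on a bimodule `M`, as an endomorphism of the left
module `M`. -/
def rightEnd (M : CentralBimod k A) (b : A) : (toLeft k A).obj M ⟶ (toLeft k A).obj M :=
  ModuleCat.ofHom (X := M.LeftMod) (Y := M.LeftMod)
    { toFun := fun m => M.right (op b) m
      map_add' := fun m m' => map_add (M.right (op b)) m m'
      map_smul' := fun a m => (M.comm a (op b) m).symm }

/-- Right multiplication `a ↦ a * b` on `A`, as an endomorphism of the left module `A`. -/
def regularRightEnd (b : A) : ModuleCat.of A A ⟶ ModuleCat.of A A :=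
  ModuleCat.ofHom
    { toFun := fun a => a * b
      map_add' := fun a a' => add_mul a a' b
      map_smul' := fun c a => mul_assoc c a b }

lemma rightEnd_one (M : CentralBimod k A) : rightEnd M 1 = 𝟙 _ :=
  ModuleCat.hom_ext (LinearMap.ext fun m => LinearMap.congr_fun (map_one M.right) m)

lemma rightEnd_mul (M : CentralBimod k A) (a b : A) :
    rightEnd M (a * b) = rightEnd M a ≫ rightEnd M b :=
  ModuleCat.hom_ext (LinearMap.ext fun m =>
    LinearMap.congr_fun (map_mul M.right (op b) (op a)) m)

lemma rightEnd_add (M : CentralBimod k A) (a b : A) :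
    rightEnd M (a + b) = rightEnd M a + rightEnd M b :=
  ModuleCat.hom_ext (LinearMap.ext fun m =>
    LinearMap.congr_fun (map_add M.right (op a) (op b)) m)

lemma rightEnd_algebraMap (M : CentralBimod k A) (c : k) :
    rightEnd M (algebraMap k A c) = c • 𝟙 _ :=
  ModuleCat.hom_ext (LinearMap.ext fun m =>
    (LinearMap.congr_fun (M.right.commutes c) m).trans
      (LinearMap.congr_fun (M.left.commutes c) m).symm)

lemma regularRightEnd_one : regularRightEnd (1 : A) = 𝟙 _ :=
  ModuleCat.hom_ext (LinearMap.ext fun a => mul_one a)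

lemma regularRightEnd_mul (a b : A) :
    regularRightEnd (a * b) = regularRightEnd a ≫ regularRightEnd b :=
  ModuleCat.hom_ext (LinearMap.ext fun c => (mul_assoc c a b).symm)

lemma regularRightEnd_add (a b : A) :
    regularRightEnd (a + b) = regularRightEnd a + regularRightEnd b :=
  ModuleCat.hom_ext (LinearMap.ext fun c => mul_add c a b)

lemma hom_smul_id (Y : ModuleCat.{w} A) (c : k) (y : Y) :
    (c • 𝟙 Y : Y ⟶ Y).hom y = algebraMap k A c • y := rfl

lemma comp_regularRightEnd_smul {X : ModuleCat.{w} A} {n : ℕ} (ξ : Ext X (ModuleCat.of A A) n)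
    (c : k) (b : A) :
    ξ.comp (Ext.mk₀ (regularRightEnd (c • b))) (add_zero n) =
      c • ξ.comp (Ext.mk₀ (regularRightEnd b)) (add_zero n) := by
  rw [Ext.smul_eq_comp_mk₀, Ext.comp_assoc_of_third_deg_zero, Ext.mk₀_comp_mk₀]
  congr 2
  refine ModuleCat.hom_ext (LinearMap.ext fun a => ?_)
  have h : a * (c • b) = algebraMap k A c * (a * b) := by rw [mul_smul_comm, Algebra.smul_def]
  exact h.trans (hom_smul_id (ModuleCat.of A A) c (a * b)).symm

/-- The vector space `Extⁿ_A(M, A)`, the Ext being taken in the category of left `A`-modules. -/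
abbrev ExtSpace (n : ℕ) (M : CentralBimod k A) : Type w :=
  Ext.{w} ((toLeft k A).obj M) (ModuleCat.of A A) n

variable (n : ℕ)

/-- The left action of `a` on `Extⁿ_A(M, A)`: it is induced by right multiplication by `a` on `M`.
In degree zero it reads `(a · φ)(m) = φ(m · a)`. -/
def extLeft (M : CentralBimod k A) : A →ₐ[k] Module.End k (ExtSpace n M) :=
  AlgHom.ofLinearMap
    { toFun := fun a => Ext.precompOfLinear (Ext.mk₀ (rightEnd M a)) k _ (zero_add n)
      map_add' := fun a b => by
        ext ξ
        simp [rightEnd_add, Ext.mk₀_add]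
      map_smul' := fun c a => by
        ext ξ
        simp [Algebra.smul_def, rightEnd_mul, rightEnd_algebraMap, Ext.mk₀_smul] }
    (by ext ξ; simp [rightEnd_one])
    (fun a b => by
      ext ξ
      simp [rightEnd_mul])

/-- The right action of `b` on `Extⁿ_A(M, A)`: it is induced by right multiplication by `b` on the
coefficients `A`. In degree zero it reads `(φ · b)(m) = φ(m) b`. -/
def extRight (M : CentralBimod k A) : Aᵐᵒᵖ →ₐ[k] Module.End k (ExtSpace n M) :=
  AlgHom.ofLinearMap
    { toFun := fun b =>
        Ext.postcompOfLinear (Ext.mk₀ (regularRightEnd b.unop)) k _ (add_zero n)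
      map_add' := fun a b => by
        ext ξ
        simp [regularRightEnd_add, Ext.mk₀_add]
      map_smul' := fun c a => by
        ext ξ
        exact comp_regularRightEnd_smul ξ c a.unop }
    (by ext ξ; simp [regularRightEnd_one])
    (fun a b => by
      ext ξ
      simp [regularRightEnd_mul])

lemma extLeft_apply (M : CentralBimod k A) (a : A) (ξ : ExtSpace n M) :
    extLeft n M a ξ = (Ext.mk₀ (rightEnd M a)).comp ξ (zero_add n) := rfl

lemma extRight_apply (M : CentralBimod k A) (b : Aᵐᵒᵖ) (ξ : ExtSpace n M) :
    extRight n M b ξ = ξ.comp (Ext.mk₀ (regularRightEnd b.unop)) (add_zero n) := rfl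

/-- The contravariant functor `M ↦ Extⁿ_A(M, A)` from bimodules to bimodules. -/
def extFunctor (k : Type u) (A : Type w) [Field k] [Ring A] [Algebra k A] (n : ℕ) :
    (CentralBimod k A)ᵒᵖ ⥤ CentralBimod k A where
  obj M :=
    { carrier := ExtSpace n M.unop
      left := extLeft n M.unop
      right := extRight n M.unop
      comm := fun a b ξ => by simp [extLeft_apply, extRight_apply] }
  map {M N} f :=
    { toLin := Ext.precompOfLinear (Ext.mk₀ ((toLeft k A).map f.unop)) k _ (zero_add n)
      map_left := fun a ξ => by
        have h : (toLeft k A).map f.unop ≫ rightEnd M.unop a =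
            rightEnd N.unop a ≫ (toLeft k A).map f.unop :=
          ModuleCat.hom_ext (LinearMap.ext fun m => (f.unop.map_right (op a) m).symm)
        simp [extLeft_apply, h]
      map_right := fun b ξ => by simp [extRight_apply] }
  map_id M := by ext ξ; simp
  map_comp f g := by ext ξ; simp

/-! ### Duals and twists of bimodules -/

/-- The linear dual `M* = Homₖ(M, k)` of a bimodule, with `(a · f · b)(m) = f(b · m · a)`. -/
def dual {A : Type (max u v)} [Ring A] [Algebra k A] (M : CentralBimod k A) :
    CentralBimod.{u, max u v} k A where
  carrier := Module.Dual k M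
  left := AlgHom.ofLinearMap
    { toFun := fun a => (M.right (op a)).dualMap
      map_add' := fun a b => by ext; simp
      map_smul' := fun c a => by ext; simp }
    (by ext; simp) (fun a b => by ext; simp)
  right := AlgHom.ofLinearMap
    { toFun := fun b => (M.left b.unop).dualMap
      map_add' := fun a b => by ext; simp
      map_smul' := fun c a => by ext; simp }
    (by ext; simp) (fun a b => by ext; simp)
  comm a b f := by
    ext m
    simp [M.comm]

/-- The contravariant functor `M ↦ M*` from bimodules to bimodules. -/
def dualFunctor (k : Type u) (A : Type (max u v)) [Field k] [Ring A] [Algebra k A] :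
    (CentralBimod.{u, max u v} k A)ᵒᵖ ⥤ CentralBimod.{u, max u v} k A where
  obj M := M.unop.dual
  map f :=
    { toLin := f.unop.toLin.dualMap
      map_left := fun a (φ : Module.Dual k _) => LinearMap.ext fun m =>
        congrArg φ (f.unop.map_right (op a) m).symm
      map_right := fun b (φ : Module.Dual k _) => LinearMap.ext fun m =>
        congrArg φ (f.unop.map_left b.unop m).symm }
  map_id _ := rfl
  map_comp _ _ := rfl

variable {g : Type v} [LieRing g] [LieAlgebra k g]

lemma subalgebra_eq_top (S : Subalgebra k (UniversalEnvelopingAlgebra k g))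
    (hS : ∀ x, UniversalEnvelopingAlgebra.ι k x ∈ S) : S = ⊤ := by
  let f : g →ₗ⁅k⁆ S :=
    { toFun := fun x => ⟨UniversalEnvelopingAlgebra.ι k x, hS x⟩
      map_add' := fun x y => Subtype.ext (map_add _ x y)
      map_smul' := fun c x => Subtype.ext (map_smul (UniversalEnvelopingAlgebra.ι k) c x)
      map_lie' := fun {x y} => Subtype.ext (LieHom.map_lie (UniversalEnvelopingAlgebra.ι k) x y) }
  have h : S.val.comp (UniversalEnvelopingAlgebra.lift k f) = AlgHom.id k _ := by
    ext x
    simp [f]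
  refine eq_top_iff.2 fun a _ => ?_
  have := AlgHom.congr_fun h a
  simp only [AlgHom.comp_apply, AlgHom.id_apply] at this
  rw [← this]
  exact Subtype.property _

/-- Let `M` be a `U(g)`-bimodule and let `W` be a right representation of `g`, that is, a vector
space with a Lie algebra homomorphism `ρ` from `g` to the opposite of `End W`. This is the right
action of `U(g)` on `M ⊗ W` with `(m ⊗ w) · x = (m · x) ⊗ w + m ⊗ (w · x)` for `x` in `g`. -/
def twistRight (M : CentralBimod k (UniversalEnvelopingAlgebra k g)) {W : Type w}
    [AddCommGroup W] [Module k W] (ρ : g →ₗ⁅k⁆ (Module.End k W)ᵐᵒᵖ) :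
    (UniversalEnvelopingAlgebra k g)ᵐᵒᵖ →ₐ[k] Module.End k (M ⊗[k] W) :=
  AlgHom.opComm <| UniversalEnvelopingAlgebra.lift k
    { toFun := fun x => op ((M.right (op (UniversalEnvelopingAlgebra.ι k x))).rTensor W +
        (ρ x).unop.lTensor M)
      map_add' := fun x y => by
        apply unop_injective
        simp [LinearMap.rTensor_add, LinearMap.lTensor_add]
        abel
      map_smul' := fun c x => by
        apply unop_injective
        simp [LinearMap.rTensor_smul, LinearMap.lTensor_smul]
      map_lie' := fun {x y} => by
        apply unop_injective
        ext m w
        simp [LieRing.of_associative_ring_bracket]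
        abel }

lemma twistRight_ι (M : CentralBimod k (UniversalEnvelopingAlgebra k g)) {W : Type w}
    [AddCommGroup W] [Module k W] (ρ : g →ₗ⁅k⁆ (Module.End k W)ᵐᵒᵖ) (x : g) (m : M) (y : W) :
    twistRight M ρ (op (UniversalEnvelopingAlgebra.ι k x)) (m ⊗ₜ y) =
      M.right (op (UniversalEnvelopingAlgebra.ι k x)) m ⊗ₜ y + m ⊗ₜ (ρ x).unop y := by
  refine (LinearMap.congr_fun (congrArg unop (UniversalEnvelopingAlgebra.lift_ι_apply k _ x))
    (m ⊗ₜ[k] y)).trans ?_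
  simp

lemma comp_eq_of_ι {V V' : Type*} [AddCommGroup V] [Module k V] [AddCommGroup V'] [Module k V']
    (r : (UniversalEnvelopingAlgebra k g)ᵐᵒᵖ →ₐ[k] Module.End k V)
    (r' : (UniversalEnvelopingAlgebra k g)ᵐᵒᵖ →ₐ[k] Module.End k V') (f : V →ₗ[k] V')
    (h : ∀ x, f ∘ₗ r (op (UniversalEnvelopingAlgebra.ι k x)) =
      r' (op (UniversalEnvelopingAlgebra.ι k x)) ∘ₗ f)
    (b : (UniversalEnvelopingAlgebra k g)ᵐᵒᵖ) : f ∘ₗ r b = r' b ∘ₗ f := by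
  let S : Subalgebra k (UniversalEnvelopingAlgebra k g) :=
    { carrier := {a | f ∘ₗ r (op a) = r' (op a) ∘ₗ f}
      mul_mem' := fun {a c} (ha : f ∘ₗ r (op a) = r' (op a) ∘ₗ f)
          (hc : f ∘ₗ r (op c) = r' (op c) ∘ₗ f) => by
        change f ∘ₗ r (op (a * c)) = r' (op (a * c)) ∘ₗ f
        rw [op_mul, map_mul, map_mul, Module.End.mul_eq_comp, Module.End.mul_eq_comp,
          ← LinearMap.comp_assoc, hc, LinearMap.comp_assoc, ha, LinearMap.comp_assoc]
      add_mem' := fun {a c} (ha : f ∘ₗ r (op a) = r' (op a) ∘ₗ f)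
          (hc : f ∘ₗ r (op c) = r' (op c) ∘ₗ f) => by
        change f ∘ₗ r (op (a + c)) = r' (op (a + c)) ∘ₗ f
        rw [MulOpposite.op_add, map_add, map_add, LinearMap.comp_add, LinearMap.add_comp, ha, hc]
      algebraMap_mem' := fun c => by
        change f ∘ₗ r (op _) = r' (op _) ∘ₗ f
        rw [← MulOpposite.algebraMap_apply, AlgHom.commutes, AlgHom.commutes]
        ext v
        simp [Module.algebraMap_end_apply] }
  have hS : S = ⊤ := subalgebra_eq_top S h
  have hb : b.unop ∈ S := hS ▸ Algebra.mem_top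
  exact hb

/-- The bimodule `M ⊗ W`, where `M` is a `U(g)`-bimodule and `W` is a right representation `ρ` of
`g`, regarded as a bimodule with trivial left action: `g` acts from the left through `M` only, and
from the right by `(m ⊗ w) · x = (m · x) ⊗ w + m ⊗ (w · x)`. -/
def twist (M : CentralBimod k (UniversalEnvelopingAlgebra k g)) {W : Type (max u v)}
    [AddCommGroup W] [Module k W] (ρ : g →ₗ⁅k⁆ (Module.End k W)ᵐᵒᵖ) :
    CentralBimod k (UniversalEnvelopingAlgebra k g) where
  carrier := M ⊗[k] W
  left := (Module.End.rTensorAlgHom k M W).comp M.left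
  right := twistRight M ρ
  comm a b m := by
    refine LinearMap.congr_fun (comp_eq_of_ι (twistRight M ρ) (twistRight M ρ)
      ((M.left a).rTensor W) (fun x => TensorProduct.ext' fun m w => ?_) b) m
    simp only [LinearMap.comp_apply, LinearMap.rTensor_tmul, twistRight_ι, map_add, M.comm]

/-- The functor `M ↦ M ⊗ W` from bimodules to bimodules. -/
def twistFunctor {W : Type (max u v)}
    [AddCommGroup W] [Module k W] (ρ : g →ₗ⁅k⁆ (Module.End k W)ᵐᵒᵖ) :
    CentralBimod k (UniversalEnvelopingAlgebra k g) ⥤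
      CentralBimod k (UniversalEnvelopingAlgebra k g) where
  obj M := M.twist ρ
  map {M N} f :=
    { toLin := f.toLin.rTensor W
      map_left := fun a => LinearMap.congr_fun (f := f.toLin.rTensor W ∘ₗ (M.left a).rTensor W)
        (g := (N.left a).rTensor W ∘ₗ f.toLin.rTensor W) <| TensorProduct.ext' fun m w => by
          simp only [LinearMap.comp_apply, LinearMap.rTensor_tmul, f.map_left]
      map_right := fun b => LinearMap.congr_fun <|
        comp_eq_of_ι (twistRight M ρ) (twistRight N ρ) (f.toLin.rTensor W)
          (fun x => TensorProduct.ext' fun m w => by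
            simp only [LinearMap.comp_apply, LinearMap.rTensor_tmul, twistRight_ι, map_add,
              f.map_right]) b }
  map_id M := Hom.ext (LinearMap.rTensor_id W M)
  map_comp f h := Hom.ext (LinearMap.rTensor_comp W h.toLin f.toLin)

end CentralBimod

/-! ### Exterior powers of the coadjoint representation -/

namespace exteriorPower

variable {k : Type u} {V : Type v} [Field k] [AddCommGroup V] [Module k V] (p : ℕ)

/-- The alternating map `(v₁, …, vₚ) ↦ ∑ᵢ v₁ ∧ … ∧ φ vᵢ ∧ … ∧ vₚ`. -/
def derivationAlt (φ : Module.End k V) : V [⋀^Fin p]→ₗ[k] ⋀[k]^p V where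
  toMultilinearMap := ∑ i : Fin p, (ιMulti k p).toMultilinearMap.compLinearMap
    (Function.update (fun _ => LinearMap.id) i φ)
  map_eq_zero_of_eq' v i j hv hij := by
    have h (l : Fin p) : (fun m => (Function.update (fun _ => LinearMap.id) l φ :
        Fin p → V →ₗ[k] V) m (v m)) = Function.update v l (φ (v l)) := by
      ext m
      rcases eq_or_ne m l with rfl | hm <;> simp [*]
    simp only [MultilinearMap.toFun_eq_coe, sum_apply,
      MultilinearMap.compLinearMap_apply, h]
    rw [← Finset.add_sum_erase _ _ (Finset.mem_univ i),
      ← Finset.add_sum_erase _ _ (Finset.mem_erase.2 ⟨hij.symm, Finset.mem_univ j⟩),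
      Finset.sum_eq_zero, add_zero]
    · have := (ιMulti k p).map_swap (Function.update v i (φ (v i))) hij
      have h2 : Function.update v i (φ (v i)) ∘ Equiv.swap i j =
          Function.update v j (φ (v j)) := by
        ext m
        rcases eq_or_ne m i with rfl | hi
        · simp [hij, hij.symm, hv]
        rcases eq_or_ne m j with rfl | hj
        · simp [hv]
        · simp [Equiv.swap_apply_of_ne_of_ne hi hj, hi, hj]
      rw [h2] at this
      exact add_eq_zero_iff_eq_neg.2 (by rw [← neg_eq_iff_eq_neg]; exact this.symm)
    · intro l hl
      simp only [Finset.mem_erase, Finset.mem_univ, and_true] at hl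
      refine (ιMulti k p).map_eq_zero_of_eq _ ?_ hij
      simp [hl.1.symm, hl.2.symm, hv]

lemma derivationAlt_apply (φ : Module.End k V) (v : Fin p → V) :
    derivationAlt p φ v = ∑ i, ιMulti k p (Function.update v i (φ (v i))) := by
  change (∑ i : Fin p, (ιMulti k p).toMultilinearMap.compLinearMap
    (Function.update (fun _ => LinearMap.id) i φ)) v = _
  rw [sum_apply]
  refine Finset.sum_congr rfl fun i _ => congrArg (ιMulti k p) (funext fun m => ?_)
  rcases eq_or_ne m i with rfl | hm <;> simp [*]

/-- The extension of an endomorphism `φ` of `V` to the `p`-th exterior power as a derivation,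
`v₁ ∧ … ∧ vₚ ↦ ∑ᵢ v₁ ∧ … ∧ φ vᵢ ∧ … ∧ vₚ`. -/
def derivation (φ : Module.End k V) : Module.End k (⋀[k]^p V) :=
  alternatingMapLinearEquiv (derivationAlt p φ)

lemma derivation_ιMulti (φ : Module.End k V) (v : Fin p → V) :
    derivation p φ (ιMulti k p v) = ∑ i, ιMulti k p (Function.update v i (φ (v i))) := by
  rw [derivation, alternatingMapLinearEquiv_apply_ιMulti, derivationAlt_apply]

lemma end_ext {φ ψ : Module.End k (⋀[k]^p V)}
    (h : ∀ v : Fin p → V, φ (ιMulti k p v) = ψ (ιMulti k p v)) : φ = ψ :=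
  linearMap_ext (AlternatingMap.ext h)

lemma derivation_add (φ ψ : Module.End k V) :
    derivation p (φ + ψ) = derivation p φ + derivation p ψ := by
  refine end_ext p fun v => ?_
  simp only [LinearMap.add_apply, derivation_ιMulti, AlternatingMap.map_update_add,
    Finset.sum_add_distrib]

lemma derivation_smul (c : k) (φ : Module.End k V) :
    derivation p (c • φ) = c • derivation p φ := by
  refine end_ext p fun v => ?_
  simp only [LinearMap.smul_apply, derivation_ιMulti, AlternatingMap.map_update_smul,
    Finset.smul_sum]

lemma derivation_lie (φ ψ : Module.End k V) :
    derivation p (φ * ψ - ψ * φ) =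
      derivation p φ * derivation p ψ - derivation p ψ * derivation p φ := by
  have key (φ ψ : Module.End k V) (v : Fin p → V) :
      derivation p φ (derivation p ψ (ιMulti k p v)) =
        ∑ i, (ιMulti k p (Function.update v i (φ (ψ (v i)))) +
          ∑ j ∈ Finset.univ.erase i, ιMulti k p
            (Function.update (Function.update v i (ψ (v i))) j (φ (v j)))) := by
    rw [derivation_ιMulti, map_sum]
    refine Finset.sum_congr rfl fun i _ => ?_
    rw [derivation_ιMulti, ← Finset.add_sum_erase _ _ (Finset.mem_univ i)]
    refine congrArg₂ (· + ·) (by simp) (Finset.sum_congr rfl fun j hj => ?_)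
    rw [Function.update_of_ne (Finset.mem_erase.1 hj).1]
  have cross : ∀ v : Fin p → V,
      ∑ i, ∑ j ∈ Finset.univ.erase i, ιMulti k p
          (Function.update (Function.update v i (ψ (v i))) j (φ (v j))) =
        ∑ i, ∑ j ∈ Finset.univ.erase i, ιMulti k p
          (Function.update (Function.update v i (φ (v i))) j (ψ (v j))) := by
    intro v
    rw [Finset.sum_comm' (t' := Finset.univ) (s' := fun j => Finset.univ.erase j)
      (fun i j => by simp [eq_comm])]
    refine Finset.sum_congr rfl fun i _ => Finset.sum_congr rfl fun j hj => ?_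
    rw [Function.update_comm (Finset.mem_erase.1 hj).1]
  refine end_ext p fun v => ?_
  rw [LinearMap.sub_apply, Module.End.mul_apply, Module.End.mul_apply, key, key,
    Finset.sum_add_distrib, Finset.sum_add_distrib, cross, add_sub_add_right_eq_sub,
    derivation_ιMulti, ← Finset.sum_sub_distrib]
  simp only [LinearMap.sub_apply, Module.End.mul_apply, AlternatingMap.map_update_sub]

end exteriorPower

/-- The right action of `g` on `⋀ᵖ g*` induced by the right coadjoint action
`(f · x)(y) = f([x, y])` of `g` on its dual `g*`:
`(f₁ ∧ … ∧ fₚ) · x = ∑ᵢ f₁ ∧ … ∧ (fᵢ · x) ∧ … ∧ fₚ`. -/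
def coadjointRight (k : Type u) (g : Type v) [Field k] [LieRing g] [LieAlgebra k g] (p : ℕ) :
    g →ₗ⁅k⁆ (Module.End k (⋀[k]^p (Module.Dual k g)))ᵐᵒᵖ where
  toFun x := op (exteriorPower.derivation p (LieAlgebra.ad k g x).dualMap)
  map_add' x y := by
    have h : (LieAlgebra.ad k g (x + y)).dualMap =
        (LieAlgebra.ad k g x).dualMap + (LieAlgebra.ad k g y).dualMap := by ext; simp
    rw [h, exteriorPower.derivation_add, MulOpposite.op_add]
  map_smul' c x := by
    have h : (LieAlgebra.ad k g (c • x)).dualMap = c • (LieAlgebra.ad k g x).dualMap := by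
      ext; simp
    rw [h, exteriorPower.derivation_smul, MulOpposite.op_smul, RingHom.id_apply]
  map_lie' {x y} := by
    have h : (LieAlgebra.ad k g ⁅x, y⁆).dualMap =
        (LieAlgebra.ad k g y).dualMap * (LieAlgebra.ad k g x).dualMap -
          (LieAlgebra.ad k g x).dualMap * (LieAlgebra.ad k g y).dualMap := by ext; simp
    rw [h, exteriorPower.derivation_lie, MulOpposite.op_sub, MulOpposite.op_mul,
      MulOpposite.op_mul, LieRing.of_associative_ring_bracket]

end

/-! Write `U` for the enveloping algebra. As a left `U`-module, `M` is resolved by the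
Chevalley–Eilenberg complex `U ⊗ M ⊗ ⋀ g`, the homology complex of `g` with coefficients in `U ⊗ M`,
where `x` acts by `u ⊗ m ↦ -ux ⊗ m + u ⊗ xm`; left multiplication by `U` commutes with everything.
By the Poincaré–Birkhoff–Witt theorem, `x` acts on `U ⊗ M` as multiplication by a variable on
polynomials, up to terms of lower degree. The complex is therefore a deformation of a Koszul
complex, and the Koszul homotopies, one for each variable, contract it by induction on the degree
(`ContractingData.exact`, `exact_zero`, `exact_succ`).

The resolution has length `n`, so `Extⁿ(M, U)` is the space of linear maps `c : M ⊗ ⋀ⁿ g → U` modulo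
coboundaries. Let `θ_x` be the action of `x` on the complex. Cartan's formula `d(x ∧ z) = θ_x z - x
∧ d z`, in which `x ∧ z = 0` when `z` has top degree, shows that the coboundaries are the sums of
cochains `c ∘ θ_x - x c`, now with the diagonal action `θ_x` on `M ⊗ ⋀ⁿ g` (`extClass_comp_theta`,
`cochain_eq_sum`).

The comparison map sends a form `μ` in `M* ⊗ ⋀ⁿ g*`, seen as a linear form on `M ⊗ ⋀ⁿ g`, to the
class of the scalar cochain `l ↦ μ(l) · 1`. Scalars commute with `x`, so the class of `μ x = x μ` is
the class of `μ ∘ θ_x`; this is the twisted right action (`toExtLin_right`). The left action and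
naturality come from functoriality of the resolution (`toExtLin_dualMap`).

Surjectivity: `M ⊗ ⋀ g` is finite dimensional, so each cochain is a finite sum of scalar cochains
multiplied on the right by elements of `U`, and the image is stable under the right action.
Injectivity: suppose `μ` is a sum of cochains `c_i ∘ θ_{b_i} - b_i c_i`. Let `U` act on `M ⊗ ⋀ g`
through `θ` and fix `l`. Then the rank one operator `l' ↦ μ(l') l` is a sum of commutators, and its
trace `μ(l)` is zero (`dual_eq_zero_of_sum`). This works in every characteristic. -/

noncomputable section

/-! ### The Poincaré–Birkhoff–Witt theorem -/

namespace PBW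

variable {k : Type u} {g : Type v} [Field k] [LieRing g] [LieAlgebra k g]
variable {ι : Type w}

/-- The space of polynomials in variables indexed by `ι`. -/
abbrev Poly (k : Type u) (ι : Type w) [Field k] : Type (max u w) := (ι →₀ ℕ) →₀ k

/-- The monomial with exponents `a`. -/
abbrev mono (k : Type u) [Field k] (a : ι →₀ ℕ) : Poly k ι := Finsupp.single a 1

/-- The polynomials of degree less than `r`. -/
def filt (k : Type u) (ι : Type w) [Field k] (r : ℕ) : Submodule k (Poly k ι) :=
  Finsupp.supported k k {a | a.degree < r}

lemma mono_mem_filt {a : ι →₀ ℕ} {r : ℕ} (h : a.degree < r) : mono k a ∈ filt k ι r :=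
  Finsupp.single_mem_supported k _ h

lemma filt_mono {r s : ℕ} (h : r ≤ s) : filt k ι r ≤ filt k ι s :=
  Finsupp.supported_mono fun _ ha => lt_of_lt_of_le ha h

lemma filt_eq_span (r : ℕ) :
    filt k ι r = Submodule.span k {v | ∃ a : ι →₀ ℕ, a.degree < r ∧ v = mono k a} := by
  rw [filt, Finsupp.supported_eq_span_single]
  congr 1
  ext v
  simp [eq_comm]

lemma filt_le_comap {W : Type*} [AddCommGroup W] [Module k W] (f : Poly k ι →ₗ[k] W)
    (S : Submodule k W) {r : ℕ} (h : ∀ a : ι →₀ ℕ, a.degree < r → f (mono k a) ∈ S) :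
    filt k ι r ≤ S.comap f := by
  rw [filt_eq_span, Submodule.span_le]
  rintro _ ⟨a, ha, rfl⟩
  exact h a ha

lemma eq_of_mem_filt {W : Type*} [AddCommGroup W] [Module k W] (f f' : Poly k ι →ₗ[k] W)
    {r : ℕ} (h : ∀ a : ι →₀ ℕ, a.degree < r → f (mono k a) = f' (mono k a)) {v : Poly k ι}
    (hv : v ∈ filt k ι r) : f v = f' v := by
  have := filt_le_comap (f - f') ⊥ (r := r) (fun a ha => by simp [h a ha]) hv
  simpa [sub_eq_zero] using this

lemma exists_mem_filt (v : Poly k ι) : ∃ r, v ∈ filt k ι r := by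
  induction v using Finsupp.induction_linear with
  | zero => exact ⟨0, zero_mem _⟩
  | add v w hv hw =>
    obtain ⟨r, hr⟩ := hv
    obtain ⟨s, hs⟩ := hw
    exact ⟨max r s, add_mem (filt_mono (le_max_left _ _) hr) (filt_mono (le_max_right _ _) hs)⟩
  | single a c => exact ⟨a.degree + 1, Finsupp.single_mem_supported k _ (Nat.lt_succ_self _)⟩

/-- Multiplication by a variable. -/
def shift (k : Type u) [Field k] (i : ι) : Module.End k (Poly k ι) :=
  Finsupp.lmapDomain k k (· + Finsupp.single i 1)

@[simp]
lemma shift_mono (i : ι) (a : ι →₀ ℕ) :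
    shift k i (mono k a) = mono k (a + Finsupp.single i 1) := by
  simp [shift, mono]

lemma degree_add_single (a : ι →₀ ℕ) (i : ι) : (a + Finsupp.single i 1).degree = a.degree + 1 := by
  simp

lemma shift_mem {i : ι} {r : ℕ} {v : Poly k ι} (hv : v ∈ filt k ι r) :
    shift k i v ∈ filt k ι (r + 1) :=
  filt_le_comap (shift k i) (filt k ι (r + 1)) (fun a ha => by
    rw [shift_mono]
    exact mono_mem_filt (by rw [degree_add_single]; omega)) hv

lemma add_single_sub (a : ι →₀ ℕ) (i : ι) :
    a + Finsupp.single i 1 - Finsupp.single i 1 = a := by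
  simp

lemma eq_zero_of_degree {a : ι →₀ ℕ} (h : a.degree = 0) : a = 0 := by
  rwa [Finsupp.degree_eq_zero_iff] at h

lemma basis_induction (b : Module.Basis ι k g) {P : g → Prop} (zero : P 0)
    (add : ∀ x y, P x → P y → P (x + y)) (smul : ∀ (c : k) x, P x → P (c • x))
    (basis : ∀ i, P (b i)) (x : g) : P x := by
  have hx : x ∈ Submodule.span k (Set.range b) := by rw [b.span_eq]; trivial
  induction hx using Submodule.span_induction with
  | mem x hx => obtain ⟨i, rfl⟩ := hx; exact basis i
  | zero => exact zero
  | add x y _ _ hx hy => exact add x y hx hy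
  | smul c x _ hx => exact smul c x hx

lemma support_add_single_nonempty (b : ι →₀ ℕ) (j : ι) :
    (b + Finsupp.single j 1).support.Nonempty := ⟨j, by simp⟩

variable [LinearOrder ι]

lemma exists_eq_add_single {a : ι →₀ ℕ} (ha : a.support.Nonempty) :
    ∃ b : ι →₀ ℕ, a = b + Finsupp.single (a.support.min' ha) 1 ∧
      ∀ l ∈ b.support, a.support.min' ha ≤ l := by
  have h := a.support.min'_mem ha
  have hle : Finsupp.single (a.support.min' ha) 1 ≤ a := by
    rw [Finsupp.single_le_iff]
    exact Nat.one_le_iff_ne_zero.2 (Finsupp.mem_support_iff.1 h)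
  refine ⟨a - Finsupp.single (a.support.min' ha) 1, (tsub_add_cancel_of_le hle).symm,
    fun l hl => Finset.min'_le _ _ ?_⟩
  rw [Finsupp.mem_support_iff] at hl ⊢
  intro h0
  simp [h0] at hl

lemma le_of_mem_support_add_single {b : ι →₀ ℕ} {j i l : ι} (hb : ∀ l ∈ b.support, i ≤ l)
    (hij : i ≤ j) (hl : l ∈ (b + Finsupp.single j 1).support) : i ≤ l := by
  rcases eq_or_ne l j with rfl | h
  · exact hij
  · refine hb l ?_
    simpa [Finsupp.single_apply, h.symm] using hl

lemma min'_add_single {b : ι →₀ ℕ} {j : ι} (hb : ∀ l ∈ b.support, j ≤ l) :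
    (b + Finsupp.single j 1).support.min' (support_add_single_nonempty b j) = j :=
  le_antisymm (Finset.min'_le _ _ (by simp))
    (Finset.le_min' _ _ _ fun _ hl => le_of_mem_support_add_single hb le_rfl hl)

/-! ### Construction of the action of `g` on polynomials. -/

variable (b : Module.Basis ι k g)

/-- The lower order part of the action of the basis vector `b i` on monomials of degree at
most `p`. -/
def corr : ℕ → ι → Module.End k (Poly k ι)
  | 0, _ => 0
  -- Let `j` be the least index of `a` and `a = c + e_j`. For `j < i` the value is forced by `b_i
  -- b_j x_c = b_j b_i x_c + [b_i, b_j] x_c`: the part `x_i x_c` of `b_i x_c` yields the leading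
  -- term, and the rest of `b_i x_c` is `corr p i x_c`. The natural number is fuel, sufficient in
  -- degrees at most its value.
  | p + 1, i => Finsupp.linearCombination k fun a =>
      if h : a.support.Nonempty then
        if a.support.min' h < i then
          (shift k (a.support.min' h) + corr p (a.support.min' h))
              (corr p i (mono k (a - Finsupp.single (a.support.min' h) 1))) +
            b.constr k (fun j => shift k j + corr p j) ⁅b i, b (a.support.min' h)⁆
              (mono k (a - Finsupp.single (a.support.min' h) 1))
        else 0
      else 0

/-- The action of `g` on monomials of degree at most `p`. -/
def actAux (p : ℕ) : g →ₗ[k] Module.End k (Poly k ι) :=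
  b.constr k fun j => shift k j + corr b p j

lemma actAux_basis (p : ℕ) (i : ι) : actAux b p (b i) = shift k i + corr b p i :=
  b.constr_basis k _ i

lemma corr_of_le (p : ℕ) {i : ι} {a : ι →₀ ℕ} (h : ∀ l ∈ a.support, i ≤ l) :
    corr b p i (mono k a) = 0 := by
  cases p with
  | zero => simp [corr]
  | succ p =>
    rw [corr, Finsupp.linearCombination_single, one_smul]
    split_ifs with h1 h2
    · exact absurd h2 (not_lt.2 (h _ (Finset.min'_mem _ _)))
    · rfl
    · rfl

lemma corr_succ (p : ℕ) {i j : ι} {a : ι →₀ ℕ} (hji : j < i) (h : ∀ l ∈ a.support, j ≤ l) :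
    corr b (p + 1) i (mono k (a + Finsupp.single j 1)) =
      actAux b p (b j) (corr b p i (mono k a)) + actAux b p ⁅b i, b j⁆ (mono k a) := by
  rw [corr, Finsupp.linearCombination_single, one_smul, dif_pos (support_add_single_nonempty a j)]
  simp only [min'_add_single h, if_pos hji, add_single_sub]
  rw [actAux_basis, actAux]

/-- The dichotomy used for inductions: either `i` needs no reordering, or the least variable, which
is smaller than `i`, splits off. Two consecutive stages appear because stability compares them. -/
lemma eq_corr_induction (p : ℕ) (i : ι) (a : ι →₀ ℕ) :
    corr b (p + 1) i (mono k a) = 0 ∧ corr b (p + 2) i (mono k a) = 0 ∨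
      ∃ j c, j < i ∧ a = c + Finsupp.single j 1 ∧ ∀ l ∈ c.support, j ≤ l := by
  by_cases h : a.support.Nonempty
  · obtain ⟨c, hc, hc'⟩ := exists_eq_add_single h
    by_cases hi : a.support.min' h < i
    · exact Or.inr ⟨_, c, hi, hc, hc'⟩
    · have h' : ∀ l ∈ a.support, i ≤ l := fun l hl => (not_lt.1 hi).trans (Finset.min'_le _ _ hl)
      exact Or.inl ⟨corr_of_le b _ h', corr_of_le b _ h'⟩
  · rw [Finset.not_nonempty_iff_eq_empty] at h
    have h' : ∀ l ∈ a.support, i ≤ l := by simp [h]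
    exact Or.inl ⟨corr_of_le b _ h', corr_of_le b _ h'⟩

lemma actAux_mem_of {p r : ℕ} (h : ∀ i, ∀ v ∈ filt k ι r, corr b p i v ∈ filt k ι r) (x : g)
    {v : Poly k ι} (hv : v ∈ filt k ι r) : actAux b p x v ∈ filt k ι (r + 1) := by
  induction x using basis_induction b with
  | zero => simp
  | add x y hx hy =>
    rw [map_add]
    exact add_mem hx hy
  | smul c x hx =>
    rw [map_smul]
    exact Submodule.smul_mem _ _ hx
  | basis i =>
    rw [actAux_basis]
    exact add_mem (shift_mem hv) (filt_mono (Nat.le_succ r) (h i v hv))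

/-- The recursion passes through a monomial of degree one less, and one further action of `g` raises
the degree by at most one. -/
lemma corr_mem (p : ℕ) : ∀ (r : ℕ) (i : ι), ∀ v ∈ filt k ι r, corr b p i v ∈ filt k ι r := by
  induction p with
  | zero => intro r i v _; simp [corr]
  | succ p ih =>
    intro r i v hv
    refine filt_le_comap (corr b (p + 1) i) (filt k ι r) (fun a ha => ?_) hv
    obtain h | ⟨j, c, hji, rfl, hc⟩ := eq_corr_induction b p i a
    · rw [h.1]; exact zero_mem _
    · rw [corr_succ b p hji hc]
      rw [degree_add_single] at ha
      obtain ⟨r, rfl⟩ : ∃ s, r = s + 1 := ⟨r - 1, by omega⟩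
      have hc' : mono k c ∈ filt k ι r := mono_mem_filt (by omega)
      exact add_mem (actAux_mem_of b (ih r) _ (ih r i _ hc')) (actAux_mem_of b (ih r) _ hc')

lemma actAux_congr {p q : ℕ} {v : Poly k ι} (h : ∀ i, corr b p i v = corr b q i v) (x : g) :
    actAux b p x v = actAux b q x v := by
  induction x using basis_induction b with
  | zero => simp
  | add x y hx hy => rw [map_add, map_add, LinearMap.add_apply, LinearMap.add_apply, hx, hy]
  | smul c x hx => rw [map_smul, map_smul, LinearMap.smul_apply, LinearMap.smul_apply, hx]
  | basis i => rw [actAux_basis, actAux_basis, LinearMap.add_apply, LinearMap.add_apply, h]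

/-- On monomials of degree at most `p` the recursion bottoms out within `p` steps, so more fuel
changes nothing. This makes `lower` well behaved. -/
lemma corr_stable_succ (p : ℕ) :
    ∀ i, ∀ v ∈ filt k ι (p + 1), corr b (p + 1) i v = corr b p i v := by
  induction p with
  | zero =>
    refine fun i v hv => eq_of_mem_filt _ _ (fun a ha => ?_) hv
    have h0 : a = 0 := eq_zero_of_degree (by omega)
    subst h0
    rw [corr_of_le, corr_of_le] <;> simp
  | succ p ih =>
    refine fun i v hv => eq_of_mem_filt _ _ (fun a ha => ?_) hv
    obtain h | ⟨j, c, hji, rfl, hc⟩ := eq_corr_induction b p i a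
    · rw [h.1, h.2]
    · rw [degree_add_single] at ha
      have hc' : mono k c ∈ filt k ι (p + 1) := mono_mem_filt (by omega)
      rw [corr_succ b _ hji hc, corr_succ b _ hji hc, ih i _ hc',
        actAux_congr b (fun l => ih l _ (corr_mem b p _ i _ hc')),
        actAux_congr b (fun l => ih l _ hc')]

lemma corr_stable {p r : ℕ} (h : p ≤ r) (i : ι) {v : Poly k ι} (hv : v ∈ filt k ι (p + 1)) :
    corr b r i v = corr b p i v := by
  induction r, h using Nat.le_induction with
  | base => rfl
  | succ r hr ih => rw [corr_stable_succ b r i v (filt_mono (by omega) hv), ih]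

/-- The lower order part of the action of the basis vector `b i`. -/
def lower (i : ι) : Module.End k (Poly k ι) :=
  Finsupp.linearCombination k fun a => corr b a.degree i (mono k a)

lemma lower_eq (i : ι) {p : ℕ} {v : Poly k ι} (hv : v ∈ filt k ι (p + 1)) :
    lower b i v = corr b p i v :=
  eq_of_mem_filt _ _ (fun a ha => by
    rw [lower, Finsupp.linearCombination_single, one_smul,
      corr_stable b (Nat.lt_succ_iff.1 ha) i (mono_mem_filt (Nat.lt_succ_self _))]) hv

/-- The action of `g` on polynomials. -/
def act : g →ₗ[k] Module.End k (Poly k ι) := b.constr k fun j => shift k j + lower b j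

lemma act_basis (i : ι) : act b (b i) = shift k i + lower b i := b.constr_basis k _ i

lemma act_eq (x : g) {p : ℕ} {v : Poly k ι} (hv : v ∈ filt k ι (p + 1)) :
    act b x v = actAux b p x v := by
  induction x using basis_induction b with
  | zero => simp
  | add x y hx hy => rw [map_add, map_add, LinearMap.add_apply, LinearMap.add_apply, hx, hy]
  | smul c x hx => rw [map_smul, map_smul, LinearMap.smul_apply, LinearMap.smul_apply, hx]
  | basis i =>
    rw [actAux_basis, act_basis, LinearMap.add_apply, LinearMap.add_apply, lower_eq b i hv]

lemma lower_mem {i : ι} {r : ℕ} {v : Poly k ι} (hv : v ∈ filt k ι r) :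
    lower b i v ∈ filt k ι r := by
  rw [lower_eq b i (filt_mono (Nat.le_succ r) hv)]
  exact corr_mem b _ _ i v hv

lemma act_of_le {i : ι} {a : ι →₀ ℕ} (h : ∀ l ∈ a.support, i ≤ l) :
    act b (b i) (mono k a) = mono k (a + Finsupp.single i 1) := by
  rw [act_basis, LinearMap.add_apply, shift_mono, lower, Finsupp.linearCombination_single,
    corr_of_le b _ h, smul_zero, add_zero]

/-- When `j` does not exceed any index of `a`, the commutation relation is the defining recursion,
and the leading terms `x_i x_j x_a` agree. -/
lemma act_of_lt {i j : ι} {a : ι →₀ ℕ} (hji : j < i) (h : ∀ l ∈ a.support, j ≤ l) :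
    act b (b i) (act b (b j) (mono k a)) =
      act b (b j) (act b (b i) (mono k a)) + act b ⁅b i, b j⁆ (mono k a) := by
  have ha : mono k a ∈ filt k ι (a.degree + 1) := mono_mem_filt (Nat.lt_succ_self _)
  have ha' : mono k (a + Finsupp.single j 1) ∈ filt k ι (a.degree + 1 + 1) :=
    mono_mem_filt (by rw [degree_add_single]; omega)
  have h1 : act b (b i) (mono k (a + Finsupp.single j 1)) =
      mono k (a + Finsupp.single j 1 + Finsupp.single i 1) +
        (act b (b j) (lower b i (mono k a)) + act b ⁅b i, b j⁆ (mono k a)) := by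
    rw [act_eq b _ ha', actAux_basis, LinearMap.add_apply, shift_mono, corr_succ b _ hji h,
      act_eq b _ ha, act_eq b _ (lower_mem b ha), lower_eq b i ha]
  have h2 : act b (b i) (mono k a) =
      mono k (a + Finsupp.single i 1) + lower b i (mono k a) := by
    rw [act_basis, LinearMap.add_apply, shift_mono]
  rw [act_of_le b h, h1, h2, map_add,
    act_of_le b fun l hl => le_of_mem_support_add_single h hji.le hl, add_right_comm a]
  abel

lemma act_lie_of_basis {v : Poly k ι}
    (h : ∀ i j, j < i → act b (b i) (act b (b j) v) =
      act b (b j) (act b (b i) v) + act b ⁅b i, b j⁆ v) (x y : g) :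
    act b x (act b y v) = act b y (act b x v) + act b ⁅x, y⁆ v := by
  induction x using basis_induction b with
  | zero => simp
  | add x x' hx hx' =>
    simp only [map_add, LinearMap.add_apply, add_lie, hx, hx']
    abel
  | smul c x hx => simp only [map_smul, LinearMap.smul_apply, smul_lie, hx, smul_add]
  | basis i =>
    induction y using basis_induction b with
    | zero => simp
    | add y y' hy hy' =>
      simp only [map_add, LinearMap.add_apply, lie_add, hy, hy']
      abel
    | smul c y hy => simp only [map_smul, LinearMap.smul_apply, lie_smul, hy, smul_add]
    | basis j =>
      rcases lt_trichotomy j i with hji | rfl | hij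
      · exact h i j hji
      · simp
      · rw [h j i hij, ← lie_skew (b j), map_neg, LinearMap.neg_apply, neg_add_cancel_right]

/-- The only case not built into the definition is a least index `l < j < i`. There `x_a = b_l x_c`;
the operator `b_l` is moved to the left past `b_i` and `b_j`, the relations on `x_c` hold by
induction on the degree, and the double brackets cancel by the Jacobi identity. -/
lemma act_lie_of_mem (r : ℕ) : ∀ v ∈ filt k ι r, ∀ x y : g,
    act b x (act b y v) = act b y (act b x v) + act b ⁅x, y⁆ v := by
  induction r with
  | zero =>
    intro v hv x y
    have : v = 0 := by simpa [filt] using hv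
    simp [this]
  | succ r ih =>
    intro v hv x y
    refine eq_of_mem_filt (act b x ∘ₗ act b y) (act b y ∘ₗ act b x + act b ⁅x, y⁆)
      (fun a ha => ?_) hv
    refine act_lie_of_basis b (fun i j hji => ?_) x y
    by_cases hj : ∀ l ∈ a.support, j ≤ l
    · exact act_of_lt b hji hj
    push Not at hj
    obtain ⟨l', hl', hl'j⟩ := hj
    have hne : a.support.Nonempty := ⟨l', hl'⟩
    obtain ⟨c, hac, hc⟩ := exists_eq_add_single hne
    have hlj : a.support.min' hne < j := (Finset.min'_le _ _ hl').trans_lt hl'j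
    generalize a.support.min' hne = l at hac hc hlj
    subst hac
    rw [degree_add_single] at ha
    have hcr : mono k c ∈ filt k ι r := mono_mem_filt (by omega)
    -- Split `b_t x_c` into the monomial `x_t x_c`, for which `l` is still minimal, and a part of
    -- degree at most that of `c`, covered by the induction hypothesis.
    have key : ∀ s t, l < s → l < t → act b (b s) (act b (b l) (act b (b t) (mono k c))) =
        act b (b l) (act b (b s) (act b (b t) (mono k c))) +
          act b ⁅b s, b l⁆ (act b (b t) (mono k c)) := by
      intro s t hs ht
      have : act b (b t) (mono k c) =
          mono k (c + Finsupp.single t 1) + lower b t (mono k c) := by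
        rw [act_basis, LinearMap.add_apply, shift_mono]
      simp only [this, map_add]
      rw [act_of_lt b hs fun m hm => le_of_mem_support_add_single hc ht.le hm,
        ih _ (lower_mem b hcr) (b s) (b l)]
      abel
    have hm := ih _ hcr
    have hli : l < i := hlj.trans hji
    rw [← act_of_le b hc, hm (b j) (b l), hm (b i) (b l), map_add, map_add, key i j hli hlj,
      key j i hlj hli, hm (b i) (b j), hm (b i) ⁅b j, b l⁆, hm (b j) ⁅b i, b l⁆, map_add,
      hm ⁅b i, b j⁆ (b l)]
    have jac : act b ⁅b i, ⁅b j, b l⁆⁆ (mono k c) = act b ⁅⁅b i, b j⁆, b l⁆ (mono k c) +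
        act b ⁅b j, ⁅b i, b l⁆⁆ (mono k c) := by
      rw [← LinearMap.add_apply, ← map_add, ← leibniz_lie]
    rw [jac]
    abel

/-- The representation of `g` on the space of polynomials underlying the
Poincaré–Birkhoff–Witt theorem. -/
def rep : g →ₗ⁅k⁆ Module.End k (Poly k ι) where
  toLinearMap := act b
  map_lie' {x y} := by
    refine LinearMap.ext fun v => ?_
    obtain ⟨r, hr⟩ := exists_mem_filt v
    have := act_lie_of_mem b r v hr x y
    simp only [AddHom.toFun_eq_coe, LinearMap.coe_toAddHom]
    rw [LieRing.of_associative_ring_bracket, LinearMap.sub_apply, Module.End.mul_apply,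
      Module.End.mul_apply, this, add_sub_cancel_left]

lemma rep_apply (x : g) : rep b x = act b x := rfl

/-! ### The symbol map and its inverse. -/

/-- The right action of the enveloping algebra on polynomials for which `x` in `g` acts
by `-rep b x`. -/
def rightRep : UniversalEnvelopingAlgebra k g →ₐ[k] (Module.End k (Poly k ι))ᵐᵒᵖ :=
  UniversalEnvelopingAlgebra.lift k
    -- The sign turns a left representation into a homomorphism to the opposite algebra.
    { toFun := fun x => op (-act b x)
      map_add' := fun x y => by
        refine unop_injective (LinearMap.ext fun v => ?_)
        simp [add_comm]
      map_smul' := fun c x => by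
        refine unop_injective (LinearMap.ext fun v => ?_)
        simp
      map_lie' := fun {x y} => by
        refine unop_injective (LinearMap.ext fun v => ?_)
        have := (rep b).map_lie x y
        simp only [rep_apply] at this
        simp [this, LieRing.of_associative_ring_bracket] }

lemma rightRep_ι (x : g) :
    (rightRep b (UniversalEnvelopingAlgebra.ι k x)).unop = -act b x :=
  congrArg unop (UniversalEnvelopingAlgebra.lift_ι_apply k _ x)

/-- The symbol of an element of the enveloping algebra. -/
def symbol : UniversalEnvelopingAlgebra k g →ₗ[k] Poly k ι where
  toFun u := (rightRep b u).unop (mono k 0)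
  map_add' u v := by simp
  map_smul' c u := by simp

lemma symbol_mul_ι (u : UniversalEnvelopingAlgebra k g) (x : g) :
    symbol b (u * UniversalEnvelopingAlgebra.ι k x) = -act b x (symbol b u) := by
  change (rightRep b (u * _)).unop (mono k 0) = _
  rw [map_mul, unop_mul, rightRep_ι]
  rfl

lemma symbol_one : symbol b 1 = mono k 0 := by simp [symbol]

lemma monomial_induction {P : (ι →₀ ℕ) → Prop} (h0 : P 0)
    (h : ∀ a i, (∀ l ∈ a.support, i ≤ l) → P a → P (a + Finsupp.single i 1)) (a : ι →₀ ℕ) :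
    P a := by
  induction hn : a.degree generalizing a with
  | zero =>
    have : a = 0 := eq_zero_of_degree hn
    exact this ▸ h0
  | succ n ih =>
    have hne : a.support.Nonempty := by
      rw [Finset.nonempty_iff_ne_empty, Ne, Finsupp.support_eq_empty]
      rintro rfl
      simp at hn
    obtain ⟨c, hac, hc⟩ := exists_eq_add_single hne
    generalize a.support.min' hne = l at hac hc
    subst hac
    rw [degree_add_single] at hn
    exact h c l hc (ih c (by omega))

lemma symbol_surjective : Function.Surjective (symbol b) := by
  rw [← LinearMap.range_eq_top, eq_top_iff]
  intro v hv
  clear hv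
  induction v using Finsupp.induction_linear with
  | zero => exact zero_mem _
  | add v w hv hw => exact add_mem hv hw
  | single a c =>
    have : mono k a ∈ LinearMap.range (symbol b) := by
      induction a using monomial_induction with
      | h0 => exact ⟨1, symbol_one b⟩
      | h a i ha ih =>
        obtain ⟨u, hu⟩ := ih
        exact ⟨-(u * UniversalEnvelopingAlgebra.ι k (b i)), by
          rw [map_neg, symbol_mul_ι, hu, act_of_le b ha, neg_neg]⟩
    rw [← mul_one c, ← smul_eq_mul, ← Finsupp.smul_single]
    exact Submodule.smul_mem _ c this

lemma degree_sub_single_lt {a : ι →₀ ℕ} (h : a.support.Nonempty) :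
    (a - Finsupp.single (a.support.min' h) 1).degree < a.degree := by
  obtain ⟨c, hac, -⟩ := exists_eq_add_single h
  generalize a.support.min' h = l at hac
  subst hac
  rw [add_single_sub, degree_add_single]
  exact Nat.lt_succ_self _

/-- The element of the enveloping algebra attached to a monomial. -/
def ofMono (a : ι →₀ ℕ) : UniversalEnvelopingAlgebra k g :=
  if h : a.support.Nonempty then
    -- The least index stands last, so that the symbol of the product is obtained by applying
    -- `act_of_le` repeatedly; the signs cancel those of the right action.
    -(ofMono (a - Finsupp.single (a.support.min' h) 1) *
      UniversalEnvelopingAlgebra.ι k (b (a.support.min' h)))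
  else 1
termination_by a.degree
decreasing_by exact degree_sub_single_lt h

lemma ofMono_zero : ofMono b 0 = 1 := by
  rw [ofMono]
  simp

lemma ofMono_add_single {a : ι →₀ ℕ} {i : ι} (h : ∀ l ∈ a.support, i ≤ l) :
    ofMono b (a + Finsupp.single i 1) = -(ofMono b a * UniversalEnvelopingAlgebra.ι k (b i)) := by
  rw [ofMono, dif_pos (support_add_single_nonempty a i)]
  simp only [min'_add_single h, add_single_sub]

/-- The inverse of the symbol map. -/
def ofPoly : Poly k ι →ₗ[k] UniversalEnvelopingAlgebra k g :=
  Finsupp.linearCombination k (ofMono b)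

lemma ofPoly_mono (a : ι →₀ ℕ) : ofPoly b (mono k a) = ofMono b a := by
  rw [ofPoly, Finsupp.linearCombination_single, one_smul]

lemma ofPoly_act_of_le {a : ι →₀ ℕ} {i : ι} (h : ∀ l ∈ a.support, i ≤ l) :
    ofPoly b (act b (b i) (mono k a)) =
      -(ofPoly b (mono k a) * UniversalEnvelopingAlgebra.ι k (b i)) := by
  rw [act_of_le b h, ofPoly_mono, ofPoly_mono, ofMono_add_single b h]

/-- For ordered monomials this is the recursion of `ofMono`. Otherwise the least variable is pulled
out, and both sides obey the same commutation relation, so induction on the degree applies. -/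
lemma ofPoly_act_of_mem (r : ℕ) : ∀ v ∈ filt k ι r, ∀ x : g,
    ofPoly b (act b x v) = -(ofPoly b v * UniversalEnvelopingAlgebra.ι k x) := by
  induction r with
  | zero =>
    intro v hv x
    have : v = 0 := by simpa [filt] using hv
    simp [this]
  | succ r ih =>
    intro v hv x
    refine eq_of_mem_filt (ofPoly b ∘ₗ act b x)
      (-(LinearMap.mulRight k (UniversalEnvelopingAlgebra.ι k x) ∘ₗ ofPoly b)) (fun a ha => ?_) hv
    change ofPoly b (act b x (mono k a)) =
      -(ofPoly b (mono k a) * UniversalEnvelopingAlgebra.ι k x)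
    induction x using basis_induction b with
    | zero => simp
    | add x y hx hy =>
      simp only [map_add, LinearMap.add_apply, hx, hy, mul_add, neg_add]
    | smul c x hx => simp only [map_smul, LinearMap.smul_apply, hx, mul_smul_comm, smul_neg]
    | basis i =>
    by_cases hi : ∀ l ∈ a.support, i ≤ l
    · exact ofPoly_act_of_le b hi
    push Not at hi
    obtain ⟨l', hl', hl'i⟩ := hi
    have hne : a.support.Nonempty := ⟨l', hl'⟩
    obtain ⟨c, hac, hc⟩ := exists_eq_add_single hne
    have hji : a.support.min' hne < i := (Finset.min'_le _ _ hl').trans_lt hl'i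
    generalize a.support.min' hne = j at hac hc hji
    subst hac
    rw [degree_add_single] at ha
    have hcr : mono k c ∈ filt k ι r := mono_mem_filt (by omega)
    have h1 : ofPoly b (act b (b j) (act b (b i) (mono k c))) =
        -(ofPoly b (act b (b i) (mono k c)) * UniversalEnvelopingAlgebra.ι k (b j)) := by
      have : act b (b i) (mono k c) =
          mono k (c + Finsupp.single i 1) + lower b i (mono k c) := by
        rw [act_basis, LinearMap.add_apply, shift_mono]
      rw [this, map_add, map_add, ih _ (lower_mem b hcr),
        ofPoly_act_of_le b fun m hm => le_of_mem_support_add_single hc hji.le hm, map_add,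
        add_mul, neg_add]
    rw [← act_of_le b hc, act_of_lt b hji hc, map_add, h1, ih _ hcr, ih _ hcr,
      ofPoly_act_of_le b hc, LieHom.map_lie, LieRing.of_associative_ring_bracket]
    noncomm_ring

lemma ofPoly_act (x : g) (v : Poly k ι) :
    ofPoly b (act b x v) = -(ofPoly b v * UniversalEnvelopingAlgebra.ι k x) := by
  obtain ⟨r, hr⟩ := exists_mem_filt v
  exact ofPoly_act_of_mem b r v hr x

lemma ofPoly_rightRep (u : UniversalEnvelopingAlgebra k g) (v : Poly k ι) :
    ofPoly b ((rightRep b u).unop v) = ofPoly b v * u := by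
  let S : Subalgebra k (UniversalEnvelopingAlgebra k g) :=
    { carrier := {u | ∀ v, ofPoly b ((rightRep b u).unop v) = ofPoly b v * u}
      mul_mem' := fun {u u'} hu hu' v => by
        rw [map_mul, unop_mul, Module.End.mul_apply, hu', hu, mul_assoc]
      add_mem' := fun {u u'} hu hu' v => by
        rw [map_add, MulOpposite.unop_add, LinearMap.add_apply, map_add, hu, hu', mul_add]
      algebraMap_mem' := fun c v => by
        rw [AlgHom.commutes, MulOpposite.algebraMap_apply, unop_op, Module.algebraMap_end_apply,
          map_smul, ← Algebra.commutes, Algebra.smul_def] }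
  have hS : S = ⊤ := CentralBimod.subalgebra_eq_top S fun x v => by
    rw [rightRep_ι, LinearMap.neg_apply, map_neg, ofPoly_act, neg_neg]
  have hu : u ∈ S := hS ▸ Algebra.mem_top
  exact hu v

/-- The symbol is `u` acting on the constant polynomial `1`, and `ofPoly` turns that action into
right multiplication by `u` on `1` in `U`. -/
lemma symbol_injective : Function.Injective (symbol b) :=
  Function.LeftInverse.injective (g := ofPoly b) fun u => by
    change ofPoly b ((rightRep b u).unop (mono k 0)) = u
    rw [ofPoly_rightRep, ofPoly_mono, ofMono_zero, one_mul]

/-- The Poincaré–Birkhoff–Witt theorem. -/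
def symbolEquiv : UniversalEnvelopingAlgebra k g ≃ₗ[k] Poly k ι :=
  LinearEquiv.ofBijective (symbol b) ⟨symbol_injective b, symbol_surjective b⟩

lemma symbolEquiv_mul_ι (u : UniversalEnvelopingAlgebra k g) (x : g) :
    symbolEquiv b (u * UniversalEnvelopingAlgebra.ι k x) = -rep b x (symbolEquiv b u) :=
  symbol_mul_ι b u x

end PBW

/-! ### The Chevalley–Eilenberg complex -/

namespace ChevalleyEilenberg

variable {k : Type u} {g : Type v} [Field k] [LieRing g] [LieAlgebra k g]

/-- A shortcut for instance search. -/
instance moduleExteriorAlgebra : Module k (ExteriorAlgebra k g) := Algebra.toModule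

lemma ι_mul_ι_mul_self (y : g) (w : ExteriorAlgebra k g) :
    ExteriorAlgebra.ι k y * (ExteriorAlgebra.ι k y * w) = 0 := by
  rw [← mul_assoc, ExteriorAlgebra.ι_sq_zero, zero_mul]

lemma ι_mul_ι_mul_comm (x y : g) (w : ExteriorAlgebra k g) :
    ExteriorAlgebra.ι k x * (ExteriorAlgebra.ι k y * w) =
      -(ExteriorAlgebra.ι k y * (ExteriorAlgebra.ι k x * w)) := by
  have h := ExteriorAlgebra.ι_add_mul_swap (R := k) x y
  rw [← mul_assoc, ← mul_assoc, eq_neg_iff_add_eq_zero, ← add_mul, h, zero_mul]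

/-- The extension of an endomorphism of `g` to a derivation of the exterior algebra. -/
def deriv (φ : Module.End k g) : Module.End k (ExteriorAlgebra k g) :=
  CliffordAlgebra.foldr' _
    (LinearMap.mk₂ k (fun y (p : ExteriorAlgebra k g × ExteriorAlgebra k g) =>
        ExteriorAlgebra.ι k (φ y) * p.1 + ExteriorAlgebra.ι k y * p.2)
      (fun y y' p => by simp only [map_add, add_mul]; abel)
      (fun c y p => by simp only [map_smul, smul_mul_assoc, smul_add])
      (fun y p p' => by simp only [Prod.fst_add, Prod.snd_add, mul_add]; abel)
      (fun c y p => by simp only [Prod.smul_fst, Prod.smul_snd, mul_smul_comm, smul_add]))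
    -- `foldr'` requires the recipe, applied twice with the same `y`, to be the quadratic form times
    -- the old value, hence zero here.
    (fun y w fw => by
      simp only [LinearMap.mk₂_apply]
      change ExteriorAlgebra.ι k (φ y) * (ExteriorAlgebra.ι k y * w) + ExteriorAlgebra.ι k y *
        (ExteriorAlgebra.ι k (φ y) * w + ExteriorAlgebra.ι k y * fw) = (0 : k) • fw
      rw [mul_add, ι_mul_ι_mul_self, ι_mul_ι_mul_comm]
      simp) 0

lemma deriv_algebraMap (φ : Module.End k g) (c : k) :
    deriv φ (algebraMap k (ExteriorAlgebra k g) c) = 0 :=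
  (CliffordAlgebra.foldr'_algebraMap _ _ _ _ _).trans (smul_zero c)

lemma deriv_one (φ : Module.End k g) : deriv φ (1 : ExteriorAlgebra k g) = 0 := by
  rw [← map_one (algebraMap k (ExteriorAlgebra k g)), deriv_algebraMap]

lemma deriv_ι_mul (φ : Module.End k g) (y : g) (w : ExteriorAlgebra k g) :
    deriv φ (ExteriorAlgebra.ι k y * w) =
      ExteriorAlgebra.ι k (φ y) * w + ExteriorAlgebra.ι k y * deriv φ w :=
  CliffordAlgebra.foldr'_ι_mul _ _ _ _ _ _

/-- The adjoint action on the exterior algebra. -/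
def adExt (k : Type u) (g : Type v) [Field k] [LieRing g] [LieAlgebra k g] :
    g →ₗ[k] Module.End k (ExteriorAlgebra k g) where
  toFun x := deriv (LieAlgebra.ad k g x)
  map_add' x y := by
    refine LinearMap.ext fun w => ?_
    induction w using CliffordAlgebra.left_induction with
    | algebraMap r =>
      rw [LinearMap.add_apply]
      erw [deriv_algebraMap, deriv_algebraMap, deriv_algebraMap, add_zero]
    | add w w' h h' => rw [LinearMap.map_add, LinearMap.map_add, h, h']
    | ι_mul w z h =>
      rw [LinearMap.add_apply] at h ⊢
      erw [deriv_ι_mul, deriv_ι_mul, deriv_ι_mul, h]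
      simp only [map_add, LinearMap.add_apply, add_mul, mul_add]
      abel
  map_smul' c x := by
    refine LinearMap.ext fun w => ?_
    induction w using CliffordAlgebra.left_induction with
    | algebraMap r =>
      rw [LinearMap.smul_apply]
      erw [deriv_algebraMap, deriv_algebraMap, smul_zero]
    | add w w' h h' => rw [map_add, map_add, h, h']
    | ι_mul w z h =>
      rw [LinearMap.smul_apply] at h ⊢
      erw [deriv_ι_mul, deriv_ι_mul, h]
      simp [smul_add]

lemma adExt_one (x : g) : adExt k g x 1 = 0 := deriv_one _

lemma adExt_ι_mul (x y : g) (w : ExteriorAlgebra k g) :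
    adExt k g x (ExteriorAlgebra.ι k y * w) =
      ExteriorAlgebra.ι k ⁅x, y⁆ * w + ExteriorAlgebra.ι k y * adExt k g x w :=
  deriv_ι_mul _ _ _

/-- The differential with trivial coefficients. -/
def diff₀ (k : Type u) (g : Type v) [Field k] [LieRing g] [LieAlgebra k g] :
    Module.End k (ExteriorAlgebra k g) :=
  CliffordAlgebra.foldr' _
    -- Cartan's formula is taken as the recursive definition, which avoids the sum over pairs of
    -- indices.
    (LinearMap.mk₂ k (fun y (p : ExteriorAlgebra k g × ExteriorAlgebra k g) =>
        adExt k g y p.1 - ExteriorAlgebra.ι k y * p.2)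
      (fun y y' p => by simp only [map_add, add_mul, LinearMap.add_apply]; abel)
      (fun c y p => by simp only [map_smul, smul_mul_assoc, smul_sub, LinearMap.smul_apply])
      (fun y p p' => by simp only [Prod.fst_add, Prod.snd_add, mul_add, map_add]; abel)
      (fun c y p => by
        simp only [Prod.smul_fst, Prod.smul_snd, mul_smul_comm, smul_sub, map_smul]))
    (fun y w fw => by
      simp only [LinearMap.mk₂_apply]
      change adExt k g y (ExteriorAlgebra.ι k y * w) - ExteriorAlgebra.ι k y *
        (adExt k g y w - ExteriorAlgebra.ι k y * fw) = (0 : k) • fw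
      rw [adExt_ι_mul, mul_sub, ι_mul_ι_mul_self]
      simp) 0

lemma diff₀_one : diff₀ k g 1 = 0 := by
  rw [← map_one (algebraMap k (ExteriorAlgebra k g))]
  exact (CliffordAlgebra.foldr'_algebraMap _ _ _ _ _).trans (smul_zero 1)

lemma diff₀_ι_mul (y : g) (w : ExteriorAlgebra k g) :
    diff₀ k g (ExteriorAlgebra.ι k y * w) =
      adExt k g y w - ExteriorAlgebra.ι k y * diff₀ k g w :=
  CliffordAlgebra.foldr'_ι_mul _ _ _ _ _ _

/-- Contraction with a linear form. -/
def contract (ξ : Module.Dual k g) : Module.End k (ExteriorAlgebra k g) :=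
  CliffordAlgebra.contractLeft ξ

lemma contract_one (ξ : Module.Dual k g) : contract ξ 1 = 0 :=
  CliffordAlgebra.contractLeft_one _ ξ

lemma contract_ι_mul (ξ : Module.Dual k g) (y : g) (w : ExteriorAlgebra k g) :
    contract ξ (ExteriorAlgebra.ι k y * w) = ξ y • w - ExteriorAlgebra.ι k y * contract ξ w :=
  CliffordAlgebra.contractLeft_ι_mul _ _ _

/-- The projection of the exterior algebra to its component of degree `q`. -/
def extProj (k : Type u) (g : Type v) [Field k] [LieRing g] [LieAlgebra k g] (q : ℕ) :
    Module.End k (ExteriorAlgebra k g) :=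
  GradedAlgebra.proj (fun i : ℕ => ⋀[k]^i g) q

lemma extProj_of_mem {q : ℕ} {w : ExteriorAlgebra k g} (h : w ∈ ⋀[k]^q g) :
    extProj k g q w = w :=
  DirectSum.decompose_of_mem_same (fun i : ℕ => ⋀[k]^i g) h

lemma extProj_of_mem_ne {p q : ℕ} {w : ExteriorAlgebra k g} (h : w ∈ ⋀[k]^p g) (hpq : p ≠ q) :
    extProj k g q w = 0 :=
  DirectSum.decompose_of_mem_ne (fun i : ℕ => ⋀[k]^i g) h hpq

lemma extProj_mem (q : ℕ) (w : ExteriorAlgebra k g) : extProj k g q w ∈ ⋀[k]^q g :=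
  SetLike.coe_mem (DirectSum.decompose (fun i : ℕ => ⋀[k]^i g) w q)

lemma one_mem_exteriorPower : (1 : ExteriorAlgebra k g) ∈ ⋀[k]^0 g :=
  SetLike.one_mem_graded (fun i : ℕ => ⋀[k]^i g)

lemma ι_mul_mem_exteriorPower (y : g) {q : ℕ} {w : ExteriorAlgebra k g} (h : w ∈ ⋀[k]^q g) :
    ExteriorAlgebra.ι k y * w ∈ ⋀[k]^(q + 1) g := by
  have hy : ExteriorAlgebra.ι k y ∈ ⋀[k]^1 g := by
    rw [ExteriorAlgebra.exteriorPower, pow_one]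
    exact LinearMap.mem_range_self _ y
  rw [add_comm]
  exact SetLike.mul_mem_graded (A := fun i : ℕ => ⋀[k]^i g) hy h

lemma extProj_zero_ι_mul (y : g) (w : ExteriorAlgebra k g) :
    extProj k g 0 (ExteriorAlgebra.ι k y * w) = 0 := by
  induction w using DirectSum.Decomposition.inductionOn (fun i : ℕ => ⋀[k]^i g) with
  | zero => simp
  | homogeneous w => exact extProj_of_mem_ne (ι_mul_mem_exteriorPower y w.2) (Nat.succ_ne_zero _)
  | add w w' h h' => rw [mul_add, map_add, h, h', add_zero]

lemma extProj_succ_ι_mul (q : ℕ) (y : g) (w : ExteriorAlgebra k g) :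
    extProj k g (q + 1) (ExteriorAlgebra.ι k y * w) =
      ExteriorAlgebra.ι k y * extProj k g q w := by
  induction w using DirectSum.Decomposition.inductionOn (fun i : ℕ => ⋀[k]^i g) with
  | zero => simp
  | @homogeneous p w =>
    by_cases h : p = q
    · subst h
      rw [extProj_of_mem w.2, extProj_of_mem (ι_mul_mem_exteriorPower y w.2)]
    · rw [extProj_of_mem_ne w.2 h, mul_zero,
        extProj_of_mem_ne (ι_mul_mem_exteriorPower y w.2) (by omega)]
  | add w w' h h' => rw [mul_add, map_add, h, h', map_add, mul_add]

/-! #### Coefficients -/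

variable {N : Type*} [AddCommGroup N] [Module k N]

/-- Exterior multiplication by `y`. -/
def wedge (N : Type*) [AddCommGroup N] [Module k N] (y : g) :
    Module.End k (N ⊗[k] ExteriorAlgebra k g) :=
  (LinearMap.mulLeft k (ExteriorAlgebra.ι k y)).lTensor N

@[simp]
lemma wedge_tmul (y : g) (n : N) (w : ExteriorAlgebra k g) :
    wedge N y (n ⊗ₜ[k] w) = n ⊗ₜ[k] (ExteriorAlgebra.ι k y * w) := rfl

lemma wedge_add (x y : g) (z : N ⊗[k] ExteriorAlgebra k g) :
    wedge N (x + y) z = wedge N x z + wedge N y z := by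
  induction z using TensorProduct.induction_on with
  | zero => simp
  | tmul n w => simp [add_mul, tmul_add]
  | add z z' h h' => simp only [map_add, h, h']; abel

lemma wedge_smul (c : k) (x : g) (z : N ⊗[k] ExteriorAlgebra k g) :
    wedge N (c • x) z = c • wedge N x z := by
  induction z using TensorProduct.induction_on with
  | zero => simp
  | tmul n w => simp
  | add z z' h h' => simp only [map_add, h, h', smul_add]

/-- The tensors `n ⊗ 1` generate everything under exterior multiplication, so identities between
`theta`, `diff` and `proj` reduce to their commutation rules with `wedge`. -/
lemma wedge_induction {P : N ⊗[k] ExteriorAlgebra k g → Prop}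
    (one : ∀ n, P (n ⊗ₜ 1)) (add : ∀ z z', P z → P z' → P (z + z'))
    (wedge : ∀ y z, P z → P (wedge N y z)) (z : N ⊗[k] ExteriorAlgebra k g) : P z := by
  have h (w : ExteriorAlgebra k g) : ∀ n : N, P (n ⊗ₜ w) := by
    induction w using CliffordAlgebra.left_induction with
    | algebraMap r =>
      intro n
      rw [Algebra.algebraMap_eq_smul_one, ← smul_tmul]
      exact one _
    | add w w' h h' =>
      intro n
      rw [tmul_add]
      exact add _ _ (h n) (h' n)
    | ι_mul w y h => exact fun n => wedge y _ (h n)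
  induction z using TensorProduct.induction_on with
  | zero => simpa using h 0 0
  | tmul n w => exact h w n
  | add z z' h h' => exact add _ _ h h'

variable (ρ : g →ₗ⁅k⁆ Module.End k N)

/-- The action of `x` on the tensor product of `N` with the exterior algebra. -/
def theta (x : g) : Module.End k (N ⊗[k] ExteriorAlgebra k g) :=
  (ρ x).rTensor _ + (adExt k g x).lTensor N

@[simp]
lemma theta_tmul (x : g) (n : N) (w : ExteriorAlgebra k g) :
    theta ρ x (n ⊗ₜ w) = ρ x n ⊗ₜ w + n ⊗ₜ adExt k g x w := rfl

lemma theta_wedge (x y : g) (z : N ⊗[k] ExteriorAlgebra k g) :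
    theta ρ x (wedge N y z) = wedge N ⁅x, y⁆ z + wedge N y (theta ρ x z) := by
  induction z using TensorProduct.induction_on with
  | zero => simp
  | tmul n w => simp only [wedge_tmul, theta_tmul, adExt_ι_mul, tmul_add, map_add]; abel
  | add z z' h h' => simp only [map_add, h, h']; abel

lemma theta_lie (x y : g) (z : N ⊗[k] ExteriorAlgebra k g) :
    theta ρ x (theta ρ y z) = theta ρ y (theta ρ x z) + theta ρ ⁅x, y⁆ z := by
  induction z using wedge_induction with
  | one n =>
    simp [adExt_one, sub_tmul]
  | add z z' h h' => simp only [map_add, h, h']; abel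
  | wedge u z h =>
    simp only [theta_wedge, map_add, h]
    rw [leibniz_lie x y u, wedge_add]
    abel

variable {ι : Type*} [Fintype ι] (b : Module.Basis ι k g)

/-- The differential of the Chevalley–Eilenberg complex of `N`. -/
def diff : Module.End k (N ⊗[k] ExteriorAlgebra k g) :=
  ∑ i, TensorProduct.map (ρ (b i)) (contract (b.coord i)) + (diff₀ k g).lTensor N

lemma diff_tmul (n : N) (w : ExteriorAlgebra k g) :
    diff ρ b (n ⊗ₜ w) = ∑ i, ρ (b i) n ⊗ₜ contract (b.coord i) w + n ⊗ₜ diff₀ k g w := by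
  simp [diff]

lemma diff_tmul_one (n : N) : diff ρ b (n ⊗ₜ 1) = 0 := by
  simp [diff_tmul, contract_one, diff₀_one]

/-- Cartan's formula. Contracting `y ∧ w` with the dual basis reassembles `ρ y n ⊗ w`, and the
remaining term of `theta` comes from the recursion of `diff₀`. -/
lemma diff_wedge (y : g) (z : N ⊗[k] ExteriorAlgebra k g) :
    diff ρ b (wedge N y z) = theta ρ y z - wedge N y (diff ρ b z) := by
  induction z using TensorProduct.induction_on with
  | zero => simp
  | tmul n w =>
    have h : ∑ i, ρ (b i) n ⊗ₜ[k] (b.coord i y • w) = ρ y n ⊗ₜ w := by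
      have : ρ y n = ∑ i, b.repr y i • ρ (b i) n := by
        conv_lhs => rw [← b.sum_repr y]
        rw [map_sum, LinearMap.sum_apply]
        simp
      rw [this, sum_tmul]
      simp [smul_tmul']
    simp only [wedge_tmul, diff_tmul, contract_ι_mul, diff₀_ι_mul, tmul_sub, theta_tmul, map_add,
      map_sum, Finset.sum_sub_distrib, h]
    abel
  | add z z' h h' => simp only [map_add, h, h']; abel

lemma theta_diff (x : g) (z : N ⊗[k] ExteriorAlgebra k g) :
    theta ρ x (diff ρ b z) = diff ρ b (theta ρ x z) := by
  induction z using wedge_induction with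
  | one n => simp [diff_tmul_one, adExt_one]
  | add z z' h h' => simp only [map_add, h, h']
  | wedge y z h =>
    simp only [theta_wedge, diff_wedge, map_add, map_sub, h, theta_lie ρ x y]
    abel

/-- Cartan's formula applied twice leaves `d θ_y - θ_y d`, which vanishes by `theta_diff`. -/
lemma diff_diff (z : N ⊗[k] ExteriorAlgebra k g) : diff ρ b (diff ρ b z) = 0 := by
  induction z using wedge_induction with
  | one n => simp [diff_tmul_one]
  | add z z' h h' => simp only [map_add, h, h', add_zero]
  | wedge y z h => simp only [diff_wedge, map_sub, h, theta_diff, map_zero]; abel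

/-- The projection to the component of exterior degree `q`. -/
def proj (k : Type u) (g : Type v) [Field k] [LieRing g] [LieAlgebra k g]
    (N : Type*) [AddCommGroup N] [Module k N] (q : ℕ) :
    Module.End k (N ⊗[k] ExteriorAlgebra k g) := (extProj k g q).lTensor N

@[simp]
lemma proj_tmul (q : ℕ) (n : N) (w : ExteriorAlgebra k g) :
    proj k g N q (n ⊗ₜ w) = n ⊗ₜ extProj k g q w := rfl

lemma proj_zero_wedge (y : g) (z : N ⊗[k] ExteriorAlgebra k g) :
    proj k g N 0 (wedge N y z) = 0 := by
  induction z using TensorProduct.induction_on with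
  | zero => simp
  | tmul n w => simp [extProj_zero_ι_mul]
  | add z z' h h' => simp only [map_add, h, h', add_zero]

lemma proj_succ_wedge (q : ℕ) (y : g) (z : N ⊗[k] ExteriorAlgebra k g) :
    proj k g N (q + 1) (wedge N y z) = wedge N y (proj k g N q z) := by
  induction z using TensorProduct.induction_on with
  | zero => simp
  | tmul n w => simp [extProj_succ_ι_mul]
  | add z z' h h' => simp only [map_add, h, h']

lemma proj_zero_tmul_one (n : N) : proj k g N 0 (n ⊗ₜ 1) = n ⊗ₜ 1 := by
  rw [proj_tmul, extProj_of_mem one_mem_exteriorPower]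

lemma proj_succ_tmul_one (q : ℕ) (n : N) : proj k g N (q + 1) (n ⊗ₜ 1) = 0 := by
  rw [proj_tmul, extProj_of_mem_ne one_mem_exteriorPower (Nat.succ_ne_zero q).symm, tmul_zero]

lemma proj_proj (q : ℕ) (z : N ⊗[k] ExteriorAlgebra k g) :
    proj k g N q (proj k g N q z) = proj k g N q z := by
  induction z using TensorProduct.induction_on with
  | zero => simp
  | tmul n w => simp [extProj_of_mem (extProj_mem q w)]
  | add z z' h h' => simp only [map_add, h, h']

lemma proj_proj_of_ne {p q : ℕ} (h : p ≠ q) (z : N ⊗[k] ExteriorAlgebra k g) :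
    proj k g N q (proj k g N p z) = 0 := by
  induction z using TensorProduct.induction_on with
  | zero => simp
  | tmul n w => simp [extProj_of_mem_ne (extProj_mem p w) h]
  | add z z' h h' => simp only [map_add, h, h', add_zero]

lemma proj_theta (q : ℕ) (x : g) (z : N ⊗[k] ExteriorAlgebra k g) :
    proj k g N q (theta ρ x z) = theta ρ x (proj k g N q z) := by
  induction z using wedge_induction generalizing q with
  | one n =>
    cases q with
    | zero => simp only [theta_tmul, adExt_one, tmul_zero, add_zero, proj_zero_tmul_one]
    | succ q => simp only [theta_tmul, adExt_one, tmul_zero, add_zero, proj_succ_tmul_one, map_zero]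
  | add z z' h h' => simp only [map_add, h, h']
  | wedge y z h =>
    cases q with
    | zero => simp only [theta_wedge, map_add, proj_zero_wedge, map_zero, add_zero]
    | succ q => simp only [theta_wedge, map_add, proj_succ_wedge, h]

lemma diff_proj_zero (z : N ⊗[k] ExteriorAlgebra k g) : diff ρ b (proj k g N 0 z) = 0 := by
  induction z using wedge_induction with
  | one n => rw [proj_zero_tmul_one, diff_tmul_one]
  | add z z' h h' => rw [map_add, map_add, h, h', add_zero]
  | wedge y z h => rw [proj_zero_wedge, map_zero]

/-- Homogeneity of degree `-1`, phrased with projections so that the whole complex can be a single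
ungraded space. -/
lemma diff_proj_succ (q : ℕ) (z : N ⊗[k] ExteriorAlgebra k g) :
    diff ρ b (proj k g N (q + 1) z) = proj k g N q (diff ρ b z) := by
  induction z using wedge_induction generalizing q with
  | one n => rw [proj_succ_tmul_one, diff_tmul_one, map_zero, map_zero]
  | add z z' h h' => simp only [map_add, h, h']
  | wedge y z h =>
    rw [proj_succ_wedge, diff_wedge, diff_wedge, map_sub, proj_theta]
    cases q with
    | zero => rw [proj_zero_wedge, diff_proj_zero, map_zero]
    | succ q => rw [h, proj_succ_wedge]

/-! #### Functoriality in the coefficients -/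

variable {N' : Type*} [AddCommGroup N'] [Module k N'] (ρ' : g →ₗ⁅k⁆ Module.End k N')

lemma rTensor_wedge (f : N →ₗ[k] N') (y : g) (z : N ⊗[k] ExteriorAlgebra k g) :
    f.rTensor _ (wedge N y z) = wedge N' y (f.rTensor _ z) := by
  induction z using TensorProduct.induction_on with
  | zero => simp
  | tmul n w => simp
  | add z z' h h' => simp only [map_add, h, h']

lemma rTensor_proj (f : N →ₗ[k] N') (q : ℕ) (z : N ⊗[k] ExteriorAlgebra k g) :
    f.rTensor _ (proj k g N q z) = proj k g N' q (f.rTensor _ z) := by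
  induction z using TensorProduct.induction_on with
  | zero => simp
  | tmul n w => simp
  | add z z' h h' => simp only [map_add, h, h']

lemma rTensor_theta (f : N →ₗ[k] N') (hf : ∀ x n, f (ρ x n) = ρ' x (f n)) (x : g)
    (z : N ⊗[k] ExteriorAlgebra k g) :
    f.rTensor _ (theta ρ x z) = theta ρ' x (f.rTensor _ z) := by
  induction z using TensorProduct.induction_on with
  | zero => simp
  | tmul n w => simp [hf]
  | add z z' h h' => simp only [map_add, h, h']

lemma rTensor_diff (f : N →ₗ[k] N') (hf : ∀ x n, f (ρ x n) = ρ' x (f n))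
    (z : N ⊗[k] ExteriorAlgebra k g) :
    f.rTensor _ (diff ρ b z) = diff ρ' b (f.rTensor _ z) := by
  induction z using TensorProduct.induction_on with
  | zero => simp
  | tmul n w => simp [diff_tmul, hf]
  | add z z' h h' => simp only [map_add, h, h']

end ChevalleyEilenberg

/-! ### Acyclicity of the Chevalley–Eilenberg complex of a free module -/

namespace PBW

variable {k : Type u} [Field k] {ι : Type w} [DecidableEq ι]

/-- Division by a variable, which kills the monomials that do not contain the variable. -/
def divVar (k : Type u) [Field k] (i : ι) : Module.End k (Poly k ι) :=
  Finsupp.linearCombination k fun a => if a i = 0 then 0 else mono k (a - Finsupp.single i 1)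

/-- The evaluation of a variable at zero. -/
def evalZero (k : Type u) [Field k] (i : ι) : Module.End k (Poly k ι) :=
  Finsupp.linearCombination k fun a => if a i = 0 then mono k a else 0

omit [DecidableEq ι] in
lemma divVar_mono (i : ι) (a : ι →₀ ℕ) :
    divVar k i (mono k a) = if a i = 0 then 0 else mono k (a - Finsupp.single i 1) := by
  rw [divVar, Finsupp.linearCombination_single, one_smul]

omit [DecidableEq ι] in
lemma evalZero_mono (i : ι) (a : ι →₀ ℕ) :
    evalZero k i (mono k a) = if a i = 0 then mono k a else 0 := by
  rw [evalZero, Finsupp.linearCombination_single, one_smul]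

omit [DecidableEq ι] in
lemma poly_ext {W : Type*} [AddCommGroup W] [Module k W] {f f' : Poly k ι →ₗ[k] W}
    (h : ∀ a, f (mono k a) = f' (mono k a)) (v : Poly k ι) : f v = f' v :=
  LinearMap.congr_fun (Finsupp.lhom_ext' fun a => LinearMap.ext_ring (h a)) v

omit [DecidableEq ι] in
lemma shift_divVar (i : ι) (v : Poly k ι) : shift k i (divVar k i v) = v - evalZero k i v := by
  refine poly_ext (f := shift k i ∘ₗ divVar k i) (f' := LinearMap.id - evalZero k i)
    (fun a => ?_) v
  simp only [LinearMap.comp_apply, LinearMap.sub_apply, LinearMap.id_apply, divVar_mono,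
    evalZero_mono]
  split_ifs with h
  · simp
  · rw [shift_mono, sub_zero, tsub_add_cancel_of_le]
    exact Finsupp.single_le_iff.2 (Nat.one_le_iff_ne_zero.2 h)

lemma divVar_shift (i j : ι) (v : Poly k ι) :
    divVar k i (shift k j v) = shift k j (divVar k i v) + if j = i then evalZero k i v else 0 := by
  rcases eq_or_ne j i with rfl | h
  · rw [if_pos rfl, shift_divVar, sub_add_cancel]
    refine poly_ext (f := divVar k j ∘ₗ shift k j) (f' := LinearMap.id) (fun a => ?_) v
    simp [divVar_mono, -Finsupp.single_tsub]
  · rw [if_neg h, add_zero]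
    refine poly_ext (f := divVar k i ∘ₗ shift k j) (f' := shift k j ∘ₗ divVar k i) (fun a => ?_) v
    have h0 : (a + Finsupp.single j 1 : ι →₀ ℕ) i = a i := by simp [h]
    simp only [LinearMap.comp_apply, shift_mono, divVar_mono, h0]
    split_ifs with h1
    · simp
    · rw [shift_mono, tsub_add_eq_add_tsub]
      exact Finsupp.single_le_iff.2 (Nat.one_le_iff_ne_zero.2 h1)

omit [DecidableEq ι] in
lemma divVar_mem {i : ι} {r : ℕ} {v : Poly k ι} (hv : v ∈ filt k ι (r + 1)) :
    divVar k i v ∈ filt k ι r := by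
  refine filt_le_comap (divVar k i) (filt k ι r) (fun a ha => ?_) hv
  rw [divVar_mono]
  split_ifs with h
  · exact zero_mem _
  · refine mono_mem_filt ?_
    have h1 : a - Finsupp.single i 1 + Finsupp.single i 1 = a :=
      tsub_add_cancel_of_le (Finsupp.single_le_iff.2 (Nat.one_le_iff_ne_zero.2 h))
    rw [← h1, degree_add_single] at ha
    omega

omit [DecidableEq ι] in
lemma evalZero_mem {i : ι} {r : ℕ} {v : Poly k ι} (hv : v ∈ filt k ι r) :
    evalZero k i v ∈ filt k ι r := by
  refine filt_le_comap (evalZero k i) (filt k ι r) (fun a ha => ?_) hv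
  rw [evalZero_mono]
  split_ifs with h
  · exact mono_mem_filt ha
  · exact zero_mem _

end PBW

/-! ### Perturbation of the Koszul homotopies. -/

namespace ChevalleyEilenberg

open PBW

variable {k : Type u} {g : Type v} [Field k] [LieRing g] [LieAlgebra k g]
variable {N M : Type*} [AddCommGroup N] [Module k N] [AddCommGroup M] [Module k M]

/-- The tensor product of two representations. -/
def tensorRep (ρ : g →ₗ⁅k⁆ Module.End k N) (σ : g →ₗ⁅k⁆ Module.End k M) :
    g →ₗ⁅k⁆ Module.End k (N ⊗[k] M) where
  toFun x := (ρ x).rTensor M + (σ x).lTensor N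
  map_add' x y := by
    refine TensorProduct.ext' fun n m => ?_
    simp
    abel
  map_smul' c x := by
    refine TensorProduct.ext' fun n m => ?_
    simp [smul_tmul']
  map_lie' {x y} := by
    refine TensorProduct.ext' fun n m => ?_
    simp [LieRing.of_associative_ring_bracket]
    abel

@[simp]
lemma tensorRep_tmul (ρ : g →ₗ⁅k⁆ Module.End k N) (σ : g →ₗ⁅k⁆ Module.End k M) (x : g) (n : N)
    (m : M) : tensorRep ρ σ x (n ⊗ₜ m) = ρ x n ⊗ₜ m + n ⊗ₜ σ x m := rfl

/-- The contracting operators attached to a list of operators and a differential. -/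
def homotopy {A : Type*} [Ring A] (d : A) : List A → A
  | [] => 0
  | h :: l => h + (1 - d * h - h * d) * homotopy d l

/-- The complement of the homotopy. -/
def remainder {A : Type*} [Ring A] (d : A) : List A → A
  | [] => 1
  | h :: l => (1 - d * h - h * d) * remainder d l

/-- Since `d² = 0`, each factor `1 - dh - hd` commutes with `d`; hence the homotopies compose and
their complements multiply. -/
lemma homotopy_add {A : Type*} [Ring A] {d : A} (hd : d * d = 0) (l : List A) :
    d * homotopy d l + homotopy d l * d = 1 - remainder d l := by
  induction l with
  | nil => simp [homotopy, remainder]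
  | cons h l ih =>
    have e : d * (1 - d * h - h * d) = (1 - d * h - h * d) * d := by
      simp only [mul_sub, sub_mul, mul_one, one_mul, ← mul_assoc, hd, zero_mul, sub_zero]
      rw [mul_assoc h, hd, mul_zero, sub_zero]
    rw [homotopy, remainder, mul_add, ← mul_assoc, e, add_mul, mul_assoc, mul_assoc]
    have : (1 - d * h - h * d) * remainder d l = (1 - d * h - h * d) *
        (1 - (d * homotopy d l + homotopy d l * d)) := by rw [ih, sub_sub_cancel]
    rw [this, mul_sub, mul_add, mul_one]
    generalize (1 - d * h - h * d) * (d * homotopy d l) = s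
    generalize (1 - d * h - h * d) * (homotopy d l * d) = t
    abel

/-- A filtration of a representation with operators which contract, up to terms of lower order,
the Koszul complex of the leading terms of the action of a basis. -/
structure ContractingData {ι : Type w} [DecidableEq ι] (ρ : g →ₗ⁅k⁆ Module.End k N)
    (b : Module.Basis ι k g) where
  filt : ℕ → Submodule k N
  filt_mono : Monotone filt
  filt_zero : filt 0 = ⊥
  exists_mem : ∀ n, ∃ r, n ∈ filt r
  div : ι → Module.End k N
  eval : ι → Module.End k N
  div_mem : ∀ i r n, n ∈ filt (r + 1) → div i n ∈ filt r
  eval_mem : ∀ i r n, n ∈ filt r → eval i n ∈ filt r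
  -- The Koszul identities `x_i div_i = 1 - eval_i` and `[div_i, x_j] = δ_ij eval_i`, both only up
  -- to terms of lower filtration.
  act_div : ∀ i r n, n ∈ filt (r + 1) → ρ (b i) (div i n) - (n - eval i n) ∈ filt r
  div_act : ∀ i j r n, n ∈ filt (r + 1) →
    div i (ρ (b j) n) - ρ (b j) (div i n) - (if j = i then eval i n else 0) ∈ filt r

namespace ContractingData

variable {ι : Type w} [DecidableEq ι] {ρ : g →ₗ⁅k⁆ Module.End k N} {b : Module.Basis ι k g}
  (c : ContractingData ρ b)

/-- The filtration of the Chevalley–Eilenberg complex. -/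
def cFilt (r : ℕ) : Submodule k (N ⊗[k] ExteriorAlgebra k g) :=
  Submodule.span k {z | ∃ n ∈ c.filt r, ∃ w, z = n ⊗ₜ w}

lemma tmul_mem {r : ℕ} {n : N} (hn : n ∈ c.filt r) (w : ExteriorAlgebra k g) :
    n ⊗ₜ w ∈ c.cFilt r :=
  Submodule.subset_span ⟨n, hn, w, rfl⟩

lemma cFilt_le_comap (f : Module.End k (N ⊗[k] ExteriorAlgebra k g))
    (S : Submodule k (N ⊗[k] ExteriorAlgebra k g)) {r : ℕ}
    (h : ∀ n ∈ c.filt r, ∀ w, f (n ⊗ₜ w) ∈ S) : c.cFilt r ≤ S.comap f := by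
  rw [cFilt, Submodule.span_le]
  rintro _ ⟨n, hn, w, rfl⟩
  exact h n hn w

lemma cFilt_mono {r s : ℕ} (h : r ≤ s) : c.cFilt r ≤ c.cFilt s := by
  rw [cFilt, Submodule.span_le]
  rintro _ ⟨n, hn, w, rfl⟩
  exact c.tmul_mem (c.filt_mono h hn) w

lemma cFilt_zero : c.cFilt 0 = ⊥ := by
  rw [eq_bot_iff, cFilt, Submodule.span_le]
  rintro _ ⟨n, hn, w, rfl⟩
  have : n = 0 := by simpa [c.filt_zero] using hn
  simp [this]

lemma exists_mem_cFilt (z : N ⊗[k] ExteriorAlgebra k g) : ∃ r, z ∈ c.cFilt r := by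
  induction z using TensorProduct.induction_on with
  | zero => exact ⟨0, zero_mem _⟩
  | add z z' h h' =>
    obtain ⟨r, hr⟩ := h
    obtain ⟨s, hs⟩ := h'
    exact ⟨max r s, add_mem (c.cFilt_mono (le_max_left _ _) hr)
      (c.cFilt_mono (le_max_right _ _) hs)⟩
  | tmul n w =>
    obtain ⟨r, hr⟩ := c.exists_mem n
    exact ⟨r, c.tmul_mem hr w⟩

lemma wedge_mem (y : g) {r : ℕ} {z : N ⊗[k] ExteriorAlgebra k g} (hz : z ∈ c.cFilt r) :
    wedge N y z ∈ c.cFilt r :=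
  c.cFilt_le_comap (wedge N y) (c.cFilt r) (fun _ hn _ => c.tmul_mem hn _) hz

lemma proj_mem (q : ℕ) {r : ℕ} {z : N ⊗[k] ExteriorAlgebra k g} (hz : z ∈ c.cFilt r) :
    proj k g N q z ∈ c.cFilt r :=
  c.cFilt_le_comap (proj k g N q) (c.cFilt r) (fun _ hn _ => c.tmul_mem hn _) hz

/-- The homotopy attached to one basis vector. -/
def basisHomotopy (i : ι) : Module.End k (N ⊗[k] ExteriorAlgebra k g) :=
  TensorProduct.map (c.div i) (LinearMap.mulLeft k (ExteriorAlgebra.ι k (b i)))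

/-- The leading term of the complement of the homotopy attached to one basis vector. -/
def leading (i : ι) : Module.End k (N ⊗[k] ExteriorAlgebra k g) :=
  TensorProduct.map (c.eval i)
    (LinearMap.id - LinearMap.mulLeft k (ExteriorAlgebra.ι k (b i)) ∘ₗ contract (b.coord i))

lemma basisHomotopy_tmul (i : ι) (n : N) (w : ExteriorAlgebra k g) :
    c.basisHomotopy i (n ⊗ₜ w) = wedge N (b i) (c.div i n ⊗ₜ w) := rfl

lemma leading_tmul (i : ι) (n : N) (w : ExteriorAlgebra k g) :
    c.leading i (n ⊗ₜ w) =
      c.eval i n ⊗ₜ (w - ExteriorAlgebra.ι k (b i) * contract (b.coord i) w) := rfl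

lemma leading_mem (i : ι) {r : ℕ} {z : N ⊗[k] ExteriorAlgebra k g} (hz : z ∈ c.cFilt r) :
    c.leading i z ∈ c.cFilt r :=
  c.cFilt_le_comap (c.leading i) (c.cFilt r)
    (fun _ hn _ => c.tmul_mem (c.eval_mem i _ _ hn) _) hz

/-- The exterior factor of `leading i` removes all terms containing `b i`. Applying it for every `i`
thus kills all positive exterior degrees. -/
lemma leading_wedge (i j : ι) (z : N ⊗[k] ExteriorAlgebra k g) :
    c.leading i (wedge N (b j) z) = if i = j then 0 else wedge N (b j) (c.leading i z) := by
  induction z using TensorProduct.induction_on with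
  | zero => simp
  | add z z' h h' => rw [map_add, map_add, h, h']; split_ifs <;> simp
  | tmul n w =>
    rw [wedge_tmul, leading_tmul, leading_tmul, contract_ι_mul]
    split_ifs with h
    · subst h
      simp [mul_sub, ι_mul_ι_mul_self]
    · have h0 : b.coord i (b j) = 0 := by simp [Ne.symm h]
      rw [h0, zero_smul, zero_sub, wedge_tmul, mul_sub, mul_neg, ι_mul_ι_mul_comm (b i) (b j),
        neg_neg]

variable [Fintype ι]

/-- Cartan's formula produces `θ_{b_i}`, whose leading part is `x_i div_i = 1 - eval_i`; the
commutators of `div_i` with the action give the exterior part of `leading i`; the two contributions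
of `diff₀` cancel. The long bracket collects the errors, all of lower filtration because only the
coefficient factor is filtered. -/
lemma homotopy_tmul (i : ι) (n : N) (w : ExteriorAlgebra k g) :
    diff ρ b (c.basisHomotopy i (n ⊗ₜ w)) + c.basisHomotopy i (diff ρ b (n ⊗ₜ w)) =
      n ⊗ₜ w - c.leading i (n ⊗ₜ w) +
        ((ρ (b i) (c.div i n) - (n - c.eval i n)) ⊗ₜ w + c.div i n ⊗ₜ adExt k g (b i) w +
        ∑ j, (c.div i (ρ (b j) n) - ρ (b j) (c.div i n) - if j = i then c.eval i n else 0) ⊗ₜ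
          (ExteriorAlgebra.ι k (b i) * contract (b.coord j) w)) := by
  have h : ∑ j, (if j = i then c.eval i n else 0) ⊗ₜ[k]
      (ExteriorAlgebra.ι k (b i) * contract (b.coord j) w) =
      c.eval i n ⊗ₜ (ExteriorAlgebra.ι k (b i) * contract (b.coord i) w) := by
    rw [Finset.sum_eq_single i]
    · rw [if_pos rfl]
    · intro j _ hj
      rw [if_neg hj, zero_tmul]
    · simp
  rw [basisHomotopy_tmul, diff_wedge, theta_tmul, diff_tmul, diff_tmul, map_add, map_add, map_sum,
    map_sum]
  simp only [basisHomotopy_tmul, wedge_tmul, leading_tmul, tmul_sub, sub_tmul,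
    Finset.sum_sub_distrib, h]
  abel

/-- The complement of the homotopy attached to one basis vector. -/
def complement (i : ι) : Module.End k (N ⊗[k] ExteriorAlgebra k g) :=
  1 - diff ρ b * c.basisHomotopy i - c.basisHomotopy i * diff ρ b

lemma complement_sub_mem (i : ι) {r : ℕ} {z : N ⊗[k] ExteriorAlgebra k g}
    (hz : z ∈ c.cFilt (r + 1)) : c.complement i z - c.leading i z ∈ c.cFilt r := by
  refine c.cFilt_le_comap (c.complement i - c.leading i) (c.cFilt r) (fun n hn w => ?_) hz
  have hd := c.div_mem i _ _ hn
  have e : (c.complement i - c.leading i) (n ⊗ₜ w) = n ⊗ₜ w - c.leading i (n ⊗ₜ w) -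
      (diff ρ b (c.basisHomotopy i (n ⊗ₜ w)) + c.basisHomotopy i (diff ρ b (n ⊗ₜ w))) := by
    simp only [complement, LinearMap.sub_apply, Module.End.mul_apply, Module.End.one_apply]
    abel
  rw [e, homotopy_tmul, sub_add_cancel_left, neg_mem_iff]
  refine add_mem (add_mem ?_ ?_) (sum_mem fun j _ => ?_)
  · exact c.tmul_mem (c.act_div i r n hn) _
  · exact c.tmul_mem hd _
  · exact c.tmul_mem (c.div_act i j r n hn) _

lemma complement_mem (i : ι) {r : ℕ} {z : N ⊗[k] ExteriorAlgebra k g} (hz : z ∈ c.cFilt r) :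
    c.complement i z ∈ c.cFilt r := by
  cases r with
  | zero =>
    rw [cFilt_zero, Submodule.mem_bot] at hz
    subst hz
    rw [map_zero]
    exact zero_mem _
  | succ r =>
    rw [← sub_add_cancel (c.complement i z) (c.leading i z)]
    exact add_mem (c.cFilt_mono (Nat.le_succ r) (c.complement_sub_mem i hz)) (c.leading_mem i hz)

/-- The complement of the homotopy attached to a list of basis vectors. -/
def rem (l : List ι) : Module.End k (N ⊗[k] ExteriorAlgebra k g) :=
  remainder (diff ρ b) (l.map c.basisHomotopy)

lemma rem_cons (i : ι) (l : List ι) (z : N ⊗[k] ExteriorAlgebra k g) :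
    c.rem (i :: l) z = c.complement i (c.rem l z) := rfl

lemma rem_mem (l : List ι) {r : ℕ} {z : N ⊗[k] ExteriorAlgebra k g} (hz : z ∈ c.cFilt r) :
    c.rem l z ∈ c.cFilt r := by
  induction l with
  | nil => exact hz
  | cons i l ih => exact c.complement_mem i ih

/-- Modulo lower filtration each complement acts as its leading term, so `b j ∧` passes through the
factors with `i ≠ j` and is killed by the factor with `i = j`. -/
lemma rem_wedge_sub_mem (l : List ι) (j : ι) {r : ℕ} {z : N ⊗[k] ExteriorAlgebra k g}
    (hz : z ∈ c.cFilt (r + 1)) :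
    c.rem l (wedge N (b j) z) - (if j ∈ l then 0 else wedge N (b j) (c.rem l z)) ∈ c.cFilt r := by
  induction l with
  | nil => simp [rem, remainder]
  | cons i l ih =>
    have hl := c.rem_mem l hz
    rw [rem_cons, rem_cons]
    have h1 := c.complement_mem i ih
    rw [map_sub] at h1
    by_cases hjl : j ∈ l
    · rw [if_pos hjl, map_zero] at h1
      rwa [if_pos (List.mem_cons_of_mem _ hjl)]
    · rw [if_neg hjl] at h1
      have h2 := c.complement_sub_mem i (c.wedge_mem (b j) hl)
      rw [leading_wedge] at h2
      by_cases hij : i = j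
      · rw [if_pos hij, sub_zero] at h2
        rw [if_pos (by simp [hij]), sub_zero]
        simpa using add_mem h1 h2
      · rw [if_neg hij] at h2
        rw [if_neg (by simp [hjl, Ne.symm hij])]
        have h3 := c.wedge_mem (b j) (c.complement_sub_mem i hl)
        rw [map_sub] at h3
        have := sub_mem (add_mem h1 h2) h3
        convert this using 1
        abel

lemma rem_univ_wedge_mem (y : g) {r : ℕ} {z : N ⊗[k] ExteriorAlgebra k g}
    (hz : z ∈ c.cFilt (r + 1)) :
    c.rem Finset.univ.toList (wedge N y z) ∈ c.cFilt r := by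
  induction y using basis_induction b with
  | zero => simp [wedge]
  | add y y' h h' =>
    rw [wedge_add, map_add]
    exact add_mem h h'
  | smul a y h =>
    rw [wedge_smul, map_smul]
    exact Submodule.smul_mem _ _ h
  | basis j => simpa using c.rem_wedge_sub_mem Finset.univ.toList j hz

lemma rem_univ_mem {r : ℕ} {z : N ⊗[k] ExteriorAlgebra k g} (hz : z ∈ c.cFilt (r + 1)) :
    c.rem Finset.univ.toList (z - proj k g N 0 z) ∈ c.cFilt r := by
  refine c.cFilt_le_comap (c.rem Finset.univ.toList * (1 - proj k g N 0)) (c.cFilt r)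
    (fun n hn w => ?_) hz
  rw [Module.End.mul_apply, LinearMap.sub_apply, Module.End.one_apply]
  induction w using CliffordAlgebra.left_induction with
  | algebraMap a =>
    have : proj k g N 0 (n ⊗ₜ algebraMap k (ExteriorAlgebra k g) a) =
        n ⊗ₜ algebraMap k (ExteriorAlgebra k g) a := by
      rw [Algebra.algebraMap_eq_smul_one, tmul_smul, map_smul, proj_zero_tmul_one]
    rw [this, sub_self, map_zero]
    exact zero_mem _
  | add w w' h h' =>
    rw [tmul_add, map_add, add_sub_add_comm, map_add]
    exact add_mem h h'
  | ι_mul w y h =>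
    have := proj_zero_wedge y (n ⊗ₜ[k] w)
    rw [wedge_tmul] at this
    erw [this, sub_zero]
    exact c.rem_univ_wedge_mem y (c.tmul_mem hn w)

-- A cycle differs from its remainder by a boundary, and in positive exterior degree the remainder
-- lies one step lower in the filtration, which starts at zero.
include c in
lemma exact_of_mem (q r : ℕ) : ∀ z ∈ c.cFilt r, proj k g N (q + 1) z = z → diff ρ b z = 0 →
    z ∈ LinearMap.range (diff ρ b) := by
  induction r with
  | zero =>
    intro z hz _ _
    rw [cFilt_zero, Submodule.mem_bot] at hz
    exact hz ▸ zero_mem _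
  | succ r ih =>
    intro z hz hq hd
    have h0 : proj k g N 0 z = 0 := by
      rw [← hq, proj_proj_of_ne (Nat.succ_ne_zero q)]
    have h1 := c.rem_univ_mem hz
    rw [h0, sub_zero] at h1
    have h2 := LinearMap.congr_fun (homotopy_add (d := diff ρ b)
      (LinearMap.ext fun z => diff_diff ρ b z)
      ((Finset.univ : Finset ι).toList.map c.basisHomotopy)) z
    rw [LinearMap.add_apply, LinearMap.sub_apply, Module.End.mul_apply, Module.End.mul_apply, hd,
      map_zero, add_zero, Module.End.one_apply, ← rem] at h2
    generalize homotopy (diff ρ b) ((Finset.univ : Finset ι).toList.map c.basisHomotopy) z = y at h2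
    -- Only the component of `y` in degree `q + 2` is kept, so that the new cycle is again
    -- homogeneous of degree `q + 1`.
    have h3 : proj k g N (q + 1) (c.rem Finset.univ.toList z) =
        z - diff ρ b (proj k g N (q + 2) y) := by
      rw [diff_proj_succ, h2, map_sub, hq, sub_sub_cancel]
    have h4 := ih _ (c.proj_mem (q + 1) h1) (proj_proj _ _) (by
      rw [h3, map_sub, hd, diff_diff, sub_zero])
    rw [h3] at h4
    have := add_mem h4 (LinearMap.mem_range_self (diff ρ b) (proj k g N (q + 2) y))
    rwa [sub_add_cancel] at this

include c in
lemma exact (q : ℕ) {z : N ⊗[k] ExteriorAlgebra k g} (hq : proj k g N (q + 1) z = z)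
    (hd : diff ρ b z = 0) : ∃ y, diff ρ b y = z := by
  obtain ⟨r, hr⟩ := c.exists_mem_cFilt z
  exact c.exact_of_mem q r z hr hq hd

end ContractingData

/-! ### Koszul operators on polynomials with coefficients in a representation. -/

/-- The filtration of `Poly k ι ⊗ M` by polynomial degree. -/
def polyFilt (k : Type u) [Field k] (ι : Type w) (M : Type*) [AddCommGroup M] [Module k M]
    (r : ℕ) : Submodule k (Poly k ι ⊗[k] M) :=
  Submodule.span k {z | ∃ v ∈ PBW.filt k ι r, ∃ m, z = v ⊗ₜ m}

variable {ι : Type w}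

lemma tmul_mem_polyFilt {r : ℕ} {v : Poly k ι} (hv : v ∈ PBW.filt k ι r) (m : M) :
    v ⊗ₜ m ∈ polyFilt k ι M r :=
  Submodule.subset_span ⟨v, hv, m, rfl⟩

lemma mem_of_tmul_mem_of_add (f : Poly k ι ⊗[k] M → Poly k ι ⊗[k] M)
    (hadd : ∀ x y, f (x + y) = f x + f y) (hsmul : ∀ (a : k) x, f (a • x) = a • f x) {r s : ℕ}
    (h : ∀ v ∈ PBW.filt k ι r, ∀ m, f (v ⊗ₜ m) ∈ polyFilt k ι M s) {z : Poly k ι ⊗[k] M}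
    (hz : z ∈ polyFilt k ι M r) : f z ∈ polyFilt k ι M s := by
  induction hz using Submodule.span_induction with
  | mem z hz =>
    obtain ⟨v, hv, m, rfl⟩ := hz
    exact h v hv m
  | zero =>
    have h0 := hsmul 0 0
    rw [zero_smul, zero_smul] at h0
    rw [h0]
    exact zero_mem _
  | add x y _ _ hx hy => exact hadd x y ▸ add_mem hx hy
  | smul a x _ hx => exact hsmul a x ▸ Submodule.smul_mem _ a hx

lemma mem_of_tmul_mem (f : Module.End k (Poly k ι ⊗[k] M)) {r s : ℕ}
    (h : ∀ v ∈ PBW.filt k ι r, ∀ m, f (v ⊗ₜ m) ∈ polyFilt k ι M s) {z : Poly k ι ⊗[k] M}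
    (hz : z ∈ polyFilt k ι M r) : f z ∈ polyFilt k ι M s :=
  mem_of_tmul_mem_of_add f (map_add f) (map_smul f) h hz

/-- Division by a variable. -/
def divTensor (M : Type*) [AddCommGroup M] [Module k M] (i : ι) :
    Module.End k (Poly k ι ⊗[k] M) := (divVar k i).rTensor M

/-- The evaluation of a variable at zero. -/
def evalTensor (M : Type*) [AddCommGroup M] [Module k M] (i : ι) :
    Module.End k (Poly k ι ⊗[k] M) := (evalZero k i).rTensor M

lemma divTensor_tmul (i : ι) (v : Poly k ι) (m : M) :
    divTensor M i (v ⊗ₜ m) = divVar k i v ⊗ₜ[k] m := rfl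

lemma evalTensor_tmul (i : ι) (v : Poly k ι) (m : M) :
    evalTensor M i (v ⊗ₜ m) = evalZero k i v ⊗ₜ[k] m := rfl

variable [LinearOrder ι] (b : Module.Basis ι k g) (σ : g →ₗ⁅k⁆ Module.End k M)

/-- The contracting operators on the tensor product of the representation of `g` on polynomials
with a representation. -/
def polyContractingData : ContractingData (tensorRep (rep b) σ) b where
  filt := polyFilt k ι M
  filt_mono _ _ h _ hz :=
    mem_of_tmul_mem 1 (fun _ hv m => tmul_mem_polyFilt (PBW.filt_mono h hv) m) hz
  filt_zero := by
    rw [eq_bot_iff, polyFilt, Submodule.span_le]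
    rintro _ ⟨v, hv, m, rfl⟩
    have : v = 0 := by simpa [PBW.filt] using hv
    simp [this]
  exists_mem z := by
    induction z using TensorProduct.induction_on with
    | zero => exact ⟨0, zero_mem _⟩
    | add z z' h h' =>
      obtain ⟨r, hr⟩ := h
      obtain ⟨s, hs⟩ := h'
      refine ⟨max r s, add_mem ?_ ?_⟩
      · exact mem_of_tmul_mem 1
          (fun _ hv m => tmul_mem_polyFilt (PBW.filt_mono (le_max_left r s) hv) m) hr
      · exact mem_of_tmul_mem 1
          (fun _ hv m => tmul_mem_polyFilt (PBW.filt_mono (le_max_right r s) hv) m) hs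
    | tmul v m =>
      obtain ⟨r, hr⟩ := exists_mem_filt v
      exact ⟨r, tmul_mem_polyFilt hr m⟩
  div i := divTensor M i
  eval i := evalTensor M i
  div_mem i r n := mem_of_tmul_mem _ fun _ hv m => tmul_mem_polyFilt (divVar_mem hv) m
  eval_mem i r n := mem_of_tmul_mem _ fun _ hv m => tmul_mem_polyFilt (evalZero_mem hv) m
  act_div i r n := mem_of_tmul_mem_of_add (fun n => tensorRep (rep b) σ (b i) (divTensor M i n) -
      (n - evalTensor M i n)) (fun x y => by simp only [map_add]; abel)
      (fun a x => by simp only [map_smul, smul_sub]) fun v hv m => by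
    -- The errors are the lower order part of `b i` and its action on `M`; both come after a
    -- division, which has already lowered the degree.
    have h : rep b (b i) (divVar k i v) = v - evalZero k i v + lower b i (divVar k i v) := by
      rw [rep_apply, act_basis, LinearMap.add_apply, shift_divVar]
    have e : tensorRep (rep b) σ (b i) (divTensor M i (v ⊗ₜ m)) -
        (v ⊗ₜ m - evalTensor M i (v ⊗ₜ m)) =
        lower b i (divVar k i v) ⊗ₜ m + divVar k i v ⊗ₜ σ (b i) m := by
      simp only [divTensor_tmul, evalTensor_tmul, tensorRep_tmul, h, add_tmul, sub_tmul]
      abel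
    rw [e]
    exact add_mem (tmul_mem_polyFilt (lower_mem b (divVar_mem hv)) m)
      (tmul_mem_polyFilt (divVar_mem hv) _)
  div_act i j r n := mem_of_tmul_mem_of_add
      (fun n => divTensor M i (tensorRep (rep b) σ (b j) n) -
        tensorRep (rep b) σ (b j) (divTensor M i n) - if j = i then evalTensor M i n else 0)
      (fun x y => by split_ifs <;> simp only [map_add] <;> abel)
      (fun a x => by split_ifs <;> simp only [map_smul, smul_sub, smul_zero]) fun v hv m => by
    -- Division commutes with the action on `M`, so the error is just the commutator of division
    -- with `lower b j`.
    have h : divVar k i (rep b (b j) v) = rep b (b j) (divVar k i v) +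
        ((if j = i then evalZero k i v else 0) +
          (divVar k i (lower b j v) - lower b j (divVar k i v))) := by
      rw [rep_apply, act_basis, LinearMap.add_apply, LinearMap.add_apply, map_add, divVar_shift]
      abel
    have e : divTensor M i (tensorRep (rep b) σ (b j) (v ⊗ₜ m)) -
        tensorRep (rep b) σ (b j) (divTensor M i (v ⊗ₜ m)) -
        (if j = i then evalTensor M i (v ⊗ₜ m) else 0) =
        (divVar k i (lower b j v) - lower b j (divVar k i v)) ⊗ₜ m := by
      have h' : (if j = i then evalTensor M i (v ⊗ₜ m) else 0) =
          (if j = i then evalZero k i v else 0) ⊗ₜ[k] m := by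
        split_ifs
        · rfl
        · rw [zero_tmul]
      simp only [h', divTensor_tmul, tensorRep_tmul, h, add_tmul, sub_tmul, map_add]
      abel
    rw [e]
    exact tmul_mem_polyFilt (sub_mem (divVar_mem (lower_mem b hv)) (lower_mem b (divVar_mem hv))) m

end ChevalleyEilenberg

/-! ### The Chevalley–Eilenberg resolution -/

namespace ChevalleyEilenberg

open PBW

section

variable {k : Type u} {g : Type v} [Field k] [LieRing g] [LieAlgebra k g]
variable {M : Type*} [AddCommGroup M] [Module k M]

/-- A shortcut for instance search. -/
instance moduleEnveloping : Module k (UniversalEnvelopingAlgebra k g) := Algebra.toModule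

/-- The representation `x • u = - u * x` of `g` on its enveloping algebra. -/
def rightMulRep (k : Type u) (g : Type v) [Field k] [LieRing g] [LieAlgebra k g] :
    g →ₗ⁅k⁆ Module.End k (UniversalEnvelopingAlgebra k g) where
  toFun x := -LinearMap.mulRight k (UniversalEnvelopingAlgebra.ι k x)
  map_add' x y := by
    ext u
    simp [mul_add]
    abel
  map_smul' c x := by
    ext u
    simp
  map_lie' {x y} := by
    refine LinearMap.ext fun u => ?_
    simp only [LieHom.map_lie, LieRing.of_associative_ring_bracket, LinearMap.neg_apply,
      LinearMap.mulRight_apply, LinearMap.sub_apply, Module.End.mul_apply]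
    noncomm_ring

variable (φ : UniversalEnvelopingAlgebra k g →ₐ[k] Module.End k M)

/-- The representation of `g` on a module over the enveloping algebra. -/
def moduleRep : g →ₗ⁅k⁆ Module.End k M :=
  φ.toLieHom.comp (UniversalEnvelopingAlgebra.ι k)

lemma moduleRep_apply (x : g) (m : M) :
    moduleRep φ x m = φ (UniversalEnvelopingAlgebra.ι k x) m := rfl

/-- The free module `U ⊗ M` over the enveloping algebra `U`. -/
def FreeMod (k : Type u) (g : Type v) [Field k] [LieRing g] [LieAlgebra k g] (M : Type*)
    [AddCommGroup M] [Module k M] : Type _ :=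
  UniversalEnvelopingAlgebra k g ⊗[k] M

namespace FreeMod

instance : AddCommGroup (FreeMod k g M) :=
  inferInstanceAs (AddCommGroup (UniversalEnvelopingAlgebra k g ⊗[k] M))

instance : Module k (FreeMod k g M) :=
  inferInstanceAs (Module k (UniversalEnvelopingAlgebra k g ⊗[k] M))

instance : Module (UniversalEnvelopingAlgebra k g) (FreeMod k g M) :=
  inferInstanceAs (Module (UniversalEnvelopingAlgebra k g) (UniversalEnvelopingAlgebra k g ⊗[k] M))

instance : IsScalarTower k (UniversalEnvelopingAlgebra k g) (FreeMod k g M) :=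
  inferInstanceAs (IsScalarTower k (UniversalEnvelopingAlgebra k g)
    (UniversalEnvelopingAlgebra k g ⊗[k] M))

instance : Module.Free (UniversalEnvelopingAlgebra k g) (FreeMod k g M) :=
  inferInstanceAs (Module.Free (UniversalEnvelopingAlgebra k g)
    (UniversalEnvelopingAlgebra k g ⊗[k] M))

/-- The identification with the tensor product. -/
def equiv (k : Type u) (g : Type v) [Field k] [LieRing g] [LieAlgebra k g] (M : Type*)
    [AddCommGroup M] [Module k M] :
    (UniversalEnvelopingAlgebra k g ⊗[k] M) ≃ₗ[k] FreeMod k g M := LinearEquiv.refl k _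

/-- A pure tensor. -/
def tmul (u : UniversalEnvelopingAlgebra k g) (m : M) : FreeMod k g M := equiv k g M (u ⊗ₜ m)

lemma tmul_add (u : UniversalEnvelopingAlgebra k g) (m m' : M) :
    tmul u (m + m') = tmul u m + tmul u m' := by
  rw [tmul, TensorProduct.tmul_add, map_add]
  rfl

lemma add_tmul (u u' : UniversalEnvelopingAlgebra k g) (m : M) :
    tmul (u + u') m = tmul u m + tmul u' m := by
  rw [tmul, TensorProduct.add_tmul, map_add]
  rfl

lemma neg_tmul (u : UniversalEnvelopingAlgebra k g) (m : M) : tmul (-u) m = -tmul u m := by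
  rw [tmul, TensorProduct.neg_tmul, map_neg]
  rfl

lemma tmul_zero (u : UniversalEnvelopingAlgebra k g) : tmul u (0 : M) = 0 := by
  rw [tmul, TensorProduct.tmul_zero, map_zero]

lemma smul_tmul (c : k) (u : UniversalEnvelopingAlgebra k g) (m : M) :
    tmul (c • u) m = tmul u (c • m) := by
  rw [tmul, TensorProduct.smul_tmul]
  rfl

lemma smul_tmul_left (a u : UniversalEnvelopingAlgebra k g) (m : M) :
    a • tmul u m = tmul (a * u) m := rfl

lemma induction {P : FreeMod k g M → Prop} (add : ∀ n n', P n → P n' → P (n + n'))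
    (tmul : ∀ u m, P (tmul u m)) (n : FreeMod k g M) : P n := by
  obtain ⟨n, rfl⟩ := (equiv k g M).surjective n
  induction n using TensorProduct.induction_on with
  | zero => simpa [FreeMod.tmul] using tmul 0 0
  | add n n' h h' => exact (map_add (equiv k g M) n n').symm ▸ add _ _ h h'
  | tmul u m => exact tmul u m

/-- The action of an element of the enveloping algebra, as a linear map over the base field. -/
def smulLin (M : Type*) [AddCommGroup M] [Module k M] (u : UniversalEnvelopingAlgebra k g) :
    Module.End k (FreeMod k g M) where
  toFun n := u • n
  map_add' n n' := smul_add u n n'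
  map_smul' c n := smul_comm u c n

/-- The map between free modules induced by a linear map. -/
def map {M' : Type*} [AddCommGroup M'] [Module k M'] (f : M →ₗ[k] M') :
    FreeMod k g M →ₗ[k] FreeMod k g M' :=
  (equiv k g M').toLinearMap ∘ₗ f.lTensor _ ∘ₗ (equiv k g M).symm.toLinearMap

@[simp]
lemma map_tmul {M' : Type*} [AddCommGroup M'] [Module k M'] (f : M →ₗ[k] M')
    (u : UniversalEnvelopingAlgebra k g) (m : M) : map f (tmul u m) = tmul u (f m) := rfl

lemma map_smul_left {M' : Type*} [AddCommGroup M'] [Module k M'] (f : M →ₗ[k] M')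
    (u : UniversalEnvelopingAlgebra k g) (n : FreeMod k g M) : map f (u • n) = u • map f n := by
  induction n using induction with
  | add n n' h h' => rw [smul_add, _root_.map_add, h, h', _root_.map_add, smul_add]
  | tmul a m => rfl

end FreeMod

/-- The representation of `g` on `U ⊗ M`. -/
def freeRep : g →ₗ⁅k⁆ Module.End k (FreeMod k g M) :=
  tensorRep (rightMulRep k g) (moduleRep φ)

lemma freeRep_tmul (x : g) (u : UniversalEnvelopingAlgebra k g) (m : M) :
    freeRep φ x (.tmul u m) = -.tmul (u * UniversalEnvelopingAlgebra.ι k x) m +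
      .tmul u (φ (UniversalEnvelopingAlgebra.ι k x) m) := by
  rw [← FreeMod.neg_tmul]
  rfl

/-- The total space of the resolution of `M`. -/
abbrev Total (k : Type u) (g : Type v) [Field k] [LieRing g] [LieAlgebra k g] (M : Type*)
    [AddCommGroup M] [Module k M] : Type _ :=
  FreeMod k g M ⊗[k] ExteriorAlgebra k g

lemma smul_eq (u : UniversalEnvelopingAlgebra k g) (z : Total k g M) :
    u • z = (FreeMod.smulLin M u).rTensor _ z := rfl

variable {φ} in
lemma map_freeRep {M' : Type*} [AddCommGroup M'] [Module k M']
    {φ' : UniversalEnvelopingAlgebra k g →ₐ[k] Module.End k M'} {f : M →ₗ[k] M'}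
    (hf : ∀ a m, f (φ a m) = φ' a (f m)) (x : g) (n : FreeMod k g M) :
    FreeMod.map f (freeRep φ x n) = freeRep φ' x (FreeMod.map f n) := by
  induction n using FreeMod.induction with
  | add n n' h h' => simp only [map_add, h, h']
  | tmul a m => simp only [freeRep_tmul, map_add, map_neg, FreeMod.map_tmul, hf]

/-- The action of `g` uses right multiplication on `U`, which commutes with left multiplication;
this is what makes the differential `U`-linear. -/
lemma smulLin_freeRep (u : UniversalEnvelopingAlgebra k g) (x : g) (n : FreeMod k g M) :
    FreeMod.smulLin M u (freeRep φ x n) = freeRep φ x (FreeMod.smulLin M u n) := by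
  change u • _ = freeRep φ x (u • n)
  induction n using FreeMod.induction with
  | add n n' h h' => simp only [map_add, h, h', smul_add]
  | tmul a m => simp only [freeRep_tmul, FreeMod.smul_tmul_left, smul_add, smul_neg, mul_assoc]

lemma wedge_smul_left (y : g) (u : UniversalEnvelopingAlgebra k g) (z : Total k g M) :
    wedge _ y (u • z) = u • wedge _ y z := by
  rw [smul_eq, smul_eq, rTensor_wedge]

lemma proj_smul_left (q : ℕ) (u : UniversalEnvelopingAlgebra k g) (z : Total k g M) :
    proj k g _ q (u • z) = u • proj k g _ q z := by
  rw [smul_eq, smul_eq, rTensor_proj]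

lemma theta_smul_left (x : g) (u : UniversalEnvelopingAlgebra k g) (z : Total k g M) :
    theta (freeRep φ) x (u • z) = u • theta (freeRep φ) x z := by
  rw [smul_eq, smul_eq, rTensor_theta _ _ _ (smulLin_freeRep φ u)]

variable {ι : Type*} [Fintype ι] (b : Module.Basis ι k g)

lemma diff_smul_left (u : UniversalEnvelopingAlgebra k g) (z : Total k g M) :
    diff (freeRep φ) b (u • z) = u • diff (freeRep φ) b z := by
  rw [smul_eq, smul_eq, rTensor_diff _ _ _ _ (smulLin_freeRep φ u)]

/-- The augmentation of `U ⊗ M`. -/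
def FreeMod.aug : FreeMod k g M →ₗ[k] M :=
  TensorProduct.lift φ.toLinearMap ∘ₗ (FreeMod.equiv k g M).symm.toLinearMap

/-- The augmentation of the resolution of `M`. -/
def aug : Total k g M →ₗ[k] M :=
  (TensorProduct.rid k M).toLinearMap ∘ₗ
    TensorProduct.map (FreeMod.aug φ) (ExteriorAlgebra.algebraMapInv (R := k) (M := g)).toLinearMap

lemma aug_tmul_one (u : UniversalEnvelopingAlgebra k g) (m : M) :
    aug φ (FreeMod.tmul u m ⊗ₜ 1) = φ u m := by
  simp [aug, FreeMod.aug, FreeMod.tmul]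

lemma aug_wedge (y : g) (z : Total k g M) : aug φ (wedge _ y z) = 0 := by
  induction z using TensorProduct.induction_on with
  | zero => simp
  | add z z' h h' => rw [map_add, map_add, h, h', add_zero]
  | tmul n w => simp [aug, ExteriorAlgebra.algebraMapInv]

lemma aug_freeRep (x : g) (n : FreeMod k g M) : aug φ (freeRep φ x n ⊗ₜ 1) = 0 := by
  induction n using FreeMod.induction with
  | add n n' h h' => rw [map_add, add_tmul, map_add, h, h', add_zero]
  | tmul u m =>
    rw [freeRep_tmul, ← FreeMod.neg_tmul, add_tmul, map_add, aug_tmul_one, aug_tmul_one, map_neg,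
      map_mul, LinearMap.neg_apply, Module.End.mul_apply, neg_add_cancel]

lemma aug_theta (x : g) (z : Total k g M) : aug φ (theta (freeRep φ) x z) = 0 := by
  induction z using wedge_induction with
  | one n => rw [theta_tmul, adExt_one, tmul_zero, add_zero, aug_freeRep]
  | add z z' h h' => rw [map_add, map_add, h, h', add_zero]
  | wedge y z h => rw [theta_wedge, map_add, aug_wedge, aug_wedge, add_zero]

lemma aug_diff (z : Total k g M) : aug φ (diff (freeRep φ) b z) = 0 := by
  induction z using wedge_induction with
  | one n => rw [diff_tmul_one, map_zero]
  | add z z' h h' => rw [map_add, map_add, h, h', add_zero]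
  | wedge y z h => rw [diff_wedge, map_sub, aug_wedge, aug_theta, sub_zero]

lemma aug_smul_left (u : UniversalEnvelopingAlgebra k g) (z : Total k g M) :
    aug φ (u • z) = φ u (aug φ z) := by
  induction z using wedge_induction with
  | one n =>
    induction n using FreeMod.induction with
    | add n n' h h' => rw [add_tmul, smul_add, map_add, h, h', map_add, map_add]
    | tmul a m =>
      rw [smul_tmul', FreeMod.smul_tmul_left, aug_tmul_one, aug_tmul_one, map_mul,
        Module.End.mul_apply]
  | add z z' h h' => rw [smul_add, map_add, h, h', map_add, map_add]
  | wedge y z h => rw [← wedge_smul_left, aug_wedge, aug_wedge, map_zero]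

lemma exists_proj_zero_eq {N : Type*} [AddCommGroup N] [Module k N]
    (z : N ⊗[k] ExteriorAlgebra k g) : ∃ n : N, proj k g N 0 z = n ⊗ₜ 1 := by
  induction z using wedge_induction with
  | one n => exact ⟨n, proj_zero_tmul_one n⟩
  | add z z' h h' =>
    obtain ⟨n, hn⟩ := h
    obtain ⟨n', hn'⟩ := h'
    exact ⟨n + n', by rw [map_add, hn, hn', add_tmul]⟩
  | wedge y z h => exact ⟨0, by rw [proj_zero_wedge, zero_tmul]⟩

/-- For `u = x` in `g` the element is `-d(x ∧ (a ⊗ m))`. The `u` with this property for all `a` and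
`m` form a subalgebra, products being handled by a telescoping sum. -/
lemma tmul_one_sub_mem (u : UniversalEnvelopingAlgebra k g) :
    ∀ (a : UniversalEnvelopingAlgebra k g) (m : M),
      (FreeMod.tmul (a * u) m - FreeMod.tmul a (φ u m)) ⊗ₜ 1 ∈
        LinearMap.range (diff (freeRep φ) b) := by
  let S : Subalgebra k (UniversalEnvelopingAlgebra k g) :=
    { carrier := {u | ∀ (a : UniversalEnvelopingAlgebra k g) (m : M),
        (FreeMod.tmul (a * u) m - FreeMod.tmul a (φ u m)) ⊗ₜ 1 ∈
          LinearMap.range (diff (freeRep φ) b)}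
      mul_mem' := fun {u u'} hu hu' a m => by
        have := add_mem (hu' (a * u) m) (hu a (φ u' m))
        rwa [← add_tmul, sub_add_sub_cancel, mul_assoc, ← Module.End.mul_apply, ← map_mul] at this
      add_mem' := fun {u u'} hu hu' a m => by
        have := add_mem (hu a m) (hu' a m)
        rwa [← add_tmul, ← add_sub_add_comm, ← FreeMod.add_tmul, ← FreeMod.tmul_add, ← mul_add,
          ← LinearMap.add_apply, ← map_add] at this
      algebraMap_mem' := fun c a m => by
        rw [AlgHom.commutes, Module.algebraMap_end_apply, ← Algebra.commutes, ← Algebra.smul_def,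
          FreeMod.smul_tmul, sub_self, zero_tmul]
        exact zero_mem _ }
  have hS : S = ⊤ := CentralBimod.subalgebra_eq_top S fun x a m => by
    rw [← neg_mem_iff]
    refine ⟨wedge _ x (FreeMod.tmul a m ⊗ₜ 1), ?_⟩
    rw [diff_wedge, diff_tmul_one, map_zero, sub_zero, theta_tmul, adExt_one, tmul_zero,
      add_zero, freeRep_tmul, ← neg_tmul, neg_sub, sub_eq_neg_add]
  have hu : u ∈ S := hS ▸ Algebra.mem_top
  exact hu

/-- Modulo boundaries, `u ⊗ m` equals `1 ⊗ u m`, so an element of exterior degree zero is determined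
by its augmentation. -/
lemma exact_zero {z : Total k g M} (hz : proj k g _ 0 z = z) (h : aug φ z = 0) :
    ∃ y, diff (freeRep φ) b y = z := by
  have key (n : FreeMod k g M) :
      (n - FreeMod.tmul 1 (aug φ (n ⊗ₜ 1))) ⊗ₜ 1 ∈ LinearMap.range (diff (freeRep φ) b) := by
    induction n using FreeMod.induction with
    | add n n' h h' =>
      rw [add_tmul, map_add, FreeMod.tmul_add, add_sub_add_comm, add_tmul]
      exact add_mem h h'
    | tmul u m =>
      rw [aug_tmul_one]
      simpa using tmul_one_sub_mem φ b u 1 m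
  obtain ⟨n, hn⟩ := exists_proj_zero_eq z
  rw [hz] at hn
  subst hn
  have := key n
  rwa [h, FreeMod.tmul_zero, sub_zero] at this

/-- The symbol isomorphism carries `x • u = -u x` to the action on polynomials, where
`polyContractingData` is available; exactness is transported back along it. -/
lemma exact_succ [LinearOrder ι] (q : ℕ) {z : Total k g M} (hz : proj k g _ (q + 1) z = z)
    (h : diff (freeRep φ) b z = 0) : ∃ y, diff (freeRep φ) b y = z := by
  let e : FreeMod k g M ≃ₗ[k] Poly k ι ⊗[k] M :=
    (FreeMod.equiv k g M).symm ≪≫ₗ TensorProduct.congr (symbolEquiv b) (LinearEquiv.refl k M)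
  have he0 (u : UniversalEnvelopingAlgebra k g) (m : M) :
      e (.tmul u m) = symbolEquiv b u ⊗ₜ m := rfl
  have he (x : g) (n) : e (freeRep φ x n) = tensorRep (rep b) (moduleRep φ) x (e n) := by
    induction n using FreeMod.induction with
    | add n n' h h' => simp only [map_add, h, h']
    | tmul u m =>
      rw [freeRep_tmul, ← FreeMod.neg_tmul, map_add, he0, he0, he0, map_neg, symbolEquiv_mul_ι,
        neg_neg]
      rfl
  have he' (x : g) (n) : e.symm (tensorRep (rep b) (moduleRep φ) x n) =
      freeRep φ x (e.symm n) := by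
    rw [LinearEquiv.symm_apply_eq, he, LinearEquiv.apply_symm_apply]
  have hes (z : Total k g M) :
      e.symm.toLinearMap.rTensor _ (e.toLinearMap.rTensor _ z) = z := by
    rw [← LinearMap.rTensor_comp_apply, LinearEquiv.comp_coe, LinearEquiv.self_trans_symm]
    simp
  obtain ⟨y, hy⟩ := (polyContractingData b (moduleRep φ)).exact q
    (z := e.toLinearMap.rTensor _ z) (by rw [← rTensor_proj, hz])
    (by rw [← rTensor_diff (freeRep φ) b _ _ he, h, map_zero])
  refine ⟨e.symm.toLinearMap.rTensor _ y, ?_⟩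
  rw [← rTensor_diff (tensorRep (rep b) (moduleRep φ)) b (freeRep φ) _ he', hy, hes]

end

/-! ### A criterion for projective resolutions. -/

section

variable {A : Type w} [Ring A] {Z : ModuleCat.{w} A}

/-- A projective resolution from an exact complex of projective modules. -/
def projectiveResolutionOfExact (K : ChainComplex (ModuleCat.{w} A) ℕ) (ε : K.X 0 ⟶ Z)
    (hε : K.d 1 0 ≫ ε = 0) (hK : ∀ n, Projective (K.X n)) (hs : Function.Surjective ε.hom)
    (h0 : ∀ x : K.X 0, ε.hom x = 0 → ∃ y, (K.d 1 0).hom y = x)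
    (h : ∀ n, ∀ x : K.X (n + 1), (K.d (n + 1) n).hom x = 0 →
      ∃ y, (K.d (n + 2) (n + 1)).hom y = x) :
    ProjectiveResolution Z where
  complex := K
  projective := hK
  π := (K.toSingle₀Equiv Z).symm ⟨ε, hε⟩
  quasiIso := ⟨fun n => by
    cases n with
    | zero =>
      rw [ChainComplex.quasiIsoAt₀_iff, ShortComplex.quasiIso_iff_of_zeros']
      · have : Epi ε := (ModuleCat.epi_iff_surjective ε).2 hs
        refine (ShortComplex.exact_and_epi_g_iff_of_iso
          (S₁ := ShortComplex.mk (K.d 1 0) ε hε) ?_).1 ⟨?_, this⟩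
        · refine ShortComplex.isoMk (Iso.refl _) (Iso.refl _) (Iso.refl _) ?_ ?_
          · exact (Category.id_comp _).trans (Category.comp_id _).symm
          · refine (Category.id_comp _).trans (Eq.trans ?_ (Category.comp_id _).symm)
            exact ChainComplex.toSingle₀Equiv_symm_apply_f_zero _ _
        · rw [ShortComplex.moduleCat_exact_iff]
          exact h0
      · exact K.shape 0 0 (by simp)
      · rfl
      · rfl
    | succ n =>
      rw [quasiIsoAt_iff_exactAt' _ _ (ChainComplex.exactAt_succ_single_obj _ _),
        HomologicalComplex.exactAt_iff' _ (n + 2) (n + 1) n (by simp) (by simp),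
        ShortComplex.moduleCat_exact_iff]
      exact h n⟩

lemma projectiveResolutionOfExact_π (K : ChainComplex (ModuleCat.{w} A) ℕ) (ε : K.X 0 ⟶ Z)
    (hε : K.d 1 0 ≫ ε = 0) (hK hs h0 h) :
    (projectiveResolutionOfExact K ε hε hK hs h0 h).π.f 0 = ε :=
  ChainComplex.toSingle₀Equiv_symm_apply_f_zero _ _

end

/-! ### The resolution as a complex of `U`-modules. -/

section

variable {k : Type u} {g : Type v} [Field k] [LieRing g] [LieAlgebra k g]
  {ι : Type w} [Fintype ι] (b : Module.Basis ι k g)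

section

variable {M : Type*} [AddCommGroup M] [Module k M]
  (φ : UniversalEnvelopingAlgebra k g →ₐ[k] Module.End k M)

/-- The component of exterior degree `q` of the resolution. -/
def component (k : Type u) (g : Type v) [Field k] [LieRing g] [LieAlgebra k g] (M : Type*)
    [AddCommGroup M] [Module k M] (q : ℕ) :
    Submodule (UniversalEnvelopingAlgebra k g) (Total k g M) where
  carrier := {z | proj k g _ q z = z}
  add_mem' := fun {z z'} hz hz' => by
    rw [Set.mem_ofPred_eq] at hz hz' ⊢
    rw [map_add, hz, hz']
  zero_mem' := map_zero _
  smul_mem' := fun u z hz => by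
    rw [Set.mem_ofPred_eq] at hz ⊢
    rw [proj_smul_left, hz]

lemma mem_component {q : ℕ} {z : Total k g M} : z ∈ component k g M q ↔ proj k g _ q z = z :=
  Iff.rfl

/-- The projection to a component. -/
def toComponent (k : Type u) (g : Type v) [Field k] [LieRing g] [LieAlgebra k g] (M : Type*)
    [AddCommGroup M] [Module k M] (q : ℕ) :
    Total k g M →ₗ[UniversalEnvelopingAlgebra k g] component k g M q where
  toFun z := ⟨proj k g _ q z, proj_proj q z⟩
  map_add' z z' := Subtype.ext (map_add _ z z')
  map_smul' u z := Subtype.ext (proj_smul_left q u z)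

lemma toComponent_coe {q : ℕ} (z : component k g M q) : toComponent k g M q z = z :=
  Subtype.ext z.2

/-- A direct summand of the total space, which is free over `U`. -/
instance (q : ℕ) : Module.Projective (UniversalEnvelopingAlgebra k g) (component k g M q) :=
  Module.Projective.of_split (component k g M q).subtype (toComponent k g M q)
    (LinearMap.ext toComponent_coe)

/-- The differential between two components. -/
def componentDiff (p q : ℕ) :
    component k g M p →ₗ[UniversalEnvelopingAlgebra k g] component k g M q where
  toFun z := toComponent k g M q (diff (freeRep φ) b z)
  map_add' z z' := by rw [Submodule.coe_add, map_add, map_add]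
  map_smul' u z := by rw [Submodule.coe_smul, diff_smul_left, map_smul, RingHom.id_apply]

lemma componentDiff_coe (q : ℕ) (z : component k g M (q + 1)) :
    (componentDiff b φ (q + 1) q z : Total k g M) = diff (freeRep φ) b z := by
  change proj k g _ q _ = _
  rw [← diff_proj_succ, mem_component.1 z.2]

end

open CentralBimod

/-- The Chevalley–Eilenberg complex of a bimodule over the enveloping algebra, regarded as a left
module. -/
def chainComplex (M : CentralBimod.{u, max u v} k (UniversalEnvelopingAlgebra k g)) :
    ChainComplex (ModuleCat.{max u v} (UniversalEnvelopingAlgebra k g)) ℕ where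
  X q := ModuleCat.of _ (component k g M q)
  -- `componentDiff` exists for every pair of degrees, so no transport along `q + 1 = p` is needed.
  d p q := if q + 1 = p then ModuleCat.ofHom (componentDiff b M.left p q) else 0
  shape p q h := if_neg h
  d_comp_d' p q r hpq hqr := by
    obtain rfl : r + 1 = q := hqr
    obtain rfl : r + 1 + 1 = p := hpq
    rw [if_pos rfl, if_pos rfl]
    refine ModuleCat.hom_ext (LinearMap.ext fun z => Subtype.ext ?_)
    change (componentDiff b M.left (r + 1) r (componentDiff b M.left (r + 1 + 1) (r + 1) z) :
      Total k g M) = 0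
    rw [componentDiff_coe, componentDiff_coe, diff_diff]

lemma chainComplex_d (M : CentralBimod.{u, max u v} k (UniversalEnvelopingAlgebra k g)) (q : ℕ) :
    (chainComplex b M).d (q + 1) q = ModuleCat.ofHom (componentDiff b M.left (q + 1) q) :=
  if_pos rfl

/-- The augmentation of the Chevalley–Eilenberg complex. -/
def augmentation (M : CentralBimod.{u, max u v} k (UniversalEnvelopingAlgebra k g)) :
    (chainComplex b M).X 0 ⟶ (toLeft k _).obj M :=
  ModuleCat.ofHom (X := component k g M 0) (Y := M.LeftMod)
    { toFun := fun z => aug M.left z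
      map_add' := fun z z' => map_add (aug M.left) z.1 z'.1
      map_smul' := fun u z => aug_smul_left M.left u z.1 }

/-- The Chevalley–Eilenberg resolution of a bimodule over the enveloping algebra, regarded as a left
module. -/
def resolution [LinearOrder ι]
    (M : CentralBimod.{u, max u v} k (UniversalEnvelopingAlgebra k g)) :
    ProjectiveResolution ((toLeft k _).obj M) :=
  projectiveResolutionOfExact (chainComplex b M) (augmentation b M)
    (by
      rw [chainComplex_d]
      refine ModuleCat.hom_ext (LinearMap.ext fun z => ?_)
      exact (congrArg (aug M.left) (componentDiff_coe b M.left 0 z)).trans (aug_diff M.left b _))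
    (fun q => (IsProjective.iff_projective _).1
      (inferInstanceAs (Module.Projective _ (component k g M q))))
    (fun m => ⟨⟨FreeMod.tmul 1 m ⊗ₜ[k] (1 : ExteriorAlgebra k g), proj_zero_tmul_one _⟩, by
      refine (aug_tmul_one M.left 1 m).trans ?_
      rw [map_one]
      rfl⟩)
    (fun z hz => by
      obtain ⟨y, hy⟩ := exact_zero M.left b z.2 hz
      refine ⟨toComponent k g M 1 y, ?_⟩
      rw [chainComplex_d]
      refine Subtype.ext ((componentDiff_coe b M.left 0 _).trans ?_)
      exact (diff_proj_succ _ b 0 y).trans ((congrArg _ hy).trans z.2))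
    (fun n z hz => by
      rw [chainComplex_d] at hz
      have hz' : diff (freeRep M.left) b z.1 = 0 :=
        (componentDiff_coe b M.left n z).symm.trans (congrArg Subtype.val hz)
      obtain ⟨y, hy⟩ := exact_succ M.left b n z.2 hz'
      refine ⟨toComponent k g M (n + 2) y, ?_⟩
      rw [chainComplex_d]
      refine Subtype.ext ((componentDiff_coe b M.left (n + 1) _).trans ?_)
      exact (diff_proj_succ _ b (n + 1) y).trans ((congrArg _ hy).trans z.2))

end

end ChevalleyEilenberg

/-! ### Cochains -/

namespace ChevalleyEilenberg

section

variable {k : Type u} {g : Type v} [Field k] [LieRing g] [LieAlgebra k g]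

section Finite

variable [FiniteDimensional k g]

lemma exteriorPower_eq_bot {q : ℕ} (h : Module.finrank k g < q) : ⋀[k]^q g = ⊥ := by
  rw [← Submodule.finrank_eq_zero (R := k), exteriorPower.finrank_eq, Nat.choose_eq_zero_of_lt h]

lemma extProj_eq_zero {q : ℕ} (h : Module.finrank k g < q) (w : ExteriorAlgebra k g) :
    extProj k g q w = 0 := by
  have := extProj_mem q w
  rwa [exteriorPower_eq_bot h, Submodule.mem_bot] at this

lemma proj_eq_zero {N : Type*} [AddCommGroup N] [Module k N] {q : ℕ}
    (h : Module.finrank k g < q) (z : N ⊗[k] ExteriorAlgebra k g) : proj k g N q z = 0 := by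
  induction z using TensorProduct.induction_on with
  | zero => exact map_zero _
  | add z z' h h' => rw [map_add, h, h', add_zero]
  | tmul n w => rw [proj_tmul, extProj_eq_zero h, tmul_zero]

instance finite_exteriorAlgebra : Module.Finite k (ExteriorAlgebra k g) := by
  let S : Submodule k (ExteriorAlgebra k g) :=
    ⨆ q ∈ Finset.range (Module.finrank k g + 1), ⋀[k]^q g
  have hS : S = ⊤ := by
    classical
    refine eq_top_iff.2 fun w _ => ?_
    rw [← DirectSum.sum_support_decompose (fun q : ℕ => ⋀[k]^q g) w]
    refine Submodule.sum_mem _ fun q _ => ?_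
    by_cases hq : q < Module.finrank k g + 1
    · exact Submodule.mem_iSup_of_mem q (Submodule.mem_iSup_of_mem (Finset.mem_range.2 hq)
        (Subtype.property _))
    · have := (DirectSum.decompose (fun q : ℕ => ⋀[k]^q g) w q).2
      have h0 : (DirectSum.decompose (fun q : ℕ => ⋀[k]^q g) w q : ExteriorAlgebra k g) = 0 := by
        exact (Submodule.mem_bot k).1 ((exteriorPower_eq_bot (by omega)).le this)
      rw [h0]
      exact zero_mem _
  refine ⟨hS ▸ Submodule.fg_biSup _ _ fun q _ => ?_⟩
  exact Module.Finite.iff_fg.1 (exteriorPower.instFinite (R := k) (M := g) (n := q))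

end Finite

variable {M : Type*} [AddCommGroup M] [Module k M]

/-- The inclusion of the generators in the resolution. -/
def inc (k : Type u) (g : Type v) [Field k] [LieRing g] [LieAlgebra k g] (M : Type*)
    [AddCommGroup M] [Module k M] : M ⊗[k] ExteriorAlgebra k g →ₗ[k] Total k g M :=
  ((FreeMod.equiv k g M).toLinearMap ∘ₗ
    TensorProduct.mk k (UniversalEnvelopingAlgebra k g) M 1).rTensor _

lemma inc_tmul (m : M) (w : ExteriorAlgebra k g) :
    inc k g M (m ⊗ₜ w) = FreeMod.tmul 1 m ⊗ₜ w := rfl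

lemma inc_induction {P : Total k g M → Prop} (add : ∀ z z', P z → P z' → P (z + z'))
    (smul : ∀ (u : UniversalEnvelopingAlgebra k g) l, P (u • inc k g M l)) (z : Total k g M) : P z := by
  induction z using TensorProduct.induction_on with
  | zero => simpa using smul 0 0
  | add z z' h h' => exact add _ _ h h'
  | tmul n w =>
    induction n using FreeMod.induction with
    | add n n' h h' =>
      rw [add_tmul]
      exact add _ _ h h'
    | tmul u m =>
      have := smul u (m ⊗ₜ[k] w)
      rwa [inc_tmul, smul_tmul', FreeMod.smul_tmul_left, mul_one] at this

lemma wedge_inc (y : g) (l : M ⊗[k] ExteriorAlgebra k g) :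
    wedge _ y (inc k g M l) = inc k g M (wedge _ y l) :=
  (rTensor_wedge _ y l).symm

lemma proj_inc (q : ℕ) (l : M ⊗[k] ExteriorAlgebra k g) :
    proj k g _ q (inc k g M l) = inc k g M (proj k g _ q l) :=
  (rTensor_proj _ q l).symm

variable (φ : UniversalEnvelopingAlgebra k g →ₐ[k] Module.End k M)

/-- On generators `1 ⊗ m` the right multiplication by `x` coincides with the left one. Hence `theta`
acts on cochains as `c ↦ c ∘ θ_x - x c`, see `cochain_theta`. -/
lemma theta_inc (x : g) (l : M ⊗[k] ExteriorAlgebra k g) :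
    theta (freeRep φ) x (inc k g M l) =
      inc k g M (theta (moduleRep φ) x l) - UniversalEnvelopingAlgebra.ι k x • inc k g M l := by
  induction l using TensorProduct.induction_on with
  | zero => simp
  | add l l' h h' =>
    simp only [map_add, h, h', smul_add]
    abel
  | tmul m w =>
    rw [inc_tmul, theta_tmul, theta_tmul, freeRep_tmul, map_add, inc_tmul, inc_tmul, smul_tmul',
      FreeMod.smul_tmul_left, one_mul, mul_one, add_tmul, neg_tmul, moduleRep_apply]
    abel

/-- The homomorphism from the resolution to `U` with given values on the generators. -/
def cochain (c : M ⊗[k] ExteriorAlgebra k g →ₗ[k] UniversalEnvelopingAlgebra k g) :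
    Total k g M →ₗ[UniversalEnvelopingAlgebra k g] UniversalEnvelopingAlgebra k g :=
  let F : Total k g M →ₗ[k] UniversalEnvelopingAlgebra k g := TensorProduct.lift
    (TensorProduct.lift (LinearMap.mk₂ k
      (fun u m => LinearMap.mulLeft k u ∘ₗ c ∘ₗ TensorProduct.mk k M (ExteriorAlgebra k g) m)
      (fun u u' m => LinearMap.ext fun w => add_mul _ _ _)
      (fun a u m => LinearMap.ext fun w => smul_mul_assoc _ _ _)
      (fun u m m' => LinearMap.ext fun w => by simp [mul_add])
      (fun a u m => LinearMap.ext fun w => by simp)) ∘ₗ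
        (FreeMod.equiv k g M).symm.toLinearMap)
  have hF (u m w) : F (FreeMod.tmul u m ⊗ₜ w) = u * c (m ⊗ₜ w) := rfl
  { toFun := F
    map_add' := map_add F
    map_smul' := fun u z => by
      induction z using TensorProduct.induction_on with
      | zero => simp
      | add z z' h h' => rw [smul_add, map_add, h, h', map_add, smul_add]
      | tmul n w =>
        induction n using FreeMod.induction with
        | add n n' h h' => rw [add_tmul, smul_add, map_add, h, h', map_add, smul_add]
        | tmul a m =>
          rw [smul_tmul', FreeMod.smul_tmul_left, hF, hF, RingHom.id_apply, smul_eq_mul, mul_assoc] }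

lemma cochain_tmul (c : M ⊗[k] ExteriorAlgebra k g →ₗ[k] UniversalEnvelopingAlgebra k g)
    (u : UniversalEnvelopingAlgebra k g) (m : M) (w : ExteriorAlgebra k g) :
    cochain c (FreeMod.tmul u m ⊗ₜ w) = u * c (m ⊗ₜ w) := rfl

lemma cochain_inc (c : M ⊗[k] ExteriorAlgebra k g →ₗ[k] UniversalEnvelopingAlgebra k g)
    (l : M ⊗[k] ExteriorAlgebra k g) : cochain c (inc k g M l) = c l := by
  induction l using TensorProduct.induction_on with
  | zero => simp
  | add l l' h h' => rw [map_add, map_add, h, h', map_add]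
  | tmul m w => rw [inc_tmul, cochain_tmul, one_mul]

lemma hom_ext_inc {Y : Type*} [AddCommGroup Y] [Module (UniversalEnvelopingAlgebra k g) Y]
    {F F' : Total k g M →ₗ[UniversalEnvelopingAlgebra k g] Y}
    (h : ∀ l, F (inc k g M l) = F' (inc k g M l)) : F = F' := by
  refine LinearMap.ext fun z => ?_
  induction z using inc_induction with
  | add z z' h h' => rw [map_add, map_add, h, h']
  | smul u l => rw [map_smul, map_smul, h]

lemma cochain_proj (c : M ⊗[k] ExteriorAlgebra k g →ₗ[k] UniversalEnvelopingAlgebra k g) (q : ℕ)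
    (z : Total k g M) : cochain c (proj k g _ q z) = cochain (c ∘ₗ proj k g M q) z := by
  induction z using inc_induction with
  | add z z' h h' => rw [map_add, map_add, map_add, h, h']
  | smul u l =>
    rw [proj_smul_left, map_smul, map_smul, proj_inc, cochain_inc, cochain_inc]
    rfl

lemma cochain_theta (c : M ⊗[k] ExteriorAlgebra k g →ₗ[k] UniversalEnvelopingAlgebra k g) (x : g)
    (z : Total k g M) : cochain c (theta (freeRep φ) x z) =
      cochain (c ∘ₗ theta (moduleRep φ) x -
        LinearMap.mulLeft k (UniversalEnvelopingAlgebra.ι k x) ∘ₗ c) z := by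
  induction z using inc_induction with
  | add z z' h h' => rw [map_add, map_add, map_add, h, h']
  | smul u l =>
    rw [theta_smul_left, map_smul, map_smul, theta_inc, map_sub, map_smul, cochain_inc,
      cochain_inc, cochain_inc]
    rfl

/-! ### Contractions in codimension one. -/

section contract

variable {N : Type*} [AddCommGroup N] [Module k N]

lemma contract_wedge (ξ : Module.Dual k g) (y : g) (z : N ⊗[k] ExteriorAlgebra k g) :
    (contract ξ).lTensor N (wedge N y z) = ξ y • z - wedge N y ((contract ξ).lTensor N z) := by
  induction z using TensorProduct.induction_on with
  | zero => simp
  | add z z' h h' =>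
    simp only [map_add, h, h', smul_add]
    abel
  | tmul n w =>
    rw [wedge_tmul, LinearMap.lTensor_tmul, LinearMap.lTensor_tmul, contract_ι_mul, wedge_tmul,
      tmul_sub, tmul_smul]

lemma wedge_wedge_comm (x y : g) (z : N ⊗[k] ExteriorAlgebra k g) :
    wedge N x (wedge N y z) = -wedge N y (wedge N x z) := by
  induction z using TensorProduct.induction_on with
  | zero => simp
  | add z z' h h' =>
    simp only [map_add, h, h', neg_add]
  | tmul n w => rw [wedge_tmul, wedge_tmul, wedge_tmul, wedge_tmul, ι_mul_ι_mul_comm, tmul_neg]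

variable {ι : Type*} [Fintype ι] (b : Module.Basis ι k g)

lemma sum_coord_smul_wedge (y : g) (z : N ⊗[k] ExteriorAlgebra k g) :
    ∑ i, b.coord i y • wedge N (b i) z = wedge N y z := by
  let F : g →ₗ[k] N ⊗[k] ExteriorAlgebra k g :=
    { toFun := fun y => wedge N y z
      map_add' := fun x y => wedge_add x y z
      map_smul' := fun c x => wedge_smul c x z }
  change ∑ i, b.coord i y • F (b i) = F y
  simp_rw [← map_smul, ← map_sum, Module.Basis.coord_apply, b.sum_repr]

/-- An Euler identity: on a monomial of degree `q` in the basis vectors, the sum counts those that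
do not occur. Moving a factor `y` through the sum lowers the count by one. -/
lemma sum_contract_wedge (q : ℕ) (z : N ⊗[k] ExteriorAlgebra k g) :
    ∑ i, (contract (b.coord i)).lTensor N (wedge N (b i) (proj k g N q z)) =
      ((Fintype.card ι : k) - q) • proj k g N q z := by
  induction z using wedge_induction generalizing q with
  | one n =>
    cases q with
    | zero =>
      simp only [proj_zero_tmul_one, contract_wedge, LinearMap.lTensor_tmul, contract_one,
        tmul_zero, map_zero, sub_zero, Module.Basis.coord_apply, Module.Basis.repr_self,
        Finsupp.single_eq_same, one_smul]
      simp [← Nat.cast_smul_eq_nsmul k]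
    | succ q => simp only [proj_succ_tmul_one, map_zero, smul_zero, Finset.sum_const_zero]
  | add z z' h h' => simp only [map_add, Finset.sum_add_distrib, h, h', smul_add]
  | wedge y z h =>
    cases q with
    | zero => simp [proj_zero_wedge]
    | succ q =>
      rw [proj_succ_wedge]
      simp only [wedge_wedge_comm _ y, map_neg, contract_wedge (b.coord _) y, neg_sub,
        Finset.sum_sub_distrib, sum_coord_smul_wedge, ← map_sum, h, map_smul]
      rw [Nat.cast_succ, ← sub_sub, sub_smul _ (1 : k), one_smul]

/-- In codimension one the factor of `sum_contract_wedge` is `1`, so nothing is divided and the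
characteristic does not matter. -/
lemma cochain_eq_sum (c : M ⊗[k] ExteriorAlgebra k g →ₗ[k] UniversalEnvelopingAlgebra k g) (q : ℕ)
    (hq : q + 1 = Fintype.card ι) {z : Total k g M} (hz : proj k g _ q z = z) :
    cochain c z = ∑ i, cochain (c ∘ₗ (contract (b.coord i)).lTensor M) (wedge _ (b i) z) := by
  have key (z : Total k g M) : cochain c (proj k g _ q z) =
      ∑ i, cochain (c ∘ₗ (contract (b.coord i)).lTensor M) (wedge _ (b i) (proj k g _ q z)) := by
    induction z using inc_induction with
    | add z z' h h' => simp only [map_add, Finset.sum_add_distrib, h, h']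
    | smul u l =>
      simp only [proj_smul_left, wedge_smul_left, map_smul, proj_inc, wedge_inc, cochain_inc,
        LinearMap.comp_apply]
      rw [← Finset.smul_sum, ← map_sum, sum_contract_wedge, ← hq]
      simp
  rw [← hz]
  exact key z

end contract

/-- The action of the enveloping algebra on the generators of the resolution. -/
def generatorAction : UniversalEnvelopingAlgebra k g →ₐ[k]
    Module.End k (M ⊗[k] ExteriorAlgebra k g) :=
  UniversalEnvelopingAlgebra.lift k
    { toFun := theta (moduleRep φ)
      map_add' := fun x y => by
        simp only [theta, map_add, LinearMap.rTensor_add, LinearMap.lTensor_add]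
        abel
      map_smul' := fun c x => by
        simp only [theta, map_smul, LinearMap.rTensor_smul, LinearMap.lTensor_smul, smul_add,
          RingHom.id_apply]
      map_lie' := fun {x y} => LinearMap.ext fun l => by
        rw [LieRing.of_associative_ring_bracket, LinearMap.sub_apply, Module.End.mul_apply,
          Module.End.mul_apply, theta_lie, add_sub_cancel_left] }

lemma generatorAction_ι (x : g) :
    generatorAction φ (UniversalEnvelopingAlgebra.ι k x) = theta (moduleRep φ) x :=
  UniversalEnvelopingAlgebra.lift_ι_apply k _ x

/-- Let both sides, as elements of `U`, act on a fixed vector `l` of the finite dimensional space `M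
⊗ ⋀ g`. As operators in the variable `l'`, the left side has rank at most one and trace `μ l`, while
the right side is a sum of commutators. -/
lemma dual_eq_zero_of_sum [FiniteDimensional k g] [FiniteDimensional k M] {ι : Type*} [Fintype ι]
    (b : Module.Basis ι k g) (μ : Module.Dual k (M ⊗[k] ExteriorAlgebra k g))
    (c : ι → M ⊗[k] ExteriorAlgebra k g →ₗ[k] UniversalEnvelopingAlgebra k g)
    (h : ∀ l, algebraMap k _ (μ l) = ∑ i, (c i (theta (moduleRep φ) (b i) l) -
      UniversalEnvelopingAlgebra.ι k (b i) * c i l)) : μ = 0 := by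
  refine LinearMap.ext fun l => ?_
  -- `A c` sends `l'` to `c(l')` acting on `l`; left multiplication of `c` by `x` becomes
  -- composition of `A c` with `θ_x`.
  let A (c : M ⊗[k] ExteriorAlgebra k g →ₗ[k] UniversalEnvelopingAlgebra k g) :
      Module.End k (M ⊗[k] ExteriorAlgebra k g) :=
    LinearMap.applyₗ l ∘ₗ (generatorAction φ).toLinearMap ∘ₗ c
  have hA : μ.smulRight l = ∑ i, (A (c i) * theta (moduleRep φ) (b i) -
      theta (moduleRep φ) (b i) * A (c i)) := by
    refine LinearMap.ext fun l' => ?_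
    have := congrArg (fun u => generatorAction φ u l) (h l')
    simp only [AlgHom.commutes, Module.algebraMap_end_apply, map_sum, map_sub, map_mul,
      generatorAction_ι, LinearMap.sum_apply, LinearMap.sub_apply, Module.End.mul_apply] at this
    rw [LinearMap.smulRight_apply, this, LinearMap.sum_apply]
    rfl
  have := congrArg (LinearMap.trace k _) hA
  simp only [map_sum, map_sub, LinearMap.trace_mul_comm k (A _), sub_self,
    Finset.sum_const_zero] at this
  simpa using this

end

end ChevalleyEilenberg

/-! ### Classes of cochains of top degree -/

namespace ChevalleyEilenberg

open CentralBimod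

/-- There are no coboundaries in degree zero. This is needed for `g = 0`, where the top degree has
no predecessor. -/
lemma eq_zero_of_extMk_eq_zero {C : Type*} [Category C] [Abelian C] [HasExt C] {X Y : C}
    (R : ProjectiveResolution X) (f : R.complex.X 0 ⟶ Y) (m : ℕ) (hm : 0 + 1 = m)
    (hf : R.complex.d m 0 ≫ f = 0) (h : R.extMk f m hm hf = 0) : f = 0 := by
  rw [← R.extEquivCohomologyClass.apply_eq_iff_eq, R.extEquivCohomologyClass_extMk,
    R.extEquivCohomologyClass_zero, CochainComplex.HomComplex.CohomologyClass.mk_eq_zero_iff,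
    CochainComplex.HomComplex.Cocycle.toSingleMk_mem_coboundaries_iff _ _ _ _ _ 1 (by simp)] at h
  obtain ⟨e, he⟩ := h
  have h0 : Limits.IsZero (R.cochainComplex.X 1) :=
    R.cochainComplex.isZero_of_isStrictlyLE 0 1 (by omega)
  rw [h0.eq_of_src e 0, Limits.comp_zero] at he
  rw [← cancel_epi (R.cochainComplexXIso (-((0 : ℕ) : ℤ)) 0 rfl).hom, ← he, Limits.comp_zero]

variable {k : Type u} {g : Type v} [Field k] [LieRing g] [LieAlgebra k g]

section

variable {M M' : Type*} [AddCommGroup M] [Module k M] [AddCommGroup M'] [Module k M']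

/-- The map induced by a linear map on the total spaces of the resolutions. -/
def totalMap (f : M →ₗ[k] M') : Total k g M →ₗ[UniversalEnvelopingAlgebra k g] Total k g M' where
  toFun := (FreeMod.map f).rTensor _
  map_add' := map_add _
  map_smul' u z := by
    induction z using TensorProduct.induction_on with
    | zero => simp
    | add z z' h h' => rw [smul_add, map_add, h, h', map_add, smul_add]
    | tmul n w =>
      rw [smul_tmul', LinearMap.rTensor_tmul, LinearMap.rTensor_tmul, FreeMod.map_smul_left]
      rfl

lemma totalMap_apply (f : M →ₗ[k] M') (z : Total k g M) :
    totalMap f z = (FreeMod.map f).rTensor _ z := rfl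

lemma totalMap_inc (f : M →ₗ[k] M') (l : M ⊗[k] ExteriorAlgebra k g) :
    totalMap f (inc k g M l) = inc k g M' (f.rTensor _ l) := by
  induction l using TensorProduct.induction_on with
  | zero => simp
  | add l l' h h' => simp only [map_add, h, h']
  | tmul m w => rfl

lemma cochain_totalMap (f : M →ₗ[k] M')
    (c : M' ⊗[k] ExteriorAlgebra k g →ₗ[k] UniversalEnvelopingAlgebra k g) (z : Total k g M) :
    cochain c (totalMap f z) = cochain (c ∘ₗ f.rTensor _) z := by
  induction z using inc_induction with
  | add z z' h h' => simp only [map_add, h, h']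
  | smul u l =>
    rw [map_smul, map_smul, map_smul, totalMap_inc, cochain_inc, cochain_inc]
    rfl

/-- The map induced by a linear map on a component of the resolutions. -/
def componentMap (f : M →ₗ[k] M') (q : ℕ) :
    component k g M q →ₗ[UniversalEnvelopingAlgebra k g] component k g M' q :=
  (totalMap f).restrict fun z hz => by
    rw [mem_component] at hz ⊢
    rw [totalMap_apply, ← rTensor_proj, hz]

variable {φ : UniversalEnvelopingAlgebra k g →ₐ[k] Module.End k M}
  {φ' : UniversalEnvelopingAlgebra k g →ₐ[k] Module.End k M'}

lemma aug_totalMap {f : M →ₗ[k] M'} (hf : ∀ a m, f (φ a m) = φ' a (f m)) (z : Total k g M) :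
    aug φ' (totalMap f z) = f (aug φ z) := by
  induction z using wedge_induction with
  | one n =>
    induction n using FreeMod.induction with
    | add n n' h h' => rw [add_tmul, map_add, map_add, h, h', map_add, map_add]
    | tmul u m =>
      rw [aug_tmul_one, hf]
      exact aug_tmul_one φ' u (f m)
  | add z z' h h' => simp only [map_add, h, h']
  | wedge y z h => rw [totalMap_apply, rTensor_wedge, aug_wedge, aug_wedge, map_zero]

end

variable {n : ℕ} (b : Module.Basis (Fin n) k g)
  {M M' : CentralBimod.{u, max u v} k (UniversalEnvelopingAlgebra k g)}

/-- The map between resolutions which is induced by a map of left modules. -/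
def chainMap (f : M →ₗ[k] M') (hf : ∀ a m, f (M.left a m) = M'.left a (f m)) :
    chainComplex b M ⟶ chainComplex b M' where
  f q := ModuleCat.ofHom (componentMap f q)
  comm' p q h := by
    obtain rfl : q + 1 = p := h
    rw [chainComplex_d, chainComplex_d]
    refine ModuleCat.hom_ext (LinearMap.ext fun z => Subtype.ext ?_)
    refine (componentDiff_coe b M'.left q _).trans ?_
    refine Eq.trans ?_ (congrArg (totalMap f) (componentDiff_coe b M.left q z)).symm
    exact (rTensor_diff _ _ _ _ (map_freeRep hf) _).symm

/-- The map between resolutions which is induced by a map of left modules. -/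
def resolutionHom (f : M →ₗ[k] M') (hf : ∀ a m, f (M.left a m) = M'.left a (f m))
    (F : (toLeft k _).obj M ⟶ (toLeft k _).obj M') (hF : ∀ m : M, F.hom m = f m) :
    ProjectiveResolution.Hom (resolution b M) (resolution b M') F where
  hom := chainMap b f hf
  hom_f_zero_comp_π_f_zero := by
    refine (congrArg _ (projectiveResolutionOfExact_π _ _ _ _ _ _ _)).trans ?_
    refine Eq.trans ?_ (congrArg (· ≫ _) (projectiveResolutionOfExact_π _ _ _ _ _ _ _)).symm
    refine ModuleCat.hom_ext (LinearMap.ext fun z => ?_)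
    exact (aug_totalMap hf z.1).trans (hF _).symm

variable (M) in
/-- The homomorphism on a component of the resolution with given values on generators. -/
def cochainHom (q : ℕ) (c : M ⊗[k] ExteriorAlgebra k g →ₗ[k] UniversalEnvelopingAlgebra k g) :
    (resolution b M).complex.X q ⟶
      ModuleCat.of (UniversalEnvelopingAlgebra k g) (UniversalEnvelopingAlgebra k g) :=
  ModuleCat.ofHom (X := component k g M q) (cochain c ∘ₗ (component k g M q).subtype)

lemma cochainHom_apply (q : ℕ)
    (c : M ⊗[k] ExteriorAlgebra k g →ₗ[k] UniversalEnvelopingAlgebra k g)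
    (z : component k g M q) : (cochainHom b M q c).hom z = cochain c z.1 := rfl

lemma hom_ext_component {q : ℕ} {Y : ModuleCat.{max u v} (UniversalEnvelopingAlgebra k g)}
    {F F' : (resolution b M).complex.X q ⟶ Y}
    (h : ∀ z : component k g M q, F.hom z = F'.hom z) : F = F' :=
  ModuleCat.hom_ext (LinearMap.ext h)

/-- Extend by the projection onto the component and restrict to generators. -/
lemma exists_cochainHom_eq {q : ℕ} (F : (resolution b M).complex.X q ⟶
      ModuleCat.of (UniversalEnvelopingAlgebra k g) (UniversalEnvelopingAlgebra k g)) :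
    ∃ c, cochainHom b M q c = F := by
  let F' : Total k g M →ₗ[UniversalEnvelopingAlgebra k g] UniversalEnvelopingAlgebra k g :=
    F.hom ∘ₗ toComponent k g M q
  let c : M ⊗[k] ExteriorAlgebra k g →ₗ[k] UniversalEnvelopingAlgebra k g :=
    F'.restrictScalars k ∘ₗ inc k g M
  have hc : cochain c = F' := hom_ext_inc fun l => cochain_inc c l
  refine ⟨c, hom_ext_component b fun z => ?_⟩
  rw [cochainHom_apply, hc]
  exact congrArg F.hom (toComponent_coe z)

lemma d_comp_cochainHom (q : ℕ)
    (c : M ⊗[k] ExteriorAlgebra k g →ₗ[k] UniversalEnvelopingAlgebra k g)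
    (z : component k g M (q + 1)) :
    ((resolution b M).complex.d (q + 1) q ≫ cochainHom b M q c).hom z =
      cochain c (diff (freeRep M.left) b z.1) := by
  have h : (resolution b M).complex.d (q + 1) q = _ := chainComplex_d b M q
  rw [h]
  exact congrArg (cochain c) (componentDiff_coe b M.left q z)

include b in
lemma component_eq_zero {q : ℕ} (hq : n < q) (z : component k g M q) : z = 0 := by
  have := Module.Finite.of_basis b
  refine Subtype.ext ?_
  rw [← mem_component.1 z.2]
  exact proj_eq_zero (by rwa [Module.finrank_eq_card_basis b, Fintype.card_fin]) _

/-- The resolution stops in degree `n`, so every cochain of degree `n` is a cocycle. -/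
lemma d_comp_eq_zero {Y : ModuleCat.{max u v} (UniversalEnvelopingAlgebra k g)}
    (F : (resolution b M).complex.X n ⟶ Y) : (resolution b M).complex.d (n + 1) n ≫ F = 0 :=
  hom_ext_component b fun z => by
    rw [component_eq_zero b (Nat.lt_succ_self n) z]
    exact (map_zero _).trans (map_zero _).symm

variable (M) in
/-- The class in `Extⁿ` of a cochain of top degree `n`. -/
def extClass (c : M ⊗[k] ExteriorAlgebra k g →ₗ[k] UniversalEnvelopingAlgebra k g) :
    ExtSpace n M :=
  (resolution b M).extMk (cochainHom b M n c) (n + 1) rfl (d_comp_eq_zero b _)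

lemma extClass_congr {c c' : M ⊗[k] ExteriorAlgebra k g →ₗ[k] UniversalEnvelopingAlgebra k g}
    (h : cochainHom b M n c = cochainHom b M n c') : extClass b M c = extClass b M c' := by
  unfold extClass
  congr 1

lemma cochain_add (c c' : M ⊗[k] ExteriorAlgebra k g →ₗ[k] UniversalEnvelopingAlgebra k g) :
    cochain (c + c') = cochain c + cochain c' := hom_ext_inc fun l => by
  simp only [LinearMap.add_apply, cochain_inc]

lemma extClass_add (c c' : M ⊗[k] ExteriorAlgebra k g →ₗ[k] UniversalEnvelopingAlgebra k g) :
    extClass b M (c + c') = extClass b M c + extClass b M c' := by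
  rw [extClass, extClass, extClass, ProjectiveResolution.add_extMk]
  congr 1
  exact hom_ext_component b fun z => LinearMap.congr_fun (cochain_add c c') z.1

lemma exists_extClass_eq (ξ : ExtSpace n M) : ∃ c, extClass b M c = ξ := by
  obtain ⟨F, hF, rfl⟩ := (resolution b M).extMk_surjective ξ (n + 1) rfl
  obtain ⟨c, rfl⟩ := exists_cochainHom_eq b F
  exact ⟨c, rfl⟩

lemma extClass_comp_regularRightEnd
    (c : M ⊗[k] ExteriorAlgebra k g →ₗ[k] UniversalEnvelopingAlgebra k g)
    (a : UniversalEnvelopingAlgebra k g) :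
    (extClass b M c).comp (Ext.mk₀ (regularRightEnd a)) (add_zero n) =
      extClass b M (LinearMap.mulRight k a ∘ₗ c) := by
  rw [extClass, extClass, ProjectiveResolution.extMk_comp_mk₀]
  congr 1
  refine hom_ext_component b fun z => ?_
  let F : UniversalEnvelopingAlgebra k g →ₗ[UniversalEnvelopingAlgebra k g]
      UniversalEnvelopingAlgebra k g := (regularRightEnd a).hom
  refine LinearMap.congr_fun (f := F ∘ₗ cochain c)
    (g := cochain (LinearMap.mulRight k a ∘ₗ c)) (hom_ext_inc fun l => ?_) z.1
  rw [cochain_inc, LinearMap.comp_apply, cochain_inc]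
  rfl

lemma extClass_smul (r : k)
    (c : M ⊗[k] ExteriorAlgebra k g →ₗ[k] UniversalEnvelopingAlgebra k g) :
    extClass b M (r • c) = r • extClass b M c := by
  -- The scalar action on Ext is realised as right multiplication of the coefficients by `r • 1`.
  have h := comp_regularRightEnd_smul (extClass b M c) r 1
  rw [regularRightEnd_one, Ext.comp_mk₀_id, extClass_comp_regularRightEnd] at h
  rw [← h]
  congr 1
  refine LinearMap.ext fun l => ?_
  simp

variable (M) in
/-- The class of a cochain of top degree as a linear map. -/
def extClassLin : (M ⊗[k] ExteriorAlgebra k g →ₗ[k] UniversalEnvelopingAlgebra k g) →ₗ[k]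
    ExtSpace n M where
  toFun := extClass b M
  map_add' := extClass_add b
  map_smul' := extClass_smul b

lemma extClassLin_apply
    (c : M ⊗[k] ExteriorAlgebra k g →ₗ[k] UniversalEnvelopingAlgebra k g) :
    extClassLin b M c = extClass b M c := rfl

lemma mk₀_comp_extClass (f : M →ₗ[k] M') (hf : ∀ a m, f (M.left a m) = M'.left a (f m))
    (F : (toLeft k _).obj M ⟶ (toLeft k _).obj M') (hF : ∀ m : M, F.hom m = f m)
    (c : M' ⊗[k] ExteriorAlgebra k g →ₗ[k] UniversalEnvelopingAlgebra k g) :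
    (Ext.mk₀ F).comp (extClass b M' c) (zero_add n) = extClass b M (c ∘ₗ f.rTensor _) := by
  rw [extClass, extClass, ProjectiveResolution.mk₀_comp_extMk _ _ _ _ (resolutionHom b f hf F hF)]
  congr 1
  exact hom_ext_component b fun z => cochain_totalMap f c z.1

lemma extClass_comp_proj
    (c : M ⊗[k] ExteriorAlgebra k g →ₗ[k] UniversalEnvelopingAlgebra k g) :
    extClass b M (c ∘ₗ proj k g M n) = extClass b M c :=
  extClass_congr b <| hom_ext_component b fun z => by
    rw [cochainHom_apply, cochainHom_apply, ← cochain_proj, mem_component.1 z.2]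

/-- Cartan's formula for `x ∧ z`, which vanishes because its exterior degree is `n + 1`. -/
lemma theta_eq_wedge_diff (x : g) (z : component k g M n) :
    theta (freeRep M.left) x z.1 = wedge _ x (diff (freeRep M.left) b z.1) := by
  have h := component_eq_zero b (Nat.lt_succ_self n) (M := M)
    ⟨wedge _ x z.1, by rw [mem_component, proj_succ_wedge, mem_component.1 z.2]⟩
  have h' : wedge _ x z.1 = 0 := congrArg Subtype.val h
  have := diff_wedge (freeRep M.left) b x z.1
  rwa [h', map_zero, eq_comm, sub_eq_zero] at this

/-- The difference of the two cochains is the coboundary of `c ∘ (x ∧ ·)`, by `theta_eq_wedge_diff`.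
-/
lemma extClass_comp_theta (x : g)
    (c : M ⊗[k] ExteriorAlgebra k g →ₗ[k] UniversalEnvelopingAlgebra k g) :
    extClass b M (c ∘ₗ theta (moduleRep M.left) x) =
      extClass b M (LinearMap.mulLeft k (UniversalEnvelopingAlgebra.ι k x) ∘ₗ c) := by
  rw [← sub_eq_zero, ← extClassLin_apply, ← extClassLin_apply, ← map_sub, extClassLin_apply]
  have key (z : component k g M n) : cochain (c ∘ₗ theta (moduleRep M.left) x -
      LinearMap.mulLeft k (UniversalEnvelopingAlgebra.ι k x) ∘ₗ c) z.1 =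
        cochain (c ∘ₗ wedge M x) (diff (freeRep M.left) b z.1) := by
    rw [← cochain_theta, theta_eq_wedge_diff b]
    generalize diff (freeRep M.left) b z.1 = y
    induction y using inc_induction with
    | add z z' h h' => simp only [map_add, h, h']
    | smul u l =>
      rw [wedge_smul_left, map_smul, map_smul, wedge_inc, cochain_inc, cochain_inc]
      rfl
  cases n with
  | zero =>
    -- For `n = 0` no cochain of lower degree exists, but then `g = 0` and both cochains vanish.
    have : Subsingleton g := b.repr.injective.subsingleton
    rw [Subsingleton.elim x 0]
    have h : theta (moduleRep M.left) (0 : g) = 0 := by simp [theta]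
    rw [h, LinearMap.comp_zero, map_zero, LinearMap.mulLeft_zero_eq_zero, LinearMap.zero_comp,
      sub_zero, ← extClassLin_apply, map_zero]
  | succ p =>
    rw [extClass, ProjectiveResolution.extMk_eq_zero_iff _ _ _ _ _ p rfl]
    refine ⟨cochainHom b M p (c ∘ₗ wedge M x), hom_ext_component b fun z => ?_⟩
    rw [d_comp_cochainHom, ← key]
    rfl

/-- A scalar cochain. -/
def scalarCochain (μ : Module.Dual k (M ⊗[k] ExteriorAlgebra k g)) :
    M ⊗[k] ExteriorAlgebra k g →ₗ[k] UniversalEnvelopingAlgebra k g :=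
  Algebra.linearMap k _ ∘ₗ μ

/-- A scalar coboundary has the shape required by `dual_eq_zero_of_sum`, with `c_i` the contraction
of the bounding cochain along the `i`-th coordinate, restricted to top degree. -/
lemma comp_proj_eq_zero_of_extClass [FiniteDimensional k M]
    (μ : Module.Dual k (M ⊗[k] ExteriorAlgebra k g)) (h : extClass b M (scalarCochain μ) = 0) :
    μ ∘ₗ proj k g M n = 0 := by
  have := Module.Finite.of_basis b
  cases n with
  | zero =>
    have h := eq_zero_of_extMk_eq_zero _ _ _ _ _ h
    refine LinearMap.ext fun l => ?_
    have h' : cochain (scalarCochain μ) (inc k g M (proj k g M 0 l)) = 0 :=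
      congrArg (fun F : (resolution b M).complex.X 0 ⟶ _ =>
        F.hom (⟨inc k g M (proj k g M 0 l), by rw [mem_component, proj_inc, proj_proj]⟩ :
          component k g M 0)) h
    rw [cochain_inc] at h'
    -- The counit `U → k`, which kills `g`, splits the inclusion of the scalars.
    refine Function.LeftInverse.injective
      (UniversalEnvelopingAlgebra.lift k (0 : g →ₗ⁅k⁆ k)).commutes ?_
    exact h'.trans (map_zero _).symm
  | succ p =>
    rw [extClass, ProjectiveResolution.extMk_eq_zero_iff _ _ _ _ _ p rfl] at h
    obtain ⟨F, hF⟩ := h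
    obtain ⟨c, rfl⟩ := exists_cochainHom_eq b F
    refine dual_eq_zero_of_sum M.left b _
      (fun i => (c ∘ₗ (contract (b.coord i)).lTensor M) ∘ₗ proj k g M (p + 1)) fun l => ?_
    let z : component k g M (p + 1) :=
      ⟨inc k g M (proj k g M (p + 1) l), by rw [mem_component, proj_inc, proj_proj]⟩
    have h : cochain (scalarCochain μ) z.1 = cochain c (diff (freeRep M.left) b z.1) :=
      (congrArg (fun F => F.hom z) hF).symm.trans (d_comp_cochainHom b p c z)
    -- `d z` has degree `n - 1`, so its value under `c` is a sum over `b_i ∧ d z`, that is, over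
    -- `θ_{b_i} z`.
    rw [cochain_eq_sum b c p (by simp)
      (by rw [← diff_proj_succ, mem_component.1 z.2])] at h
    simp only [← theta_eq_wedge_diff b, cochain_theta] at h
    simp only [z, cochain_inc] at h
    refine Eq.trans h (Finset.sum_congr rfl fun i _ => ?_)
    rw [LinearMap.sub_apply]
    simp only [LinearMap.comp_apply, proj_theta]
    rfl

end ChevalleyEilenberg

/-! ### The pairing of exterior powers -/

/-- By Cramer's rule the two sides are the traces of `adj(A) B` and `B adj(A)`. -/
lemma Matrix.sum_det_updateCol_eq_sum_det_updateRow {n R : Type*} [Fintype n] [DecidableEq n]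
    [CommRing R] (A B : Matrix n n R) :
    ∑ j, (A.updateCol j fun i => B i j).det = ∑ i, (A.updateRow i fun j => B i j).det := by
  have h1 (j : n) : (A.updateCol j fun i => B i j).det = (A.adjugate * B) j j := by
    rw [← Matrix.cramer_apply, Matrix.cramer_eq_adjugate_mulVec]
    rfl
  have h2 (i : n) : (A.updateRow i fun j => B i j).det = (B * A.adjugate) i i := by
    rw [← Matrix.det_transpose, ← Matrix.updateCol_transpose, ← Matrix.cramer_apply,
      Matrix.cramer_eq_adjugate_mulVec, ← Matrix.adjugate_transpose, Matrix.mulVec_transpose]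
    rfl
  simp only [h1, h2]
  exact Matrix.trace_mul_comm _ _

namespace exteriorPower

variable {k V : Type*} [Field k] [AddCommGroup V] [Module k V] {n : ℕ}

/-- The pairing of decomposable elements is a determinant whose columns belong to the forms and rows
to the vectors. One derivation changes columns, the other rows, and the two sums of determinants
agree. -/
lemma pairingDual_derivation (φ : Module.End k V) (ω : ⋀[k]^n (Module.Dual k V)) (w : ⋀[k]^n V) :
    pairingDual k V n (derivation n φ.dualMap ω) w = pairingDual k V n ω (derivation n φ w) := by
  refine LinearMap.congr_fun (LinearMap.congr_fun
    (f := pairingDual k V n ∘ₗ derivation n φ.dualMap)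
    (g := (derivation n φ).dualMap ∘ₗ pairingDual k V n)
    (linearMap_ext (AlternatingMap.ext fun f => linearMap_ext (AlternatingMap.ext fun v => ?_)))
    ω) w
  change pairingDual k V n (derivation n φ.dualMap (ιMulti k n f)) (ιMulti k n v) =
    pairingDual k V n (ιMulti k n f) (derivation n φ (ιMulti k n v))
  rw [derivation_ιMulti, derivation_ιMulti, map_sum, map_sum, LinearMap.sum_apply]
  simp only [pairingDual_ιMulti_ιMulti]
  refine Eq.trans ?_ ((Matrix.sum_det_updateCol_eq_sum_det_updateRow
    (Matrix.of fun i j => f j (v i)) (Matrix.of fun i j => f j (φ (v i)))).trans ?_)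
  · refine Finset.sum_congr rfl fun l _ => congrArg Matrix.det (Matrix.ext fun i j => ?_)
    rcases eq_or_ne j l with rfl | h <;> simp [*]
  · refine Finset.sum_congr rfl fun l _ => congrArg Matrix.det (Matrix.ext fun i j => ?_)
    rcases eq_or_ne i l with rfl | h <;> simp [*]

/-- In top degree both spaces are lines, and the pairing takes the value `1` on dual bases. No
factorial is inverted. -/
lemma pairingDual_bijective (b : Module.Basis (Fin n) k V) :
    Function.Bijective (pairingDual k V n) := by
  have := Module.Finite.of_basis b
  have h1 : Module.finrank k (⋀[k]^n (Module.Dual k V)) = 1 := by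
    rw [finrank_eq, Subspace.dual_finrank_eq, Module.finrank_eq_card_basis b, Fintype.card_fin,
      Nat.choose_self]
  have h2 : Module.finrank k (Module.Dual k (⋀[k]^n V)) = 1 := by
    rw [Subspace.dual_finrank_eq, finrank_eq, Module.finrank_eq_card_basis b, Fintype.card_fin,
      Nat.choose_self]
  have h0 : pairingDual k V n ≠ 0 := fun h => by
    have h' := pairingDual_apply_apply_eq_one b b.coord (by simp)
      (fun i j hij => by simp [Finsupp.single_eq_of_ne hij]) n (RelEmbedding.refl _)
    rw [h] at h'
    exact zero_ne_one h'
  have hs := surjective_of_nonzero_of_finrank_eq_one h2 h0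
  exact ⟨(LinearMap.injective_iff_surjective_of_finrank_eq_finrank (h1.trans h2.symm)).2 hs, hs⟩

end exteriorPower

/-! ### Forms on the generators and the comparison map. -/

namespace ChevalleyEilenberg

open CentralBimod

section

variable {k : Type u} {g : Type v} [Field k] [LieRing g] [LieAlgebra k g] {n : ℕ}

lemma deriv_ιMulti (φ : Module.End k g) (v : Fin n → g) :
    deriv φ (ExteriorAlgebra.ιMulti k n v) =
      ∑ i, ExteriorAlgebra.ιMulti k n (Function.update v i (φ (v i))) := by
  induction n with
  | zero => simp [deriv_one]
  | succ n ih =>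
    rw [ExteriorAlgebra.ιMulti_succ_apply, deriv_ι_mul, Fin.sum_univ_succ, ih, Finset.mul_sum,
      ExteriorAlgebra.ιMulti_succ_apply]
    refine congrArg₂ (· + ·) ?_ (Finset.sum_congr rfl fun i _ => ?_)
    · rw [Function.update_self]
      congr 2
    · rw [ExteriorAlgebra.ιMulti_succ_apply, Function.update_of_ne (Fin.succ_ne_zero i).symm]
      congr 2
      refine funext fun j => ?_
      rcases eq_or_ne j i with rfl | h
      · simp [Matrix.vecTail]
      · simp [Matrix.vecTail, Function.update_of_ne h,
          Function.update_of_ne (fun h' => h (Fin.succ_injective _ h'))]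

lemma adExt_coe (x : g) (w : ⋀[k]^n g) :
    adExt k g x w = (exteriorPower.derivation n (LieAlgebra.ad k g x) w : ⋀[k]^n g) := by
  refine LinearMap.congr_fun (f := adExt k g x ∘ₗ (⋀[k]^n g).subtype)
    (g := (⋀[k]^n g).subtype ∘ₗ exteriorPower.derivation n (LieAlgebra.ad k g x))
    (exteriorPower.linearMap_ext (AlternatingMap.ext fun v => ?_)) w
  change adExt k g x (exteriorPower.ιMulti k n v : ⋀[k]^n g) =
    (exteriorPower.derivation n (LieAlgebra.ad k g x) (exteriorPower.ιMulti k n v) : ⋀[k]^n g)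
  rw [exteriorPower.derivation_ιMulti, exteriorPower.ιMulti_apply_coe]
  refine (deriv_ιMulti _ v).trans ?_
  simp

lemma extProj_adExt (q : ℕ) (x : g) (w : ExteriorAlgebra k g) :
    extProj k g q (adExt k g x w) = adExt k g x (extProj k g q w) := by
  have h := proj_theta (0 : g →ₗ⁅k⁆ Module.End k k) q x (1 ⊗ₜ[k] w)
  simp only [theta_tmul, proj_tmul, LieHom.zero_apply, LinearMap.zero_apply, zero_tmul,
    zero_add] at h
  simpa using congrArg (TensorProduct.lid k _) h

/-- The projection of the exterior algebra to an exterior power. -/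
def toPower (k : Type u) (g : Type v) [Field k] [LieRing g] [LieAlgebra k g] (n : ℕ) :
    ExteriorAlgebra k g →ₗ[k] ⋀[k]^n g :=
  (extProj k g n).codRestrict _ (extProj_mem n)

lemma toPower_coe (w : ⋀[k]^n g) : toPower k g n w = w := Subtype.ext (extProj_of_mem w.2)

lemma toPower_extProj (w : ExteriorAlgebra k g) :
    toPower k g n (extProj k g n w) = toPower k g n w :=
  toPower_coe (toPower k g n w)

lemma toPower_adExt (x : g) (w : ExteriorAlgebra k g) : toPower k g n (adExt k g x w) =
    exteriorPower.derivation n (LieAlgebra.ad k g x) (toPower k g n w) :=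
  Subtype.ext ((extProj_adExt n x w).trans (adExt_coe x (toPower k g n w)))

variable (M : Type*) [AddCommGroup M] [Module k M]

/-- The linear form on `M ⊗ ⋀ g` given by a linear form on `M` and an exterior form. -/
def toForm (k : Type u) (g : Type v) [Field k] [LieRing g] [LieAlgebra k g] (n : ℕ) (M : Type*)
    [AddCommGroup M] [Module k M] : Module.Dual k M ⊗[k] ⋀[k]^n (Module.Dual k g) →ₗ[k]
      Module.Dual k (M ⊗[k] ExteriorAlgebra k g) :=
  ((toPower k g n).lTensor M).dualMap ∘ₗ TensorProduct.dualDistrib k M (⋀[k]^n g) ∘ₗ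
    (exteriorPower.pairingDual k g n).lTensor (Module.Dual k M)

variable {M}

lemma toForm_tmul (f : Module.Dual k M) (ω : ⋀[k]^n (Module.Dual k g)) (m : M)
    (w : ExteriorAlgebra k g) : toForm k g n M (f ⊗ₜ ω) (m ⊗ₜ w) =
      f m * exteriorPower.pairingDual k g n ω (toPower k g n w) := rfl

lemma toForm_injective [FiniteDimensional k M] (b : Module.Basis (Fin n) k g) :
    Function.Injective (toForm k g n M) := by
  have := Module.Finite.of_basis b
  have h1 : Function.Injective ((toPower k g n).lTensor M).dualMap :=
    LinearMap.dualMap_injective_of_surjective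
      (LinearMap.lTensor_surjective M fun w => ⟨w, toPower_coe w⟩)
  have h2 : Function.Injective (TensorProduct.dualDistrib k M (⋀[k]^n g)) :=
    (TensorProduct.dualDistribEquiv k M (⋀[k]^n g)).injective
  have h3 : Function.Injective ((exteriorPower.pairingDual k g n).lTensor (Module.Dual k M)) :=
    Module.Flat.lTensor_preserves_injective_linearMap _ (exteriorPower.pairingDual_bijective b).1
  exact h1.comp (h2.comp h3)

lemma exists_toForm_eq [FiniteDimensional k M] (b : Module.Basis (Fin n) k g)
    (μ : Module.Dual k (M ⊗[k] ExteriorAlgebra k g)) :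
    ∃ t, toForm k g n M t = μ ∘ₗ proj k g M n := by
  have := Module.Finite.of_basis b
  obtain ⟨s, hs⟩ := (TensorProduct.dualDistribEquiv k M (⋀[k]^n g)).surjective
    (μ ∘ₗ (⋀[k]^n g).subtype.lTensor M)
  obtain ⟨t, rfl⟩ := LinearMap.lTensor_surjective (Module.Dual k M)
    (exteriorPower.pairingDual_bijective b).2 s
  refine ⟨t, TensorProduct.ext' fun m w => ?_⟩
  exact LinearMap.congr_fun hs (m ⊗ₜ toPower k g n w)

lemma toForm_proj (t : Module.Dual k M ⊗[k] ⋀[k]^n (Module.Dual k g)) :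
    toForm k g n M t ∘ₗ proj k g M n = toForm k g n M t := by
  refine TensorProduct.ext' fun m w => ?_
  rw [LinearMap.comp_apply, proj_tmul]
  induction t using TensorProduct.induction_on with
  | zero => rw [map_zero, LinearMap.zero_apply, LinearMap.zero_apply]
  | add t t' h h' => rw [map_add, LinearMap.add_apply, LinearMap.add_apply, h, h']
  | tmul f ω => rw [toForm_tmul, toForm_tmul, toPower_extProj]

lemma toForm_dualMap {M' : Type*} [AddCommGroup M'] [Module k M'] (f : M →ₗ[k] M')
    (t : Module.Dual k M' ⊗[k] ⋀[k]^n (Module.Dual k g)) :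
    toForm k g n M (f.dualMap.rTensor _ t) = toForm k g n M' t ∘ₗ f.rTensor _ := by
  refine TensorProduct.ext' fun m w => ?_
  induction t using TensorProduct.induction_on with
  | zero => simp
  | add t t' h h' =>
    rw [map_add, map_add, map_add, LinearMap.add_apply, h, h', LinearMap.add_comp,
      LinearMap.add_apply]
  | tmul e ω => rfl

/-- The transpose of `θ_x` is the right action on `M* ⊗ ⋀ⁿ g*`: the action on `M` transposes to
`M*`, and the adjoint action to the coadjoint one by `pairingDual_derivation`. -/
lemma toForm_theta (φ : UniversalEnvelopingAlgebra k g →ₐ[k] Module.End k M) (x : g)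
    (t : Module.Dual k M ⊗[k] ⋀[k]^n (Module.Dual k g)) :
    toForm k g n M ((φ (UniversalEnvelopingAlgebra.ι k x)).dualMap.rTensor _ t +
      (exteriorPower.derivation n (LieAlgebra.ad k g x).dualMap).lTensor _ t) =
        toForm k g n M t ∘ₗ theta (moduleRep φ) x := by
  refine TensorProduct.ext' fun m w => ?_
  induction t using TensorProduct.induction_on with
  | zero => simp
  | add t t' h h' =>
    simp only [map_add, LinearMap.add_comp, LinearMap.add_apply] at h h' ⊢
    rw [add_add_add_comm, h, h']
  | tmul e ω =>
    rw [LinearMap.rTensor_tmul, LinearMap.lTensor_tmul, map_add, LinearMap.add_apply, toForm_tmul,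
      toForm_tmul, LinearMap.comp_apply, theta_tmul, map_add, toForm_tmul, toForm_tmul,
      exteriorPower.pairingDual_derivation, toPower_adExt]
    rfl

end

variable {k : Type u} {g : Type v} [Field k] [LieRing g] [LieAlgebra k g]
  {n : ℕ} (b : Module.Basis (Fin n) k g)

lemma scalarCochain_apply {M : CentralBimod.{u, max u v} k (UniversalEnvelopingAlgebra k g)}
    (μ : Module.Dual k (M ⊗[k] ExteriorAlgebra k g)) (l : M ⊗[k] ExteriorAlgebra k g) :
    scalarCochain μ l = algebraMap k _ (μ l) := rfl

section

variable (M : CentralBimod.{u, max u v} k (UniversalEnvelopingAlgebra k g))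

/-- The map from the twisted dual to `Extⁿ`. -/
def toExtLin : Module.Dual k M ⊗[k] ⋀[k]^n (Module.Dual k g) →ₗ[k] ExtSpace n M where
  toFun t := extClass b M (scalarCochain (toForm k g n M t))
  map_add' t t' := by
    rw [← extClass_add, map_add]
    exact congrArg _ (LinearMap.comp_add _ _ _)
  map_smul' r t := by
    rw [← extClass_smul, map_smul]
    exact congrArg _ (LinearMap.comp_smul _ _ _)

variable {M}

lemma toExtLin_apply (t : Module.Dual k M ⊗[k] ⋀[k]^n (Module.Dual k g)) :
    toExtLin b M t = extClass b M (scalarCochain (toForm k g n M t)) := rfl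

/-- Used twice: right multiplications on `M` as `f` give compatibility with the left actions, and
bimodule maps as `f` give naturality. -/
lemma toExtLin_dualMap {M' : CentralBimod.{u, max u v} k (UniversalEnvelopingAlgebra k g)}
    (f : M →ₗ[k] M') (hf : ∀ a m, f (M.left a m) = M'.left a (f m))
    (F : (toLeft k _).obj M ⟶ (toLeft k _).obj M') (hF : ∀ m : M, F.hom m = f m)
    (t : Module.Dual k M' ⊗[k] ⋀[k]^n (Module.Dual k g)) :
    toExtLin b M (f.dualMap.rTensor _ t) =
      (Ext.mk₀ F).comp (toExtLin b M' t) (zero_add n) := by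
  rw [toExtLin_apply, toExtLin_apply, mk₀_comp_extClass b f hf F hF, toForm_dualMap]
  rfl

/-- Right and left multiplication by `x` agree on a scalar cochain, and `extClass_comp_theta` trades
the latter for precomposition with `θ_x`. -/
lemma toExtLin_right (x : g) (t : Module.Dual k M ⊗[k] ⋀[k]^n (Module.Dual k g)) :
    toExtLin b M ((M.left (UniversalEnvelopingAlgebra.ι k x)).dualMap.rTensor _ t +
      (exteriorPower.derivation n (LieAlgebra.ad k g x).dualMap).lTensor _ t) =
        extRight n M (op (UniversalEnvelopingAlgebra.ι k x)) (toExtLin b M t) := by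
  have h (μ : Module.Dual k (M ⊗[k] ExteriorAlgebra k g)) :
      scalarCochain (μ ∘ₗ theta (moduleRep M.left) x) =
        scalarCochain μ ∘ₗ theta (moduleRep M.left) x := rfl
  rw [toExtLin_apply, toForm_theta, extRight_apply, unop_op, toExtLin_apply,
    extClass_comp_regularRightEnd, h, extClass_comp_theta]
  refine congrArg (extClass b M) (LinearMap.ext fun l => ?_)
  exact (Algebra.commutes (R := k) (toForm k g n M t l) (UniversalEnvelopingAlgebra.ι k x)).symm

lemma toExtLin_injective [FiniteDimensional k M] : Function.Injective (toExtLin b M) := by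
  intro t t' h
  have h' : extClass b M (scalarCochain (toForm k g n M (t - t'))) = 0 := by
    rw [← toExtLin_apply, map_sub, h, sub_self]
  have := comp_proj_eq_zero_of_extClass b (toForm k g n M (t - t')) h'
  rw [toForm_proj] at this
  exact sub_eq_zero.1 (toForm_injective b (this.trans (map_zero _).symm))

variable (M) in
lemma twistRight_dual_ι (x : g) (t : Module.Dual k M ⊗[k] ⋀[k]^n (Module.Dual k g)) :
    twistRight M.dual (coadjointRight k g n) (op (UniversalEnvelopingAlgebra.ι k x)) t =
      (M.left (UniversalEnvelopingAlgebra.ι k x)).dualMap.rTensor _ t +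
        (exteriorPower.derivation n (LieAlgebra.ad k g x).dualMap).lTensor _ t := by
  refine LinearMap.congr_fun
    (f := (twistRight M.dual (coadjointRight k g n) (op (UniversalEnvelopingAlgebra.ι k x)) :
      Module.End k (Module.Dual k M ⊗[k] ⋀[k]^n (Module.Dual k g))))
    (g := (M.left (UniversalEnvelopingAlgebra.ι k x)).dualMap.rTensor _ +
      (exteriorPower.derivation n (LieAlgebra.ad k g x).dualMap).lTensor _)
    (TensorProduct.ext' fun f ω => ?_) t
  exact twistRight_ι M.dual (coadjointRight k g n) x f ω

variable (M) in
/-- The map from the twisted dual to `Extⁿ`, as a homomorphism of bimodules. -/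
def toExt : M.dual.twist (coadjointRight k g n) ⟶ (extFunctor k _ n).obj (Opposite.op M) where
  toLin := toExtLin b M
  map_left a t := toExtLin_dualMap b (M.right (op a)) (fun a' m => (M.comm a' (op a) m).symm)
    (rightEnd M a) (fun _ => rfl) t
  map_right a t := LinearMap.congr_fun (comp_eq_of_ι
    (V := Module.Dual k M ⊗[k] ⋀[k]^n (Module.Dual k g)) (V' := ExtSpace n M)
    (twistRight M.dual (coadjointRight k g n)) (extRight n M) (toExtLin b M)
    (fun x => LinearMap.ext fun t =>
      (congrArg (toExtLin b M) (twistRight_dual_ι M x t)).trans (toExtLin_right b x t)) a) t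

/-- Expanding in a basis of `M ⊗ ⋀ g` writes any cochain as a sum of scalar cochains multiplied on
the right by its values on that basis. -/
lemma toExtLin_surjective [FiniteDimensional k M] : Function.Surjective (toExtLin b M) := by
  have := Module.Finite.of_basis b
  rw [← LinearMap.range_eq_top]
  refine eq_top_iff.2 fun ξ _ => ?_
  obtain ⟨c, rfl⟩ := exists_extClass_eq b ξ
  let e := Module.finBasis k (M ⊗[k] ExteriorAlgebra k g)
  have hc : c = ∑ i, LinearMap.mulRight k (c (e i)) ∘ₗ scalarCochain (e.coord i) := by
    refine e.ext fun j => ?_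
    simp only [LinearMap.sum_apply, LinearMap.comp_apply, scalarCochain_apply,
      LinearMap.mulRight_apply, Module.Basis.coord_apply, Module.Basis.repr_self]
    rw [Finset.sum_eq_single j (fun i _ h => by simp [Finsupp.single_eq_of_ne h]) (by simp)]
    simp
  rw [hc, ← extClassLin_apply, map_sum]
  refine Submodule.sum_mem _ fun i _ => ?_
  obtain ⟨t, ht⟩ := exists_toForm_eq b (e.coord i)
  rw [extClassLin_apply, ← extClass_comp_regularRightEnd, ← extClass_comp_proj]
  -- The preimage of the scalar class, moved by the right action: `toExt` is right linear for all of
  -- `U`.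
  refine ⟨(M.dual.twist (coadjointRight k g n)).right (op (c (e i))) t, ?_⟩
  refine ((toExt b M).map_right _ t).trans ?_
  refine congrArg (extRight n M (op (c (e i)))) ?_
  change extClass b M (scalarCochain (toForm k g n M t)) = _
  rw [ht]
  rfl

end

/-- A bijective homomorphism of bimodules is an isomorphism. -/
def _root_.CentralBimod.isoOfBijective {k : Type u} {A : Type w} [Field k] [Ring A] [Algebra k A]
    {M N : CentralBimod k A} (f : M ⟶ N) (hf : Function.Bijective f.toLin) : M ≅ N :=
  let e := LinearEquiv.ofBijective f.toLin hf
  { hom := f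
    inv := ⟨e.symm.toLinearMap,
      fun a m => e.symm_apply_eq.2
        ((f.map_left a _).trans (congrArg _ (e.apply_symm_apply m))).symm,
      fun a m => e.symm_apply_eq.2
        ((f.map_right a _).trans (congrArg _ (e.apply_symm_apply m))).symm⟩
    hom_inv_id := hom_ext e.symm_apply_apply
    inv_hom_id := hom_ext e.apply_symm_apply }

end ChevalleyEilenberg

end

theorem corollary2p2 (k : Type u) (g : Type v) [Field k] [LieRing g] [LieAlgebra k g]
    [FiniteDimensional k g] :
    Nonempty
      ((CentralBimod.finDim k (UniversalEnvelopingAlgebra k g)).ι.op ⋙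
          CentralBimod.extFunctor k (UniversalEnvelopingAlgebra k g) (Module.finrank k g) ≅
        (CentralBimod.finDim k (UniversalEnvelopingAlgebra k g)).ι.op ⋙
          CentralBimod.dualFunctor k (UniversalEnvelopingAlgebra k g) ⋙
            CentralBimod.twistFunctor (coadjointRight k g (Module.finrank k g))) := by
  let b := Module.finBasis k g
  -- The isomorphism is built from the twisted dual to Ext, the direction in which an explicit
  -- formula exists, and then inverted.
  refine ⟨(NatIso.ofComponents
    (fun (M : (CentralBimod.finDim k (UniversalEnvelopingAlgebra k g)).FullSubcategoryᵒᵖ) =>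
    have : FiniteDimensional k M.unop.obj := M.unop.property
    CentralBimod.isoOfBijective (ChevalleyEilenberg.toExt b M.unop.obj)
      ⟨ChevalleyEilenberg.toExtLin_injective b, ChevalleyEilenberg.toExtLin_surjective b⟩) fun {M N} f => ?_).symm⟩
  exact CentralBimod.hom_ext fun t =>
    ChevalleyEilenberg.toExtLin_dualMap b f.unop.hom.toLin f.unop.hom.map_left
      ((CentralBimod.toLeft k _).map f.unop.hom) (fun _ => rfl) t
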